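/- All vector spaces, tensor products and algebras are over $\mathbb{Q}$. Let $\mathfrak{h}=\bigoplus_{i\in\mathbb{Z}}\mathfrak{h}^i$ be a differential graded Lie algebra (bracket of degree $0$, differential $\delta$ of degree $+1$) which is nilpotent (its lower central series $F^0=\mathfrak h$, $F^{i+1}=[\mathfrak{h},F^i]$ vanishes for large $i$) and satisfies $\mathfrak{h}^i=0$ for $i<-1$. The Deligne–Getzler 2-groupoid $\mathrm{MC}^2(\mathfrak{h})$ is the following strict 2-groupoid. * Objects: elements $\gamma\in\mathfrak{h}^1$ with $\delta\gamma+\frac12[\gamma,\gamma]=0$. * 1-morphisms $\gamma_1\to\gamma_2$: elements $\exp X$ of the unipotent group $\exp(\mathfrak{h}^0)$ with $(\exp X)\cdot\gamma_1=\gamma_2$, where $(\exp X)\cdot\gamma=\gamma-\sum_{i\ge 0}\frac{(\mathrm{ad}X)^i}{(i+1)!}(\delta X+[\gamma,X])$; the composite of $\exp X:\gamma_1\to\gamma_2$ and $\exp Y:\gamma_2\to\gamma_3$ is the product $\exp Y\exp X$ in $\exp(\mathfrak{h}^0)$. * 2-morphisms $\exp X\Rightarrow\exp Y$ between 1-morphisms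 $\gamma_1\to\gamma_2$: elements $\exp_{\gamma_2}t$ of the unipotent group $\exp_{\gamma_2}(\mathfrak{h}^{-1})$ of the nilpotent Lie algebra $\mathfrak{h}^{-1}$ with bracket $[a,b]_{\gamma_2}=[a,\delta b+[\gamma_2,b]]$, such that $\exp(\delta t+[\gamma_2,t])\exp X=\exp Y$. Vertical composition is the product in $\exp_{\gamma_2}(\mathfrak{h}^{-1})$, and the horizontal composite of $\exp_{\gamma_2}t_{12}:\exp X_{12}\Rightarrow\exp Y_{12}$ (between 1-morphisms $\gamma_1\to\gamma_2$) and $\exp_{\gamma_3}t_{23}:\exp X_{23}\Rightarrow\exp Y_{23}$ (between 1-morphisms $\gamma_2\to\gamma_3$) is $\exp_{\gamma_3}t_{23}\,\exp_{\gamma_3}(e^{\mathrm{ad}X_{23}}t_{12})$. For $n\ge 0$ let $\Omega_n=\mathbb{Q}[t_1,\dots,t_n,dt_1,\dots,dt_n]$ be the commutative DGA of polynomial differential forms on the simplex $\Delta^n$, and let $\Omega_n\otimes\mathfrak{h}$ be the DGLA with $(\Omega_n\otimes\mathfrak{h})^i=\bigoplus_p\Omega_n^p\otimes\mathfrak{h}^{i-p}$,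 bracket $[\omega\otimes x,\eta\otimes y]=(-1)^{|x||\eta|}\omega\eta\otimes[x,y]$ and differential $\omega\otimes x\mapsto d\omega\otimes x+(-1)^{|\omega|}\omega\otimes\delta x$; it is again nilpotent and concentrated in degrees $\ge -1$. **Proposition.** For every $n\ge 0$, the strict 2-functor $$\mathrm{MC}^2(\mathfrak{h})\to\mathrm{MC}^2(\Omega_n\otimes\mathfrak{h})$$ induced by the inclusion of constants $x\mapsto 1\otimes x$ is an equivalence of 2-groupoids: every object of $\mathrm{MC}^2(\Omega_n\otimes\mathfrak{h})$ is equivalent to the image of an object of $\mathrm{MC}^2(\mathfrak{h})$, and for all objects $\mu,\nu$ of $\mathrm{MC}^2(\mathfrak{h})$ the induced functor $\mathrm{Hom}(\mu,\nu)\to\mathrm{Hom}(1\otimes\mu,1\otimes\nu)$ is an equivalence of groupoids. In particular, for every Maurer–Cartan element $\mu$ of $\mathfrak{h}$ the functor $$\mathrm{Hom}_{\mathrm{MC}^2(\mathfrak{h})}(\mu,\mu)\to\mathrm{Hom}_{\mathrm{MC}^2(\Omega_n\otimes\mathfrak{h})}(1\otimes\mu,1\otimes\mu)$$ is an equivalence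 of groupoids. -/

import Mathlib

open scoped TensorProduct
set_option linter.unusedSectionVars false

noncomputable section
namespace Deligne

section NilEval
variable {A B : Type*} [Ring A] [Algebra ℚ A] [Ring B] [Algebra ℚ B]

/-- The value `∑ᵢ fᵢ aⁱ` of a rational formal power series at a nilpotent element. -/
def nilEval (f : PowerSeries ℚ) (a : A) : A :=
  ∑ i ∈ Finset.range (nilpotencyClass a), PowerSeries.coeff i f • a ^ i

theorem nilEval_eq_sum (f : PowerSeries ℚ) {a : A} {k : ℕ} (h : a ^ k = 0) :
    nilEval f a = ∑ i ∈ Finset.range k, PowerSeries.coeff i f • a ^ i := by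
  have hle : nilpotencyClass a ≤ k := csInf_le' h
  refine Finset.sum_subset (Finset.range_mono hle) fun i _ hi => ?_
  have : nilpotencyClass a ≤ i := by simpa using hi
  rw [pow_eq_zero_of_le this (pow_nilpotencyClass ⟨k, h⟩), smul_zero]

theorem aeval_eq_nilEval (p : Polynomial ℚ) {a : A} {k : ℕ} (h : a ^ k = 0) :
    Polynomial.aeval a p = ∑ i ∈ Finset.range k, p.coeff i • a ^ i := by
  rw [Polynomial.aeval_eq_sum_range' (n := max k (p.natDegree + 1)) (by omega)]
  symm
  refine Finset.sum_subset (Finset.range_mono (le_max_left _ _)) fun i _ hi => ?_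
  have : k ≤ i := by simpa using hi
  rw [pow_eq_zero_of_le this h, smul_zero]

theorem nilEval_add (f g : PowerSeries ℚ) (a : A) :
    nilEval (f + g) a = nilEval f a + nilEval g a := by
  simp [nilEval, add_smul, Finset.sum_add_distrib]

theorem nilEval_sub (f g : PowerSeries ℚ) (a : A) :
    nilEval (f - g) a = nilEval f a - nilEval g a := by
  simp [nilEval, sub_smul, Finset.sum_sub_distrib]

theorem nilEval_smul (c : ℚ) (f : PowerSeries ℚ) (a : A) :
    nilEval (c • f) a = c • nilEval f a := by
  simp [nilEval, mul_smul, Finset.smul_sum]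

theorem nilEval_sum {ι : Type*} (s : Finset ι) (f : ι → PowerSeries ℚ) (a : A) :
    nilEval (∑ i ∈ s, f i) a = ∑ i ∈ s, nilEval (f i) a := by
  classical
  induction s using Finset.induction_on with
  | empty => simp [nilEval]
  | insert i s hi ih => rw [Finset.sum_insert hi, Finset.sum_insert hi, nilEval_add, ih]

theorem nilEval_mul (f g : PowerSeries ℚ) {a : A} (ha : IsNilpotent a) :
    nilEval (f * g) a = nilEval f a * nilEval g a := by
  obtain ⟨k, h⟩ := ha
  have key : ∀ f : PowerSeries ℚ, nilEval f a = Polynomial.aeval a (PowerSeries.trunc k f) := by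
    intro f
    rw [nilEval_eq_sum f h, aeval_eq_nilEval _ h]
    refine Finset.sum_congr rfl fun i hi => ?_
    rw [PowerSeries.coeff_trunc, if_pos (Finset.mem_range.1 hi)]
  rw [key f, key g, ← map_mul, nilEval_eq_sum _ h, aeval_eq_nilEval _ h]
  refine Finset.sum_congr rfl fun i hi => ?_
  rw [PowerSeries.coeff_mul_eq_coeff_trunc_mul_trunc _ _ (Finset.mem_range.1 hi),
    ← Polynomial.coe_mul, Polynomial.coeff_coe]

theorem nilEval_one {a : A} (ha : IsNilpotent a) : nilEval 1 a = 1 := by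
  obtain ⟨k, h⟩ := ha
  rw [nilEval_eq_sum 1 (pow_eq_zero_of_le (Nat.le_succ k) h), Finset.sum_range_succ']
  simp [PowerSeries.coeff_one]

theorem nilEval_X {a : A} (ha : IsNilpotent a) : nilEval PowerSeries.X a = a := by
  obtain ⟨k, h⟩ := ha
  rw [nilEval_eq_sum _ (pow_eq_zero_of_le (show k ≤ k + 2 by omega) h), Finset.sum_range_succ',
    Finset.sum_range_succ']
  simp [PowerSeries.coeff_X]

theorem nilEval_pow (f : PowerSeries ℚ) {a : A} (ha : IsNilpotent a) (n : ℕ) :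
    nilEval (f ^ n) a = nilEval f a ^ n := by
  induction n with
  | zero => simp [nilEval_one ha]
  | succ n ih => rw [pow_succ, nilEval_mul _ _ ha, ih, pow_succ]

theorem map_nilEval (φ : A →ₐ[ℚ] B) (f : PowerSeries ℚ) {a : A} (ha : IsNilpotent a) :
    φ (nilEval f a) = nilEval f (φ a) := by
  obtain ⟨k, h⟩ := ha
  have h' : φ a ^ k = 0 := by rw [← map_pow, h, map_zero]
  simp [nilEval_eq_sum f h, nilEval_eq_sum f h']

theorem nilEval_commute (f : PowerSeries ℚ) {a b : A} (h : Commute a b) :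
    Commute (nilEval f a) b :=
  Commute.sum_left _ _ _ fun _ _ => ((h.pow_left _).smul_left _)

theorem nilEval_intertwine {M N : Type*} [AddCommGroup M] [Module ℚ M] [AddCommGroup N]
    [Module ℚ N] (T : M →ₗ[ℚ] N) (f : PowerSeries ℚ) {a : Module.End ℚ M} {b : Module.End ℚ N}
    (ha : IsNilpotent a) (hb : IsNilpotent b) (h : ∀ m, T (a m) = b (T m)) (m : M) :
    T (nilEval f a m) = nilEval f b (T m) := by
  obtain ⟨k, hk⟩ := ha
  obtain ⟨l, hl⟩ := hb
  have hp : ∀ i m, T ((a ^ i) m) = (b ^ i) (T m) := by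
    intro i
    induction i with
    | zero => simp
    | succ i ih => intro m; simp [pow_succ, ih, h]
  rw [nilEval_eq_sum f (pow_eq_zero_of_le (le_max_left k l) hk),
    nilEval_eq_sum f (pow_eq_zero_of_le (le_max_right k l) hl)]
  simp [hp]

theorem nilEval_apply_of_apply_eq_zero {M : Type*} [AddCommGroup M] [Module ℚ M]
    (f : PowerSeries ℚ) {a : Module.End ℚ M} (ha : IsNilpotent a) {m : M} (h : a m = 0) :
    nilEval f a m = PowerSeries.coeff 0 f • m := by
  obtain ⟨k, hk⟩ := ha
  rw [nilEval_eq_sum f (pow_eq_zero_of_le (Nat.le_succ k) hk), Finset.sum_range_succ']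
  simp [pow_succ, h]

theorem isNilpotent_nilEval (f : PowerSeries ℚ) (hf : PowerSeries.constantCoeff f = 0) {a : A}
    (ha : IsNilpotent a) : IsNilpotent (nilEval f a) := by
  obtain ⟨g, rfl⟩ := PowerSeries.X_dvd_iff.2 hf
  rw [nilEval_mul _ _ ha, nilEval_X ha]
  exact (nilEval_commute g (Commute.refl a)).symm.isNilpotent_mul_right ha

theorem nilEval_subst (f g : PowerSeries ℚ) (hg : PowerSeries.constantCoeff g = 0) {a : A}
    (ha : IsNilpotent a) : nilEval (f.subst g) a = nilEval f (nilEval g a) := by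
  obtain ⟨k, hk⟩ := ha
  obtain ⟨l, hl⟩ := isNilpotent_nilEval g hg ⟨k, hk⟩
  have hk' := pow_eq_zero_of_le (le_max_left k l) hk
  have hl' := pow_eq_zero_of_le (le_max_right k l) hl
  set n := max k l
  have e : nilEval f (nilEval g a) =
      nilEval (∑ i ∈ Finset.range n, PowerSeries.coeff i f • g ^ i) a := by
    rw [nilEval_eq_sum f hl', nilEval_sum]
    refine Finset.sum_congr rfl fun i _ => ?_
    rw [nilEval_smul, nilEval_pow _ ⟨k, hk⟩]
  rw [e, nilEval_eq_sum _ hk', nilEval_eq_sum _ hk']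
  refine Finset.sum_congr rfl fun j hj => ?_
  congr 1
  rw [PowerSeries.coeff_subst' (PowerSeries.HasSubst.of_constantCoeff_zero' hg), map_sum,
    finsum_eq_sum_of_support_subset (s := Finset.range n)]
  · simp
  · intro i hi
    by_contra hin
    apply hi
    have : j < i := by
      have := Finset.mem_range.1 hj
      have : n ≤ i := by simpa using hin
      omega
    have : PowerSeries.coeff j (g ^ i) = 0 := by
      apply PowerSeries.coeff_of_lt_order
      refine lt_of_lt_of_le (by exact_mod_cast this) (PowerSeries.le_order_pow_of_constantCoeff_eq_zero i hg)
    simp [this]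

/-- The series `(eᵘ - 1) / u = ∑ uⁱ / (i + 1)!`. -/
def dexpSeries : PowerSeries ℚ := PowerSeries.mk fun i => ((i + 1).factorial : ℚ)⁻¹

/-- The series `log (1 + v) / v = ∑ (-1)ⁱ vⁱ / (i + 1)`. -/
def logQuotSeries : PowerSeries ℚ := PowerSeries.mk fun i => (-1 : ℚ) ^ i / (i + 1)

theorem exp_eq_dexp : PowerSeries.exp ℚ = 1 + dexpSeries * PowerSeries.X := by
  ext n
  cases n with
  | zero => simp
  | succ n => simp [dexpSeries, PowerSeries.coeff_exp, PowerSeries.coeff_one, PowerSeries.coeff_succ_mul_X]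

theorem log_eq_logQuot : PowerSeries.log ℚ = logQuotSeries * PowerSeries.X := by
  ext n
  cases n with
  | zero => simp
  | succ n => simp [logQuotSeries, PowerSeries.coeff_log, PowerSeries.coeff_succ_mul_X, pow_succ]

theorem mul_deriv_log : (1 + PowerSeries.X) * PowerSeries.derivative ℚ (PowerSeries.log ℚ) = 1 := by
  rw [PowerSeries.deriv_log, add_mul, one_mul]
  ext n
  cases n with
  | zero => simp
  | succ n => simp [PowerSeries.coeff_succ_X_mul, PowerSeries.coeff_one, pow_succ]

theorem subst_one_add_X (g : PowerSeries ℚ) (hg : PowerSeries.HasSubst g) :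
    (1 + PowerSeries.X : PowerSeries ℚ).subst g = 1 + g := by
  rw [← PowerSeries.coe_substAlgHom hg, map_add, map_one, PowerSeries.coe_substAlgHom hg, PowerSeries.subst_X hg]

theorem log_exp : (PowerSeries.log ℚ).subst (PowerSeries.exp ℚ - 1) = PowerSeries.X := by
  have hs := PowerSeries.HasSubst.exp_sub_one (A := ℚ)
  apply PowerSeries.derivative.ext
  · rw [PowerSeries.derivative_subst hs, map_sub, PowerSeries.derivative_X]
    have h := congrArg (PowerSeries.subst (PowerSeries.exp ℚ - 1)) mul_deriv_log
    rw [PowerSeries.subst_mul hs, subst_one_add_X _ hs, ← PowerSeries.coe_substAlgHom hs, map_one,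
      PowerSeries.coe_substAlgHom hs] at h
    rw [mul_comm]
    convert h using 2
    simp [PowerSeries.derivative_exp]
  · simp only [PowerSeries.constantCoeff_X]
    exact PowerSeries.constantCoeff_subst_eq_zero
      (by rw [← PowerSeries.constantCoeff_eq]; simp [PowerSeries.constantCoeff_exp]) _ (by simp)

theorem exp_log : (PowerSeries.exp ℚ).subst (PowerSeries.log ℚ) = 1 + PowerSeries.X := by
  have hs := PowerSeries.HasSubst.log (A := ℚ)
  set l := PowerSeries.log ℚ with hl
  set G := (PowerSeries.exp ℚ).subst l with hG
  set l' := PowerSeries.derivative ℚ l with hl'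
  have h1 : (1 + PowerSeries.X) * l' = 1 := mul_deriv_log
  have hG' : PowerSeries.derivative ℚ G = G * l' := by
    rw [hG, PowerSeries.derivative_subst hs, PowerSeries.derivative_exp]
  have h2 : l' + (1 + PowerSeries.X) * PowerSeries.derivative ℚ l' = 0 := by
    have := congrArg (PowerSeries.derivative ℚ) h1
    rw [Derivation.leibniz, map_add, PowerSeries.derivative_X] at this
    simp only [smul_eq_mul, Derivation.map_one_eq_zero, zero_add, mul_one] at this
    rw [add_comm]
    exact this
  have h3 : PowerSeries.derivative ℚ l' = - (l' * l') := by
    linear_combination l' * h2 - PowerSeries.derivative ℚ l' * h1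
  have h4 : G * l' = 1 := by
    apply PowerSeries.derivative.ext
    · rw [Derivation.leibniz, hG', h3, Derivation.map_one_eq_zero]
      simp only [smul_eq_mul]
      ring
    · have e1 : PowerSeries.constantCoeff G = 1 := by
        rw [hG, exp_eq_dexp, ← PowerSeries.coe_substAlgHom hs, map_add, map_mul, map_one,
          PowerSeries.coe_substAlgHom hs, PowerSeries.subst_X hs]
        simp [hl]
      have e2 : PowerSeries.constantCoeff l' = 1 := by
        have := congrArg PowerSeries.constantCoeff h1
        simpa using this
      simp [e1, e2]
  linear_combination (1 + PowerSeries.X) * h4 - G * h1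

theorem logQuot_mul_dexp :
    logQuotSeries.subst (PowerSeries.exp ℚ - 1) * dexpSeries = 1 := by
  have hs := PowerSeries.HasSubst.exp_sub_one (A := ℚ)
  have h := log_exp
  rw [log_eq_logQuot, PowerSeries.subst_mul hs, PowerSeries.subst_X hs] at h
  have h2 : PowerSeries.exp ℚ - 1 = dexpSeries * PowerSeries.X := by rw [exp_eq_dexp]; ring
  nth_rewrite 2 [h2] at h
  rw [← mul_assoc] at h
  exact mul_right_cancel₀ PowerSeries.X_ne_zero (h.trans (one_mul _).symm)

/-- The exponential of a nilpotent element. -/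
def nexp (a : A) : A := nilEval (PowerSeries.exp ℚ) a

theorem nexp_eq (a : A) : nexp a = IsNilpotent.exp a := by
  simp [nexp, nilEval, IsNilpotent.exp, PowerSeries.coeff_exp]

theorem nexp_zero : nexp (0 : A) = 1 := by rw [nexp_eq, IsNilpotent.exp_zero]

theorem nexp_mul_neg {a : A} (ha : IsNilpotent a) : nexp a * nexp (-a) = 1 := by
  rw [nexp_eq, nexp_eq, IsNilpotent.exp_mul_exp_neg_self ha]

theorem nexp_neg_mul {a : A} (ha : IsNilpotent a) : nexp (-a) * nexp a = 1 := by
  rw [nexp_eq, nexp_eq, IsNilpotent.exp_neg_mul_exp_self ha]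

theorem nexp_eq_dexp {a : A} (ha : IsNilpotent a) : nexp a = 1 + nilEval dexpSeries a * a := by
  rw [nexp, exp_eq_dexp, nilEval_add, nilEval_mul _ _ ha, nilEval_one ha, nilEval_X ha]

theorem nexp_sub_one_eq {a : A} (ha : IsNilpotent a) :
    nexp a - 1 = nilEval (PowerSeries.exp ℚ - 1) a := by
  rw [nilEval_sub, nilEval_one ha, nexp]

theorem isNilpotent_nexp_sub_one {a : A} (ha : IsNilpotent a) : IsNilpotent (nexp a - 1) := by
  rw [nexp_sub_one_eq ha]
  exact isNilpotent_nilEval _ (by simp [PowerSeries.constantCoeff_exp]) ha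

/-- The logarithm of a unipotent element. -/
def nlog (g : A) : A := nilEval (PowerSeries.log ℚ) (g - 1)

theorem nlog_nexp {a : A} (ha : IsNilpotent a) : nlog (nexp a) = a := by
  rw [nlog, nexp_sub_one_eq ha, ← nilEval_subst _ _ (by simp [PowerSeries.constantCoeff_exp]) ha,
    log_exp, nilEval_X ha]

theorem isNilpotent_nlog {g : A} (hg : IsNilpotent (g - 1)) : IsNilpotent (nlog g) :=
  isNilpotent_nilEval _ (by simp) hg

theorem nexp_nlog {g : A} (hg : IsNilpotent (g - 1)) : nexp (nlog g) = g := by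
  rw [nlog, nexp, ← nilEval_subst _ _ (by simp) hg, exp_log, nilEval_add, nilEval_one hg,
    nilEval_X hg, add_sub_cancel]

/-- The value of `log g / (g - 1)` at a unipotent element `g`. -/
def logQuot (g : A) : A := nilEval logQuotSeries (g - 1)

theorem logQuot_nexp_mul {a : A} (ha : IsNilpotent a) :
    logQuot (nexp a) * nilEval dexpSeries a = 1 := by
  rw [logQuot, nexp_sub_one_eq ha, ← nilEval_subst _ _ (by simp [PowerSeries.constantCoeff_exp]) ha,
    ← nilEval_mul _ _ ha, logQuot_mul_dexp, nilEval_one ha]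

theorem dexp_mul_logQuot_nexp {a : A} (ha : IsNilpotent a) :
    nilEval dexpSeries a * logQuot (nexp a) = 1 := by
  rw [logQuot, nexp_sub_one_eq ha, ← nilEval_subst _ _ (by simp [PowerSeries.constantCoeff_exp]) ha,
    ← nilEval_mul _ _ ha, mul_comm, logQuot_mul_dexp, nilEval_one ha]

/-- The commutator operator `T ↦ V T - T V`. -/
def comm (V : A) : Module.End ℚ A := LinearMap.mulLeft ℚ V - LinearMap.mulRight ℚ V

theorem comm_apply (V T : A) : comm V T = V * T - T * V := rfl

theorem isNilpotent_mulLeft {V : A} (hV : IsNilpotent V) :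
    IsNilpotent (LinearMap.mulLeft ℚ V) := by
  obtain ⟨k, hk⟩ := hV
  exact ⟨k, by rw [LinearMap.pow_mulLeft, hk, LinearMap.mulLeft_zero_eq_zero]⟩

theorem isNilpotent_mulRight {V : A} (hV : IsNilpotent V) :
    IsNilpotent (LinearMap.mulRight ℚ V) := by
  obtain ⟨k, hk⟩ := hV
  exact ⟨k, by rw [LinearMap.pow_mulRight, hk, LinearMap.mulRight_zero_eq_zero]⟩

theorem isNilpotent_comm {V : A} (hV : IsNilpotent V) : IsNilpotent (comm V) :=
  (LinearMap.commute_mulLeft_right V V).isNilpotent_sub (isNilpotent_mulLeft hV)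
    (isNilpotent_mulRight hV)

theorem nexp_comm {V : A} (hV : IsNilpotent V) (T : A) :
    nexp (comm V) T = nexp V * T * nexp (-V) := by
  have h1 : nexp (LinearMap.mulLeft ℚ V) = LinearMap.mulLeft ℚ (nexp V) :=
    (map_nilEval (Algebra.lmul ℚ A) (PowerSeries.exp ℚ) hV).symm
  have h2 : nexp (LinearMap.mulRight ℚ (-V)) = LinearMap.mulRight ℚ (nexp (-V)) := by
    obtain ⟨k, hk⟩ := hV.neg
    have hk' : (LinearMap.mulRight ℚ (-V)) ^ k = 0 := by
      rw [LinearMap.pow_mulRight, hk, LinearMap.mulRight_zero_eq_zero]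
    rw [nexp, nexp, nilEval_eq_sum _ hk, nilEval_eq_sum _ hk']
    ext T
    simp [LinearMap.pow_mulRight, Finset.mul_sum]
  have h3 : comm V = LinearMap.mulLeft ℚ V + LinearMap.mulRight ℚ (-V) := by
    ext T
    simp [comm, sub_eq_add_neg]
  rw [h3, nexp_eq, IsNilpotent.exp_add_of_commute (LinearMap.commute_mulLeft_right V (-V))
    (isNilpotent_mulLeft hV) (isNilpotent_mulRight hV.neg), ← nexp_eq, ← nexp_eq, h1, h2]
  simp [mul_assoc]

theorem comm_nexp (D : A) {N : A} (hN : IsNilpotent N) :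
    D * nexp N - nexp N * D = nilEval dexpSeries (comm N) (D * N - N * D) * nexp N := by
  have h1 := nexp_comm hN D
  rw [nexp_eq_dexp (isNilpotent_comm hN), LinearMap.add_apply, Module.End.mul_apply, comm_apply,
    ← neg_sub (D * N), map_neg, Module.End.one_apply] at h1
  have h2 := congrArg (· * nexp N) h1
  simp only [mul_assoc, nexp_neg_mul hN, mul_one] at h2
  rw [← h2, add_mul, neg_mul]
  abel

end NilEval

/-! ### Polynomial paths and the Baker-Campbell-Hausdorff product -/

section Paths
open scoped Polynomial
variable {L M L' : Type*} [LieRing L] [LieAlgebra ℚ L] [AddCommGroup M] [Module ℚ M]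
  [LieRingModule L M] [LieModule ℚ L M] [LieRing L'] [LieAlgebra ℚ L']

instance instLieModulePath : LieModule ℚ (ℚ[X] ⊗[ℚ] L) (ℚ[X] ⊗[ℚ] M) where
  smul_lie t x m := by rw [← algebraMap_smul ℚ[X] t x, smul_lie, algebraMap_smul]
  lie_smul t x m := by rw [← algebraMap_smul ℚ[X] t m, lie_smul, algebraMap_smul]

instance (priority := 10000) instBracketPath : Bracket (ℚ[X] ⊗[ℚ] L) (ℚ[X] ⊗[ℚ] M) :=
  LieRingModule.toBracket

theorem path_lie_tmul (p r : ℚ[X]) (x : L) (m : M) :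
    ⁅p ⊗ₜ[ℚ] x, r ⊗ₜ[ℚ] m⁆ = (p * r) ⊗ₜ ⁅x, m⁆ := rfl

/-- The operator by which an element of a Lie algebra acts on a module. -/
def act (M : Type*) [AddCommGroup M] [Module ℚ M] [LieRingModule L M] [LieModule ℚ L M] :
    L →ₗ[ℚ] Module.End ℚ M :=
  LinearMap.mk₂ ℚ (fun x m => ⁅x, m⁆) add_lie smul_lie lie_add lie_smul

theorem act_apply (x : L) (m : M) : act M x m = ⁅x, m⁆ := rfl

theorem isNilpotent_act [LieModule.IsNilpotent L M] (x : L) : IsNilpotent (act M x) :=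
  LieModule.isNilpotent_toEnd_of_isNilpotent ℚ L M x

/-- The antiderivative `∫₀ᵗ` of polynomials. -/
def antideriv : ℚ[X] →ₗ[ℚ] ℚ[X] :=
  (Polynomial.basisMonomials ℚ).constr ℚ fun n => Polynomial.monomial (n + 1) ((n : ℚ) + 1)⁻¹

theorem antideriv_monomial (n : ℕ) :
    antideriv (Polynomial.monomial n 1) = Polynomial.monomial (n + 1) ((n : ℚ) + 1)⁻¹ := by
  have := (Polynomial.basisMonomials ℚ).constr_basis ℚ
    (fun n => Polynomial.monomial (n + 1) ((n : ℚ) + 1)⁻¹) n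
  rwa [Polynomial.coe_basisMonomials] at this

/-- The constant path. -/
abbrev constPath (m : M) : ℚ[X] ⊗[ℚ] M := (1 : ℚ[X]) ⊗ₜ[ℚ] m

/-- The path `t ↦ t m`. -/
abbrev linPath (m : M) : ℚ[X] ⊗[ℚ] M := (Polynomial.X : ℚ[X]) ⊗ₜ[ℚ] m

/-- Evaluation of a polynomial path at the time `c`. -/
def pathEval (M : Type*) [AddCommGroup M] [Module ℚ M] (c : ℚ) : ℚ[X] ⊗[ℚ] M →ₗ[ℚ] M :=
  (TensorProduct.lid ℚ M).toLinearMap ∘ₗ (Polynomial.leval c).rTensor M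

/-- Primitive `∫₀ᵗ` of a polynomial path. -/
def pathInt (M : Type*) [AddCommGroup M] [Module ℚ M] : ℚ[X] ⊗[ℚ] M →ₗ[ℚ] ℚ[X] ⊗[ℚ] M :=
  antideriv.rTensor M

/-- Derivative of a polynomial path. -/
def pathDer (M : Type*) [AddCommGroup M] [Module ℚ M] : Module.End ℚ (ℚ[X] ⊗[ℚ] M) :=
  (Polynomial.derivative (R := ℚ)).rTensor M

theorem pathEval_tmul (c : ℚ) (p : ℚ[X]) (m : M) : pathEval M c (p ⊗ₜ m) = p.eval c • m := by
  simp [pathEval, Polynomial.leval]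

theorem pathInt_tmul (p : ℚ[X]) (m : M) : pathInt M (p ⊗ₜ m) = antideriv p ⊗ₜ m := rfl

theorem pathDer_tmul (p : ℚ[X]) (m : M) :
    pathDer M (p ⊗ₜ m) = Polynomial.derivative p ⊗ₜ m := rfl

theorem pathDer_int (q : ℚ[X] ⊗[ℚ] M) : pathDer M (pathInt M q) = q := by
  have : (Polynomial.derivative (R := ℚ)) ∘ₗ antideriv = LinearMap.id := by
    refine (Polynomial.basisMonomials ℚ).ext fun n => ?_
    rw [Polynomial.coe_basisMonomials, LinearMap.comp_apply, antideriv_monomial,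
      Polynomial.derivative_monomial]
    have : (n : ℚ) + 1 ≠ 0 := by positivity
    simp [this]
  rw [pathDer, pathInt, ← LinearMap.comp_apply, ← LinearMap.rTensor_comp, this,
    LinearMap.rTensor_id, LinearMap.id_apply]

theorem pathEval_int (q : ℚ[X] ⊗[ℚ] M) : pathEval M 0 (pathInt M q) = 0 := by
  have : Polynomial.leval (0 : ℚ) ∘ₗ antideriv = 0 := by
    refine (Polynomial.basisMonomials ℚ).ext fun n => ?_
    rw [Polynomial.coe_basisMonomials, LinearMap.comp_apply, antideriv_monomial]
    simp [Polynomial.leval]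
  rw [pathEval, pathInt, LinearMap.comp_apply, ← LinearMap.comp_apply (LinearMap.rTensor _ _),
    ← LinearMap.rTensor_comp, this]
  simp

theorem path_eq (q : ℚ[X] ⊗[ℚ] M) :
    q = 1 ⊗ₜ pathEval M 0 q + pathInt M (pathDer M q) := by
  induction q using TensorProduct.induction_on with
  | zero => simp
  | tmul p m =>
    induction p using Polynomial.induction_on' with
    | add p q hp hq =>
      rw [TensorProduct.add_tmul, map_add, map_add, map_add, TensorProduct.tmul_add]
      nth_rewrite 1 [hp, hq]
      abel
    | monomial n a =>
      have ha : Polynomial.monomial n a = a • Polynomial.monomial n (1 : ℚ) := by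
        simp [Polynomial.smul_monomial]
      rw [ha, ← TensorProduct.smul_tmul', map_smul, map_smul, map_smul, TensorProduct.tmul_smul,
        ← smul_add]
      congr 1
      rw [pathEval_tmul, pathDer_tmul, pathInt_tmul, Polynomial.derivative_monomial]
      cases n with
      | zero => simp [← Polynomial.C_1, -map_one]
      | succ n =>
        have e : Polynomial.monomial n ((1 : ℚ) * ((n + 1 : ℕ) : ℚ)) =
            ((n : ℚ) + 1) • Polynomial.monomial n (1 : ℚ) := by
          simp [Polynomial.smul_monomial]
        have : (n : ℚ) + 1 ≠ 0 := by positivity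
        rw [Nat.add_sub_cancel, e, map_smul, antideriv_monomial]
        simp [Polynomial.smul_monomial, this]
  | add x y hx hy =>
    rw [map_add, map_add, map_add, TensorProduct.tmul_add]
    nth_rewrite 1 [hx, hy]
    abel

theorem pathDer_nilpotent (q : ℚ[X] ⊗[ℚ] M) : ∃ n, (pathDer M ^ n) q = 0 := by
  induction q using TensorProduct.induction_on with
  | zero => exact ⟨0, by simp⟩
  | tmul p m =>
    refine ⟨p.natDegree + 1, ?_⟩
    have : ∀ (n : ℕ) (p : ℚ[X]), (pathDer M ^ n) (p ⊗ₜ m) = (Polynomial.derivative^[n] p) ⊗ₜ m := by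
      intro n
      induction n with
      | zero => simp
      | succ n ih => intro p; rw [pow_succ, Module.End.mul_apply, pathDer_tmul, ih]; rfl
    rw [this, Polynomial.iterate_derivative_eq_zero (Nat.lt_succ_self _), TensorProduct.zero_tmul]
  | add x y hx hy =>
    obtain ⟨k, hk⟩ := hx
    obtain ⟨l, hl⟩ := hy
    refine ⟨k + l, ?_⟩
    rw [map_add]
    nth_rewrite 1 [add_comm k l]
    rw [pow_add, pow_add, Module.End.mul_apply, Module.End.mul_apply, hk, hl]
    simp

theorem eq_zero_of_commute (K : Module.End ℚ (ℚ[X] ⊗[ℚ] M))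
    (h1 : ∀ q, pathDer M (K q) = K (pathDer M q)) (h2 : ∀ q, pathEval M 0 (K q) = 0) : K = 0 := by
  have key : ∀ n q, (pathDer M ^ n) q = 0 → K q = 0 := by
    intro n
    induction n with
    | zero => intro q hq; rw [show q = 0 by simpa using hq, map_zero]
    | succ n ih =>
      intro q hq
      rw [path_eq (K q), h1, h2, ih (pathDer M q) (by rw [← hq, pow_succ]; rfl)]
      simp
  refine LinearMap.ext fun q => ?_
  obtain ⟨n, hn⟩ := pathDer_nilpotent q
  exact key n _ hn

theorem pathEval_lie (c : ℚ) (u : ℚ[X] ⊗[ℚ] L) (q : ℚ[X] ⊗[ℚ] M) :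
    pathEval M c ⁅u, q⁆ = ⁅pathEval L c u, pathEval M c q⁆ := by
  induction u using TensorProduct.induction_on with
  | zero => simp
  | tmul p x =>
    induction q using TensorProduct.induction_on with
    | zero => simp
    | tmul r m =>
      rw [path_lie_tmul, pathEval_tmul, pathEval_tmul, pathEval_tmul]
      simp only [Polynomial.eval_mul, mul_smul, smul_lie, lie_smul]
      exact smul_comm _ _ _
    | add a b ha hb => rw [lie_add, map_add, ha, hb, map_add, lie_add]
  | add a b ha hb => rw [add_lie, map_add, ha, hb, map_add, add_lie]

theorem pathDer_lie (u : ℚ[X] ⊗[ℚ] L) (q : ℚ[X] ⊗[ℚ] M) :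
    pathDer M ⁅u, q⁆ = ⁅pathDer L u, q⁆ + ⁅u, pathDer M q⁆ := by
  induction u using TensorProduct.induction_on with
  | zero => simp
  | tmul p x =>
    induction q using TensorProduct.induction_on with
    | zero => simp
    | tmul r m =>
      simp only [path_lie_tmul, pathDer_tmul, Polynomial.derivative_mul,
        TensorProduct.add_tmul]
    | add a b ha hb => rw [lie_add, map_add, ha, hb, map_add, lie_add, lie_add]; abel
  | add a b ha hb => rw [add_lie, map_add, ha, hb, map_add, add_lie, add_lie]; abel

/-- The path `t ↦ e^{t x} e^{y}` of operators on a module over a nilpotent Lie algebra. -/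
def expPath (M : Type*) [AddCommGroup M] [Module ℚ M] [LieRingModule L M] [LieModule ℚ L M]
    (x y : L) : Module.End ℚ (ℚ[X] ⊗[ℚ] M) :=
  nexp (act _ (linPath x)) * nexp (act _ (constPath y))

/-- The polynomial path `t ↦ log (e^{tx} e^y)`, that is
`y + ∫₀ᵗ (log g / (g - 1)) x ds` with `g = e^{s ad x} e^{ad y}`. -/
def bchPath (x y : L) : ℚ[X] ⊗[ℚ] L :=
  constPath y + pathInt L (logQuot (expPath L x y) (constPath x))

/-- The Baker-Campbell-Hausdorff product `log (eˣ eʸ)` in a nilpotent Lie algebra over `ℚ`,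
given by the integral formula
`log (eˣ eʸ) = y + ∫₀¹ (log g / (g - 1)) x dt` with `g = e^{t ad x} e^{ad y}`. -/
def bch (x y : L) : L := pathEval L 1 (bchPath x y)

theorem leibniz_aux {A : Type*} [Ring A] {D a b x : A} (h1 : D * a - a * D = x * a)
    (h2 : D * b = b * D) : D * (a * b) - a * b * D = x * (a * b) := by
  rw [← mul_assoc, ← mul_assoc, ← h1, sub_mul, mul_assoc a b, ← h2, mul_assoc a D]

theorem leibniz_aux2 {A : Type*} [Ring A] {D B G E x : A} (h1 : D * G - G * D = x * G)
    (h2 : D * E - E * D = x * E) (h3 : D * B - B * D = -x * B) (h4 : B * x = x * B) :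
    D * (B * (G - E)) = B * (G - E) * D := by
  have e : D * (B * (G - E)) - B * (G - E) * D =
      (D * B - B * D) * (G - E) + B * ((D * G - G * D) - (D * E - E * D)) := by noncomm_ring
  rw [← sub_eq_zero, e, h1, h2, h3, ← mul_sub, ← mul_assoc, h4]
  noncomm_ring

theorem comm_act (x y : L) : comm (act M x) (act M y) = act M ⁅x, y⁆ := by
  ext m
  simp [comm_apply, act_apply]

theorem nexp_act_conj [LieRing.IsNilpotent L] [LieModule.IsNilpotent L M] (x y : L) :
    nexp (act M x) * act M y * nexp (-(act M x)) = act M (nexp (act L x) y) := by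
  rw [← nexp_comm (isNilpotent_act x)]
  exact (nilEval_intertwine (act M) (PowerSeries.exp ℚ) (isNilpotent_act x)
    (isNilpotent_comm (isNilpotent_act x)) (fun y => (comm_act x y).symm) y).symm

theorem dexp_comm_act [LieRing.IsNilpotent L] [LieModule.IsNilpotent L M] (x y : L) :
    nilEval dexpSeries (comm (act M x)) (act M y) = act M (nilEval dexpSeries (act L x) y) := by
  exact (nilEval_intertwine (act M) dexpSeries (isNilpotent_act x)
    (isNilpotent_comm (isNilpotent_act x)) (fun y => (comm_act x y).symm) y).symm

section Main
variable [LieRing.IsNilpotent L] [LieModule.IsNilpotent L M]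

instance : LieModule.IsNilpotent (ℚ[X] ⊗[ℚ] L) (ℚ[X] ⊗[ℚ] M) :=
  LieModule.instIsNilpotentTensor ℚ ℚ[X] L M

theorem pathDer_nexp (u : ℚ[X] ⊗[ℚ] L) :
    pathDer M * nexp (act (ℚ[X] ⊗[ℚ] M) u) - nexp (act (ℚ[X] ⊗[ℚ] M) u) * pathDer M =
      act _ (nilEval dexpSeries (act _ u) (pathDer L u)) * nexp (act (ℚ[X] ⊗[ℚ] M) u) := by
  have h : pathDer M * act (ℚ[X] ⊗[ℚ] M) u - act (ℚ[X] ⊗[ℚ] M) u * pathDer M =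
      act _ (pathDer L u) := by
    refine LinearMap.ext fun q => ?_
    rw [LinearMap.sub_apply, Module.End.mul_apply, Module.End.mul_apply, act_apply, act_apply,
      act_apply, pathDer_lie]
    abel
  rw [comm_nexp _ (isNilpotent_act u), h, dexp_comm_act]

theorem pathEval_nilEval (f : PowerSeries ℚ) (c : ℚ) (u : ℚ[X] ⊗[ℚ] L) (q : ℚ[X] ⊗[ℚ] M) :
    pathEval M c (nilEval f (act _ u) q) = nilEval f (act M (pathEval L c u)) (pathEval M c q) :=
  nilEval_intertwine (pathEval M c) f (isNilpotent_act u) (isNilpotent_act _)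
    (fun q => pathEval_lie c u q) q

theorem pathEval_nexp (c : ℚ) (u : ℚ[X] ⊗[ℚ] L) (q : ℚ[X] ⊗[ℚ] M) :
    pathEval M c (nexp (act _ u) q) = nexp (act M (pathEval L c u)) (pathEval M c q) :=
  pathEval_nilEval _ c u q

theorem pathEval_X (c : ℚ) (x : L) : pathEval L c (linPath x) = c • x := by
  rw [pathEval_tmul, Polynomial.eval_X]

theorem pathEval_one (c : ℚ) (x : L) : pathEval L c (constPath x) = x := by
  rw [pathEval_tmul, Polynomial.eval_one, one_smul]

theorem dexp_linPath (x : L) :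
    nilEval dexpSeries (act (ℚ[X] ⊗[ℚ] L) (linPath x)) (constPath x) = constPath x := by
  rw [nilEval_apply_of_apply_eq_zero _ (isNilpotent_act _)]
  · simp [dexpSeries]
  · rw [act_apply, path_lie_tmul, lie_self, TensorProduct.tmul_zero]

theorem pathDer_nexp_linPath (x : L) :
    pathDer M * nexp (act (ℚ[X] ⊗[ℚ] M) (linPath x)) -
      nexp (act (ℚ[X] ⊗[ℚ] M) (linPath x)) * pathDer M =
      act _ (constPath x) * nexp (act (ℚ[X] ⊗[ℚ] M) (linPath x)) := by
  rw [pathDer_nexp, pathDer_tmul, Polynomial.derivative_X, dexp_linPath]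

theorem pathDer_nexp_constPath (y : L) :
    pathDer M * nexp (act (ℚ[X] ⊗[ℚ] M) (constPath y)) =
      nexp (act (ℚ[X] ⊗[ℚ] M) (constPath y)) * pathDer M := by
  rw [← sub_eq_zero, pathDer_nexp, pathDer_tmul, Polynomial.derivative_one,
    TensorProduct.zero_tmul, map_zero, map_zero, zero_mul]

theorem pathDer_expPath (x y : L) :
    pathDer M * expPath M x y - expPath M x y * pathDer M =
      act _ (constPath x) * expPath M x y := by
  exact leibniz_aux (A := Module.End ℚ (ℚ[X] ⊗[ℚ] M)) (pathDer_nexp_linPath x) (pathDer_nexp_constPath y)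

theorem pathEval_expPath (c : ℚ) (x y : L) (q : ℚ[X] ⊗[ℚ] M) :
    pathEval M c (expPath M x y q) =
      nexp (act M (c • x)) (nexp (act M y) (pathEval M c q)) := by
  rw [expPath, Module.End.mul_apply, pathEval_nexp, pathEval_nexp, pathEval_X, pathEval_one]

/-- Uniqueness for the linear differential equation `G' = x G`. -/
theorem expPath_unique (x y : L) (G : Module.End ℚ (ℚ[X] ⊗[ℚ] M))
    (h1 : pathDer M * G - G * pathDer M = act _ (constPath x) * G)
    (h2 : ∀ q, pathEval M 0 (G q) = nexp (act M y) (pathEval M 0 q)) : G = expPath M x y := by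
  have hneg : act (ℚ[X] ⊗[ℚ] M) (linPath (-x)) = -act (ℚ[X] ⊗[ℚ] M) (linPath x) := by
    rw [linPath, TensorProduct.tmul_neg, map_neg]
  have hneg' : act (ℚ[X] ⊗[ℚ] M) (constPath (-x)) = -act (ℚ[X] ⊗[ℚ] M) (constPath x) := by
    rw [constPath, TensorProduct.tmul_neg, map_neg]
  have hinv : nexp (act (ℚ[X] ⊗[ℚ] M) (linPath x)) * nexp (act (ℚ[X] ⊗[ℚ] M) (linPath (-x))) = 1 := by
    rw [hneg]
    exact nexp_mul_neg (isNilpotent_act _)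
  have hA2 := pathDer_nexp_linPath (M := M) (-x)
  have hcomm : nexp (act (ℚ[X] ⊗[ℚ] M) (linPath (-x))) * act (ℚ[X] ⊗[ℚ] M) (constPath x) =
      act (ℚ[X] ⊗[ℚ] M) (constPath x) * nexp (act (ℚ[X] ⊗[ℚ] M) (linPath (-x))) := by
    refine (nilEval_commute _ ?_).eq
    refine sub_eq_zero.1 ((comm_act _ _).trans ?_)
    rw [path_lie_tmul, neg_lie, lie_self, neg_zero, TensorProduct.tmul_zero, map_zero]
  have hE := pathDer_expPath (M := M) x y
  have hK : nexp (act (ℚ[X] ⊗[ℚ] M) (linPath (-x))) * (G - expPath M x y) = 0 := by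
    apply eq_zero_of_commute
    · intro q
      rw [hneg'] at hA2
      exact LinearMap.congr_fun
        (leibniz_aux2 (A := Module.End ℚ (ℚ[X] ⊗[ℚ] M)) h1 hE hA2 hcomm) q
    · intro q
      rw [Module.End.mul_apply, pathEval_nexp]
      have : pathEval M 0 ((G - expPath M x y) q) = 0 := by
        rw [LinearMap.sub_apply, map_sub, h2, pathEval_expPath, zero_smul, map_zero, nexp_zero,
          Module.End.one_apply, sub_self]
      rw [this, map_zero]
  have h := congrArg (nexp (act (ℚ[X] ⊗[ℚ] M) (linPath x)) * ·) hK
  simp only [← mul_assoc, hinv, one_mul, mul_zero] at h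
  exact sub_eq_zero.1 h

theorem nilEval_mem_lieSubmodule (f : PowerSeries ℚ) (x : L) (N : LieSubmodule ℚ L M) {m : M}
    (hm : m ∈ N) : nilEval f (act M x) m ∈ N := by
  have hp : ∀ i : ℕ, (act M x ^ i) m ∈ N := by
    intro i
    induction i with
    | zero => simpa using hm
    | succ i ih => rw [pow_succ']; exact N.lie_mem ih
  rw [nilEval, LinearMap.sum_apply]
  exact N.sum_mem fun i _ => N.smul_mem _ (hp i)

theorem nexp_act_sub_mem (x : L) (k : ℕ) {m : M}
    (hm : m ∈ LieModule.lowerCentralSeries ℚ L M k) :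
    nexp (act M x) m - m ∈ LieModule.lowerCentralSeries ℚ L M (k + 1) := by
  rw [nexp_eq_dexp (isNilpotent_act x), LinearMap.add_apply, Module.End.one_apply,
    add_sub_cancel_left, Module.End.mul_apply]
  apply nilEval_mem_lieSubmodule
  rw [LieModule.lowerCentralSeries_succ]
  exact LieSubmodule.lie_mem_lie (LieSubmodule.mem_top x) hm

theorem isNilpotent_mul_sub_one (x y : L) :
    IsNilpotent (nexp (act M x) * nexp (act M y) - 1) := by
  have key : ∀ (i : ℕ) (m : M), ((nexp (act M x) * nexp (act M y) - 1) ^ i) m ∈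
      LieModule.lowerCentralSeries ℚ L M i := by
    intro i
    induction i with
    | zero => intro m; simp
    | succ i ih =>
      intro m
      rw [pow_succ', Module.End.mul_apply]
      have h := ih m
      generalize ((nexp (act M x) * nexp (act M y) - 1) ^ i) m = m' at h
      have e : (nexp (act M x) * nexp (act M y) - 1) m' =
          (nexp (act M x) (nexp (act M y) m') - nexp (act M y) m') + (nexp (act M y) m' - m') := by
        rw [LinearMap.sub_apply, Module.End.mul_apply, Module.End.one_apply]
        abel
      rw [e]
      exact add_mem (nexp_act_sub_mem x i (nilEval_mem_lieSubmodule _ y _ h))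
        (nexp_act_sub_mem y i h)
  obtain ⟨k, hk⟩ := LieModule.IsNilpotent.nilpotent ℚ L M
  refine ⟨k, LinearMap.ext fun m => ?_⟩
  have := key k m
  rw [hk, LieSubmodule.mem_bot] at this
  exact this

theorem isNilpotent_expPath_sub_one (x y : L) : IsNilpotent (expPath M x y - 1) :=
  isNilpotent_mul_sub_one (M := ℚ[X] ⊗[ℚ] M) (linPath x) (constPath y)

theorem log_aux {A : Type*} [Ring A] [Algebra ℚ A] {D V x : A} (hV : IsNilpotent V)
    (h : D * nexp V - nexp V * D = x * nexp V) :
    D * V - V * D = logQuot (nexp (comm V)) x := by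
  rw [comm_nexp D hV] at h
  have h' := congrArg (· * nexp (-V)) h
  simp only [mul_assoc, nexp_mul_neg hV, mul_one] at h'
  rw [← h', ← Module.End.mul_apply, logQuot_nexp_mul (isNilpotent_comm hV), Module.End.one_apply]

theorem act_logQuot_mul (x y q : L) (V : Module.End ℚ M) (hV : IsNilpotent V)
    (h : nexp V = nexp (act M x) * nexp (act M y)) :
    act M (logQuot (nexp (act L x) * nexp (act L y)) q) = logQuot (nexp (comm V)) (act M q) := by
  have hinv : nexp (-V) = nexp (-(act M y)) * nexp (-(act M x)) := by
    have h1 := nexp_neg_mul hV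
    rw [h] at h1
    calc nexp (-V) = nexp (-V) * ((nexp (act M x) * nexp (act M y)) *
          (nexp (-(act M y)) * nexp (-(act M x)))) := by
            rw [mul_assoc (nexp (act M x)), ← mul_assoc (nexp (act M y)),
              nexp_mul_neg (isNilpotent_act y), one_mul, nexp_mul_neg (isNilpotent_act x), mul_one]
      _ = _ := by rw [← mul_assoc, h1, one_mul]
  refine nilEval_intertwine (act M) _ (isNilpotent_mul_sub_one x y)
    (isNilpotent_nexp_sub_one (isNilpotent_comm hV)) (fun q => ?_) q
  rw [LinearMap.sub_apply, LinearMap.sub_apply, map_sub, Module.End.mul_apply, nexp_comm hV, h,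
    hinv, ← nexp_act_conj, ← nexp_act_conj]
  simp only [mul_assoc, Module.End.one_apply]

theorem pathEval_bchPath_zero (x y : L) : pathEval L 0 (bchPath x y) = y := by
  rw [bchPath, map_add, pathEval_int, pathEval_one, add_zero]

theorem pathDer_bchPath (x y : L) :
    pathDer L (bchPath x y) = logQuot (expPath L x y) (constPath x) := by
  rw [bchPath, map_add, pathDer_int, pathDer_tmul, Polynomial.derivative_one,
    TensorProduct.zero_tmul, zero_add]

theorem nlog_expPath (x y : L) : nlog (expPath L x y) = act (ℚ[X] ⊗[ℚ] L) (bchPath x y) := by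
  have hg := isNilpotent_expPath_sub_one (M := L) x y
  have hV := isNilpotent_nlog (A := Module.End ℚ (ℚ[X] ⊗[ℚ] L)) hg
  have hVg : nexp (nlog (expPath L x y)) = expPath L x y :=
    nexp_nlog (A := Module.End ℚ (ℚ[X] ⊗[ℚ] L)) hg
  have hD : pathDer L * nlog (expPath L x y) - nlog (expPath L x y) * pathDer L =
      act (ℚ[X] ⊗[ℚ] L) (pathDer L (bchPath x y)) := by
    rw [pathDer_bchPath]
    refine (log_aux (A := Module.End ℚ (ℚ[X] ⊗[ℚ] L)) hV (x := act _ (constPath x)) ?_).trans ?_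
    · rw [hVg]
      exact pathDer_expPath x y
    · exact (act_logQuot_mul (M := ℚ[X] ⊗[ℚ] L) (linPath x) (constPath y) (constPath x) _ hV
        hVg).symm
  refine sub_eq_zero.1 (eq_zero_of_commute _ (fun q => ?_) (fun q => ?_))
  · have h := LinearMap.congr_fun hD q
    rw [LinearMap.sub_apply, Module.End.mul_apply, Module.End.mul_apply, act_apply] at h
    rw [LinearMap.sub_apply, LinearMap.sub_apply, map_sub, act_apply, act_apply, pathDer_lie, ← h]
    abel
  · have h : pathEval L 0 (nlog (expPath L x y) q) =
        nlog (nexp (act L y)) (pathEval L 0 q) := by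
      refine nilEval_intertwine (pathEval L 0) _ hg
        (isNilpotent_nexp_sub_one (isNilpotent_act y)) (fun q => ?_) q
      rw [LinearMap.sub_apply, LinearMap.sub_apply, map_sub, pathEval_expPath, zero_smul, map_zero,
        nexp_zero]
      rfl
    rw [LinearMap.sub_apply, map_sub, h, nlog_nexp (isNilpotent_act y), act_apply, act_apply,
      pathEval_lie, pathEval_bchPath_zero, sub_self]

theorem nexp_bchPath (x y : L) :
    nexp (act (ℚ[X] ⊗[ℚ] M) (bchPath x y)) = expPath M x y := by
  have hg : nexp (act (ℚ[X] ⊗[ℚ] L) (bchPath x y)) = expPath L x y := by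
    rw [← nlog_expPath]
    exact nexp_nlog (A := Module.End ℚ (ℚ[X] ⊗[ℚ] L)) (isNilpotent_expPath_sub_one x y)
  apply expPath_unique
  · rw [pathDer_nexp, pathDer_bchPath, ← hg, ← Module.End.mul_apply,
      dexp_mul_logQuot_nexp (isNilpotent_act _), Module.End.one_apply]
  · intro q
    rw [pathEval_nexp, pathEval_bchPath_zero]

/-- The defining property of the Baker-Campbell-Hausdorff product. -/
theorem nexp_bch (x y : L) :
    nexp (act M (bch x y)) = nexp (act M x) * nexp (act M y) := by
  refine LinearMap.ext fun m => ?_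
  have h := pathEval_nexp (M := M) 1 (bchPath x y) (constPath m)
  rw [nexp_bchPath, pathEval_expPath, one_smul, pathEval_tmul, Polynomial.eval_one, one_smul] at h
  exact h.symm


/-- The map of paths induced by a linear map. -/
def pathMap {M N : Type*} [AddCommGroup M] [Module ℚ M] [AddCommGroup N] [Module ℚ N]
    (φ : M →ₗ[ℚ] N) : ℚ[X] ⊗[ℚ] M →ₗ[ℚ] ℚ[X] ⊗[ℚ] N := φ.lTensor ℚ[X]

theorem pathMap_lie (φ : L →ₗ⁅ℚ⁆ L') (u v : ℚ[X] ⊗[ℚ] L) :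
    pathMap (φ : L →ₗ[ℚ] L') ⁅u, v⁆ =
      ⁅pathMap (φ : L →ₗ[ℚ] L') u, pathMap (φ : L →ₗ[ℚ] L') v⁆ := by
  induction u using TensorProduct.induction_on with
  | zero => simp
  | tmul p x =>
    induction v using TensorProduct.induction_on with
    | zero => simp
    | tmul r m =>
      rw [path_lie_tmul]
      simp only [pathMap, LinearMap.lTensor_tmul, LieHom.coe_toLinearMap, LieHom.map_lie]
      rw [path_lie_tmul]
    | add a b ha hb => rw [lie_add, map_add, ha, hb, map_add, lie_add]
  | add a b ha hb => rw [add_lie, map_add, ha, hb, map_add, add_lie]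

theorem pathEval_map {M N : Type*} [AddCommGroup M] [Module ℚ M] [AddCommGroup N] [Module ℚ N]
    (φ : M →ₗ[ℚ] N) (c : ℚ) (q : ℚ[X] ⊗[ℚ] M) :
    pathEval N c (pathMap φ q) = φ (pathEval M c q) := by
  induction q using TensorProduct.induction_on with
  | zero => simp
  | tmul p x => simp [pathMap, pathEval_tmul]
  | add a b ha hb => rw [map_add, map_add, ha, hb, map_add, map_add]

theorem pathInt_map {M N : Type*} [AddCommGroup M] [Module ℚ M] [AddCommGroup N] [Module ℚ N]
    (φ : M →ₗ[ℚ] N) (q : ℚ[X] ⊗[ℚ] M) :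
    pathInt N (pathMap φ q) = pathMap φ (pathInt M q) := by
  induction q using TensorProduct.induction_on with
  | zero => simp
  | tmul p x => simp [pathMap, pathInt_tmul]
  | add a b ha hb => rw [map_add, map_add, ha, hb, map_add, map_add]

theorem map_bch [LieRing.IsNilpotent L'] (φ : L →ₗ⁅ℚ⁆ L') (x y : L) :
    φ (bch x y) = bch (φ x) (φ y) := by
  have hn : ∀ u q, pathMap (φ : L →ₗ[ℚ] L') (nexp (act (ℚ[X] ⊗[ℚ] L) u) q) =
      nexp (act (ℚ[X] ⊗[ℚ] L') (pathMap (φ : L →ₗ[ℚ] L') u)) (pathMap (φ : L →ₗ[ℚ] L') q) :=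
    fun u q => nilEval_intertwine _ _ (isNilpotent_act u) (isNilpotent_act _)
      (fun q => pathMap_lie φ u q) q
  have hg : ∀ q, pathMap (φ : L →ₗ[ℚ] L') (expPath L x y q) =
      expPath L' (φ x) (φ y) (pathMap (φ : L →ₗ[ℚ] L') q) := by
    intro q
    rw [expPath, expPath, Module.End.mul_apply, Module.End.mul_apply, hn, hn]
    rfl
  have hl : pathMap (φ : L →ₗ[ℚ] L') (logQuot (expPath L x y) (constPath x)) =
      logQuot (expPath L' (φ x) (φ y)) (constPath (φ x)) := by
    refine (nilEval_intertwine (pathMap (φ : L →ₗ[ℚ] L')) _ (isNilpotent_expPath_sub_one x y)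
      (isNilpotent_expPath_sub_one (φ x) (φ y)) (fun q => ?_) (constPath x)).trans ?_
    · rw [LinearMap.sub_apply, LinearMap.sub_apply, map_sub, hg]
      rfl
    · rfl
  rw [bch, bch, bchPath, bchPath, map_add, map_add, ← hl, pathInt_map, map_add, pathEval_map,
    pathEval_one, pathEval_one]
  rfl

theorem bch_zero_left (y : L) : bch 0 y = y := by
  rw [bch, bchPath, constPath, constPath, TensorProduct.tmul_zero, map_zero, map_zero, add_zero,
    pathEval_one]

/-! ### The affine module of a derivation -/

/-- The module `M × ℚ` over `L` with action `x (m, c) = (x m - c d x, 0)`. -/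
def AffExt (_d : LieDerivation ℚ L M) : Type _ := M × ℚ

instance (d : LieDerivation ℚ L M) : AddCommGroup (AffExt d) :=
  inferInstanceAs (AddCommGroup (M × ℚ))

instance (d : LieDerivation ℚ L M) : Module ℚ (AffExt d) := inferInstanceAs (Module ℚ (M × ℚ))

instance (d : LieDerivation ℚ L M) : LieRingModule L (AffExt d) where
  bracket x z := ((⁅x, z.1⁆ - z.2 • d x, 0) : M × ℚ)
  add_lie x y z := Prod.ext (by
    change ⁅x + y, z.1⁆ - z.2 • d (x + y) = (⁅x, z.1⁆ - z.2 • d x) + (⁅y, z.1⁆ - z.2 • d y)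
    rw [add_lie, map_add, smul_add]; abel) (add_zero (0 : ℚ)).symm
  lie_add x z w := Prod.ext (by
    change ⁅x, z.1 + w.1⁆ - (z.2 + w.2) • d x = (⁅x, z.1⁆ - z.2 • d x) + (⁅x, w.1⁆ - w.2 • d x)
    rw [lie_add, add_smul]; abel) (add_zero (0 : ℚ)).symm
  leibniz_lie x y z := Prod.ext (by
    change ⁅x, ⁅y, z.1⁆ - z.2 • d y⁆ - (0 : ℚ) • d x =
      (⁅⁅x, y⁆, z.1⁆ - z.2 • d ⁅x, y⁆) + (⁅y, ⁅x, z.1⁆ - z.2 • d x⁆ - (0 : ℚ) • d y)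
    rw [LieDerivation.apply_lie_eq_sub, lie_sub, lie_sub, leibniz_lie x y, lie_smul, lie_smul,
      zero_smul, zero_smul, smul_sub]
    abel) (add_zero (0 : ℚ)).symm

theorem affExt_lie (d : LieDerivation ℚ L M) (x : L) (z : AffExt d) :
    ⁅x, z⁆ = ((⁅x, z.1⁆ - z.2 • d x, 0) : M × ℚ) := rfl

instance (d : LieDerivation ℚ L M) : LieModule ℚ L (AffExt d) where
  smul_lie t x z := Prod.ext (by
    change ⁅t • x, z.1⁆ - z.2 • d (t • x) = t • (⁅x, z.1⁆ - z.2 • d x)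
    rw [smul_lie, map_smul, smul_sub, smul_comm t]) (mul_zero t).symm
  lie_smul t x z := Prod.ext (by
    change ⁅x, t • z.1⁆ - (t • z.2) • d x = t • (⁅x, z.1⁆ - z.2 • d x)
    rw [lie_smul, smul_assoc, smul_sub]) (mul_zero t).symm

/-- The inclusion `m ↦ (m, 0)`. -/
def affInl (d : LieDerivation ℚ L M) : M →ₗ[ℚ] AffExt d := LinearMap.inl ℚ M ℚ

theorem affInl_lie (d : LieDerivation ℚ L M) (x : L) (m : M) :
    affInl d ⁅x, m⁆ = ⁅x, affInl d m⁆ :=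
  Prod.ext (by
    change ⁅x, m⁆ = ⁅x, m⁆ - (0 : ℚ) • d x
    rw [zero_smul, sub_zero]) rfl

instance (d : LieDerivation ℚ L M) : LieModule.IsNilpotent L (AffExt d) := by
  have key : ∀ k, ∀ z ∈ LieModule.lowerCentralSeries ℚ L (AffExt d) (k + 1),
      ∃ m ∈ LieModule.lowerCentralSeries ℚ L M k, z = affInl d m := by
    intro k
    induction k with
    | zero =>
      intro z hz
      rw [LieModule.lowerCentralSeries_succ] at hz
      rw [← LieSubmodule.mem_toSubmodule, LieSubmodule.lieIdeal_oper_eq_linear_span'] at hz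
      refine Submodule.span_induction ?_ ⟨0, by simp, by simp⟩ ?_ ?_ hz
      · rintro _ ⟨x, -, z, -, rfl⟩
        exact ⟨⁅x, z.1⁆ - z.2 • d x, by simp, rfl⟩
      · rintro _ _ _ _ ⟨m, hm, rfl⟩ ⟨n, hn, rfl⟩
        exact ⟨m + n, add_mem hm hn, (map_add _ _ _).symm⟩
      · rintro t _ _ ⟨m, hm, rfl⟩
        exact ⟨t • m, by simp, (map_smul _ _ _).symm⟩
    | succ k ih =>
      intro z hz
      rw [LieModule.lowerCentralSeries_succ] at hz
      rw [← LieSubmodule.mem_toSubmodule, LieSubmodule.lieIdeal_oper_eq_linear_span'] at hz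
      refine Submodule.span_induction ?_ ⟨0, zero_mem _, by simp⟩ ?_ ?_ hz
      · rintro _ ⟨x, -, z, hz, rfl⟩
        obtain ⟨m, hm, rfl⟩ := ih z hz
        refine ⟨⁅x, m⁆, ?_, (affInl_lie d x m).symm⟩
        rw [LieModule.lowerCentralSeries_succ]
        exact LieSubmodule.lie_mem_lie (LieSubmodule.mem_top x) hm
      · rintro _ _ _ _ ⟨m, hm, rfl⟩ ⟨n, hn, rfl⟩
        exact ⟨m + n, add_mem hm hn, (map_add _ _ _).symm⟩
      · rintro t _ _ ⟨m, hm, rfl⟩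
        exact ⟨t • m, (LieModule.lowerCentralSeries ℚ L M (k + 1)).smul_mem _ hm, (map_smul _ _ _).symm⟩
  obtain ⟨k, hk⟩ := LieModule.IsNilpotent.nilpotent ℚ L M
  refine (LieModule.isNilpotent_iff ℚ L (AffExt d)).2 ⟨k + 1, ?_⟩
  rw [eq_bot_iff]
  intro z hz
  obtain ⟨m, hm, rfl⟩ := key k z hz
  rw [hk, LieSubmodule.mem_bot] at hm
  rw [hm, map_zero]
  exact zero_mem _

/-- The affine action `e^x · m = m - ∑ xⁱ / (i + 1)! (d x - x m)` attached to a derivation. -/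
def gaugeAct (d : LieDerivation ℚ L M) (x : L) (m : M) : M :=
  m - nilEval dexpSeries (act M x) (d x - ⁅x, m⁆)

/-- The element `(m, c)`. -/
def affMk (d : LieDerivation ℚ L M) (m : M) (c : ℚ) : AffExt d := (m, c)

theorem nexp_affExt (d : LieDerivation ℚ L M) (x : L) (m : M) :
    nexp (act (AffExt d) x) (affMk d m 1) = affMk d (gaugeAct d x m) 1 := by
  have h1 : act (AffExt d) x (affMk d m 1) = affInl d (⁅x, m⁆ - d x) := by
    refine Prod.ext ?_ rfl
    change ⁅x, m⁆ - (1 : ℚ) • d x = ⁅x, m⁆ - d x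
    rw [one_smul]
  have h2 : nilEval dexpSeries (act (AffExt d) x) (affInl d (⁅x, m⁆ - d x)) =
      affInl d (nilEval dexpSeries (act M x) (⁅x, m⁆ - d x)) :=
    (nilEval_intertwine (affInl d) _ (isNilpotent_act x) (isNilpotent_act x)
      (fun m => affInl_lie d x m) _).symm
  rw [nexp_eq_dexp (isNilpotent_act x), LinearMap.add_apply, Module.End.mul_apply, h1, h2]
  refine Prod.ext ?_ (add_zero (1 : ℚ))
  change m + nilEval dexpSeries (act M x) (⁅x, m⁆ - d x) = gaugeAct d x m
  rw [gaugeAct, ← neg_sub (d x), map_neg]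
  exact (sub_eq_add_neg _ _).symm

theorem gaugeAct_bch (d : LieDerivation ℚ L M) (x y : L) (m : M) :
    gaugeAct d (bch x y) m = gaugeAct d x (gaugeAct d y m) := by
  have h := LinearMap.congr_fun (nexp_bch (M := AffExt d) x y) (affMk d m 1)
  rw [Module.End.mul_apply, nexp_affExt, nexp_affExt, nexp_affExt] at h
  exact congrArg Prod.fst h

theorem gaugeAct_zero (d : LieDerivation ℚ L M) (m : M) : gaugeAct d 0 m = m := by
  simp [gaugeAct]

/-- Differentiation of paths as a derivation. -/
def pathDerivation (L : Type*) [LieRing L] [LieAlgebra ℚ L] :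
    LieDerivation ℚ (ℚ[X] ⊗[ℚ] L) (ℚ[X] ⊗[ℚ] L) where
  toLinearMap := pathDer L
  leibniz' a b := by
    change pathDer L ⁅a, b⁆ = ⁅a, pathDer L b⁆ - ⁅b, pathDer L a⁆
    rw [pathDer_lie, ← lie_skew b]
    abel

theorem path_eq_of_nexp_eq (u v : ℚ[X] ⊗[ℚ] L)
    (h : nexp (act (AffExt (pathDerivation L)) u) = nexp (act (AffExt (pathDerivation L)) v))
    (h0 : pathEval L 0 u = pathEval L 0 v) : u = v := by
  have h1 : act (AffExt (pathDerivation L)) u = act (AffExt (pathDerivation L)) v := by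
    rw [← nlog_nexp (isNilpotent_act u), h, nlog_nexp (isNilpotent_act v)]
  have h2 := congrArg Prod.fst
    (LinearMap.congr_fun h1 (affMk (pathDerivation L) 0 1))
  change ⁅u, (0 : ℚ[X] ⊗[ℚ] L)⁆ - (1 : ℚ) • pathDer L u =
    ⁅v, (0 : ℚ[X] ⊗[ℚ] L)⁆ - (1 : ℚ) • pathDer L v at h2
  rw [lie_zero, lie_zero, one_smul, one_smul, zero_sub, zero_sub, neg_inj] at h2
  rw [path_eq u, path_eq v, h0, h2]

/-- Evaluation of paths as a Lie algebra homomorphism. -/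
def pathEvalHom (L : Type*) [LieRing L] [LieAlgebra ℚ L] (c : ℚ) : ℚ[X] ⊗[ℚ] L →ₗ⁅ℚ⁆ L where
  toLinearMap := pathEval L c
  map_lie' {u v} := pathEval_lie c u v

/-- Conjugation by an invertible element. -/
def conjAlg {A : Type*} [Ring A] [Algebra ℚ A] (g g' : A) (h : g' * g = 1) (h' : g * g' = 1) :
    A →ₐ[ℚ] A where
  toFun a := g * a * g'
  map_one' := by rw [mul_one, h']
  map_mul' a b := by
    calc g * (a * b) * g' = g * a * (1 * b) * g' := by rw [one_mul, ← mul_assoc g]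
      _ = g * a * g' * (g * b * g') := by rw [← h]; simp only [mul_assoc]
  map_zero' := by simp
  map_add' a b := by rw [mul_add, add_mul]
  commutes' c := by rw [← Algebra.commutes, mul_assoc, h', mul_one]

theorem bch_zero_right (x : L) : bch x 0 = x := by
  have e : bch (linPath x) 0 = linPath x := by
    refine path_eq_of_nexp_eq _ _ ?_ ?_
    · rw [nexp_bch, map_zero, nexp_zero]
      exact mul_one _
    · refine (map_bch (pathEvalHom L 0) _ _).trans ?_
      change bch (pathEval L 0 (linPath x)) (pathEval L 0 0) = pathEval L 0 (linPath x)
      rw [pathEval_X, zero_smul, map_zero, bch_zero_left]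
  have e1 := congrArg (pathEval L 1) e
  have h := map_bch (pathEvalHom L 1) (linPath x) 0
  change pathEval L 1 _ = bch (pathEval L 1 (linPath x)) (pathEval L 1 0) at h
  rw [h, pathEval_X, one_smul, map_zero] at e1
  exact e1

theorem bch_conj (x y : L) : bch (bch x y) (-x) = nexp (act L x) y := by
  have hev : ∀ c (u v : ℚ[X] ⊗[ℚ] L), pathEval L c (bch u v) =
      bch (pathEval L c u) (pathEval L c v) := fun c u v => map_bch (pathEvalHom L c) u v
  have e : bch (bch (linPath x) (linPath y)) (-linPath x) =
      nexp (act _ (linPath x)) (linPath y) := by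
    refine path_eq_of_nexp_eq _ _ ?_ ?_
    · rw [nexp_bch, nexp_bch, map_neg]
      rw [← nexp_act_conj, nexp, nexp, nexp]
      exact (map_nilEval (conjAlg (nexp (act _ (linPath x))) (nexp (-(act _ (linPath x))))
        (nexp_neg_mul (isNilpotent_act _)) (nexp_mul_neg (isNilpotent_act _))) _ (isNilpotent_act _)).trans rfl
    · simp only [hev, pathEval_nexp, pathEval_X, map_neg, zero_smul, neg_zero, bch_zero_left, map_zero]
  have e1 := congrArg (pathEval L 1) e
  simpa only [hev, pathEval_nexp, pathEval_X, map_neg, one_smul] using e1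

theorem bch_assoc (x y z : L) : bch (bch x y) z = bch x (bch y z) := by
  have hev : ∀ c (u v : ℚ[X] ⊗[ℚ] L), pathEval L c (bch u v) =
      bch (pathEval L c u) (pathEval L c v) := fun c u v => map_bch (pathEvalHom L c) u v
  have e : bch (bch (linPath x) (linPath y)) (linPath z) =
      bch (linPath x) (bch (linPath y) (linPath z)) := by
    refine path_eq_of_nexp_eq _ _ ?_ ?_
    · rw [nexp_bch, nexp_bch, nexp_bch, nexp_bch]
      exact mul_assoc _ _ _
    · simp only [hev, pathEval_X, zero_smul, bch_zero_left]
  have e1 := congrArg (pathEval L 1) e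
  simpa only [hev, pathEval_X, one_smul] using e1

theorem bch_neg_left (x : L) : bch (-x) x = 0 := by
  have hev : ∀ c (u v : ℚ[X] ⊗[ℚ] L), pathEval L c (bch u v) =
      bch (pathEval L c u) (pathEval L c v) := fun c u v => map_bch (pathEvalHom L c) u v
  have e : bch (linPath (-x)) (linPath x) = 0 := by
    refine path_eq_of_nexp_eq _ _ ?_ ?_
    · have hneg : linPath (-x) = -linPath x := TensorProduct.tmul_neg _ _
      rw [nexp_bch, map_zero, nexp_zero, hneg, map_neg]
      exact nexp_neg_mul (isNilpotent_act _)
    · simp only [hev, pathEval_X, zero_smul, bch_zero_left, map_zero]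
  have e1 := congrArg (pathEval L 1) e
  simpa only [hev, pathEval_X, one_smul, map_zero] using e1

theorem bch_neg_right (x : L) : bch x (-x) = 0 := by
  simpa using bch_neg_left (-x)

end Main
end Paths

/-! ### Differential graded Lie algebras -/

universe u v

/-- A differential graded Lie algebra over `ℚ` with underlying vector space `H`. -/
structure DGLA (H : Type u) [AddCommGroup H] [Module ℚ H] where
  /-- The homogeneous components. -/
  gr : ℤ → Submodule ℚ H
  internal : DirectSum.IsInternal gr
  /-- The bracket. -/
  bracket : H →ₗ[ℚ] H →ₗ[ℚ] H
  /-- The differential. -/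
  d : H →ₗ[ℚ] H
  bracket_mem : ∀ {i j x y}, x ∈ gr i → y ∈ gr j → bracket x y ∈ gr (i + j)
  d_mem : ∀ {i x}, x ∈ gr i → d x ∈ gr (i + 1)
  d_d : ∀ x, d (d x) = 0
  bracket_comm : ∀ {i j x y}, x ∈ gr i → y ∈ gr j →
    bracket x y = -((-1 : ℚ) ^ (i * j) • bracket y x)
  leibniz : ∀ {i x}, x ∈ gr i → ∀ y,
    d (bracket x y) = bracket (d x) y + (-1 : ℚ) ^ i • bracket x (d y)
  jacobi : ∀ {i j x y}, x ∈ gr i → y ∈ gr j → ∀ z,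
    bracket x (bracket y z) =
      bracket (bracket x y) z + (-1 : ℚ) ^ (i * j) • bracket y (bracket x z)

theorem isNilpotent_of_filtration {L M : Type*} [LieRing L] [LieAlgebra ℚ L] [AddCommGroup M]
    [Module ℚ M] [LieRingModule L M] [LieModule ℚ L M] (F : ℕ → Submodule ℚ M) (h0 : F 0 = ⊤)
    (hs : ∀ k (x : L) (m : M), m ∈ F k → ⁅x, m⁆ ∈ F (k + 1)) (hk : ∃ k, F k = ⊥) :
    LieModule.IsNilpotent L M := by
  have key : ∀ k, (LieModule.lowerCentralSeries ℚ L M k).toSubmodule ≤ F k := by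
    intro k
    induction k with
    | zero => rw [h0]; exact le_top
    | succ k ih =>
      rw [LieModule.lowerCentralSeries_succ, LieSubmodule.lieIdeal_oper_eq_linear_span']
      refine Submodule.span_le.2 ?_
      rintro _ ⟨x, -, m, hm, rfl⟩
      exact hs k x m (ih hm)
  obtain ⟨k, hk⟩ := hk
  refine (LieModule.isNilpotent_iff ℚ L M).2 ⟨k, ?_⟩
  rw [← LieSubmodule.toSubmodule_eq_bot, eq_bot_iff, ← hk]
  exact key k

namespace DGLA
variable {H : Type u} [AddCommGroup H] [Module ℚ H] (h : DGLA H)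

/-- The lower central series `F⁰ = 𝔥`, `Fⁱ⁺¹ = [𝔥, Fⁱ]`. -/
def lcs : ℕ → Submodule ℚ H
  | 0 => ⊤
  | i + 1 => Submodule.map₂ h.bracket ⊤ (lcs i)

/-- A DGLA is nilpotent if its lower central series vanishes eventually. -/
class IsNilpotent : Prop where
  exists_lcs_eq_bot : ∃ i, h.lcs i = ⊥

/-- A DGLA concentrated in degrees greater than or equal to `-1`. -/
class IsGENegOne : Prop where
  gr_eq_bot : ∀ i < -1, h.gr i = ⊥

theorem bracket_mem_lcs {k : ℕ} (x : H) {y : H} (hy : y ∈ h.lcs k) :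
    h.bracket x y ∈ h.lcs (k + 1) :=
  Submodule.apply_mem_map₂ _ Submodule.mem_top hy

/-! ### The Lie algebra of degree zero elements -/

/-- The Lie algebra `𝔥⁰`. -/
def Zero : Type u := h.gr 0

instance : AddCommGroup h.Zero := inferInstanceAs (AddCommGroup (h.gr 0))

instance : Module ℚ h.Zero := inferInstanceAs (Module ℚ (h.gr 0))

variable {h}

/-- The underlying element of `𝔥`. -/
def Zero.val : h.Zero →ₗ[ℚ] H := (h.gr 0).subtype

theorem Zero.mem (x : h.Zero) : Zero.val x ∈ h.gr 0 := x.2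

theorem Zero.val_injective : Function.Injective (Zero.val (h := h)) := Subtype.val_injective

/-- The element of `𝔥⁰` given by a homogeneous element of `𝔥`. -/
def Zero.mk (x : H) (hx : x ∈ h.gr 0) : h.Zero := ⟨x, hx⟩

theorem Zero.val_mk (x : H) (hx : x ∈ h.gr 0) : Zero.val (Zero.mk x hx) = x := rfl

theorem bracket_zero_comm {x y : H} {j : ℤ} (hx : x ∈ h.gr 0) (hy : y ∈ h.gr j) :
    h.bracket x y = -h.bracket y x := by
  rw [h.bracket_comm hx hy, zero_mul, zpow_zero, one_smul]

theorem bracket_zero_jacobi {x y : H} {j : ℤ} (hx : x ∈ h.gr 0) (hy : y ∈ h.gr j) (z : H) :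
    h.bracket x (h.bracket y z) = h.bracket (h.bracket x y) z + h.bracket y (h.bracket x z) := by
  rw [h.jacobi hx hy, zero_mul, zpow_zero, one_smul]

theorem bracket_zero_leibniz {x : H} (hx : x ∈ h.gr 0) (y : H) :
    h.d (h.bracket x y) = h.bracket (h.d x) y + h.bracket x (h.d y) := by
  rw [h.leibniz hx, zpow_zero, one_smul]

theorem bracket_zero_self {x : H} (hx : x ∈ h.gr 0) : h.bracket x x = 0 := by
  have := bracket_zero_comm hx hx
  have h2 : (2 : ℚ) • h.bracket x x = 0 := by
    rw [two_smul]; nth_rewrite 1 [this]; exact neg_add_cancel _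
  exact (smul_eq_zero.1 h2).resolve_left two_ne_zero

instance : LieRing h.Zero where
  bracket x y := Zero.mk (h.bracket (Zero.val x) (Zero.val y))
    (by simpa using h.bracket_mem x.mem y.mem)
  add_lie x y z := Zero.val_injective (by
    change h.bracket (Zero.val (x + y)) (Zero.val z) = h.bracket (Zero.val x) (Zero.val z) +
      h.bracket (Zero.val y) (Zero.val z)
    rw [map_add, map_add, LinearMap.add_apply])
  lie_add x y z := Zero.val_injective (by
    change h.bracket (Zero.val x) (Zero.val (y + z)) = h.bracket (Zero.val x) (Zero.val y) +
      h.bracket (Zero.val x) (Zero.val z)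
    rw [map_add, map_add])
  lie_self x := Zero.val_injective (bracket_zero_self x.mem)
  leibniz_lie x y z := Zero.val_injective (bracket_zero_jacobi x.mem y.mem (Zero.val z))

theorem Zero.val_lie (x y : h.Zero) : Zero.val ⁅x, y⁆ = h.bracket (Zero.val x) (Zero.val y) := rfl

instance : LieAlgebra ℚ h.Zero where
  lie_smul t x y := Zero.val_injective (by
    rw [Zero.val_lie, map_smul, map_smul, map_smul, Zero.val_lie])

instance : LieRingModule h.Zero H where
  bracket x m := h.bracket (Zero.val x) m
  add_lie x y m := by
    change h.bracket (Zero.val (x + y)) m = h.bracket (Zero.val x) m + h.bracket (Zero.val y) m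
    rw [map_add, map_add, LinearMap.add_apply]
  lie_add x m n := map_add (h.bracket (Zero.val x)) m n
  leibniz_lie x y m := bracket_zero_jacobi x.mem y.mem m

theorem zero_lie_def (x : h.Zero) (m : H) : ⁅x, m⁆ = h.bracket (Zero.val x) m := rfl

instance : LieModule ℚ h.Zero H where
  smul_lie t x m := by
    rw [zero_lie_def, map_smul, map_smul, LinearMap.smul_apply, zero_lie_def]
  lie_smul t x m := by rw [zero_lie_def, map_smul, zero_lie_def]

instance [h.IsNilpotent] : LieModule.IsNilpotent h.Zero H :=
  isNilpotent_of_filtration h.lcs rfl (fun _ x _ hm => h.bracket_mem_lcs (Zero.val x) hm)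
    IsNilpotent.exists_lcs_eq_bot

instance [h.IsNilpotent] : LieRing.IsNilpotent h.Zero :=
  isNilpotent_of_filtration (fun k => (h.lcs k).comap Zero.val)
    (by rw [lcs, Submodule.comap_top])
    (fun _ x _ hm => h.bracket_mem_lcs (Zero.val x) hm)
    (by
      obtain ⟨k, hk⟩ := IsNilpotent.exists_lcs_eq_bot (h := h)
      refine ⟨k, ?_⟩
      rw [hk, Submodule.comap_bot]
      exact LinearMap.ker_eq_bot.2 Zero.val_injective)

variable (h)

/-- The differential `𝔥⁰ → 𝔥` as a derivation. -/
def dZero : LieDerivation ℚ h.Zero H where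
  toLinearMap := h.d ∘ₗ Zero.val
  leibniz' x y := by
    change h.d (h.bracket (Zero.val x) (Zero.val y)) =
      h.bracket (Zero.val x) (h.d (Zero.val y)) - h.bracket (Zero.val y) (h.d (Zero.val x))
    rw [bracket_zero_leibniz x.mem, bracket_zero_comm y.mem (h.d_mem x.mem)]
    abel

theorem dZero_apply (x : h.Zero) : h.dZero x = h.d (Zero.val x) := rfl

/-- The gauge action
`(exp X) · γ = γ - ∑ (ad X)ⁱ / (i + 1)! (d X + [γ, X])` of the group `exp 𝔥⁰` on `𝔥¹`.
(Here it is used on Maurer-Cartan elements only.) -/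
def gauge (X : h.Zero) (γ : H) : H :=
  γ - nilEval dexpSeries (act H X) (h.d (Zero.val X) + h.bracket γ (Zero.val X))

variable {h}

theorem gauge_eq (X : h.Zero) {γ : H} (hγ : γ ∈ h.gr 1) : h.gauge X γ = gaugeAct h.dZero X γ := by
  rw [gauge, gaugeAct, zero_lie_def, bracket_zero_comm X.mem hγ, sub_neg_eq_add]
  rfl

theorem nilEval_mem_gr (f : PowerSeries ℚ) (X : h.Zero) {i : ℤ} {m : H} (hm : m ∈ h.gr i) :
    nilEval f (act H X) m ∈ h.gr i := by
  have hp : ∀ k : ℕ, (act H X ^ k) m ∈ h.gr i := by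
    intro k
    induction k with
    | zero => simpa using hm
    | succ k ih =>
      rw [pow_succ', Module.End.mul_apply, act_apply, zero_lie_def]
      simpa using h.bracket_mem X.mem ih
  rw [nilEval, LinearMap.sum_apply]
  exact (h.gr i).sum_mem fun k _ => (h.gr i).smul_mem _ (hp k)

variable (h)

/-- The twisted differential `δ_γ = d + [γ, ·]`. -/
def twist (γ : H) : H →ₗ[ℚ] H := h.d + h.bracket γ

theorem twist_apply (γ x : H) : h.twist γ x = h.d x + h.bracket γ x := rfl

variable {h}

theorem twist_mem {γ x : H} {i : ℤ} (hγ : γ ∈ h.gr 1) (hx : x ∈ h.gr i) :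
    h.twist γ x ∈ h.gr (i + 1) :=
  add_mem (h.d_mem hx) (by rw [add_comm i]; exact h.bracket_mem hγ hx)

theorem twist_leibniz {γ x : H} {i : ℤ} (hγ : γ ∈ h.gr 1) (hx : x ∈ h.gr i) (y : H) :
    h.twist γ (h.bracket x y) =
      h.bracket (h.twist γ x) y + (-1 : ℚ) ^ i • h.bracket x (h.twist γ y) := by
  simp only [twist_apply, map_add, LinearMap.add_apply]
  rw [h.leibniz hx, h.jacobi hγ hx, one_mul, smul_add]
  abel

variable (h)

/-- Maurer-Cartan elements: the objects of the Deligne-Getzler 2-groupoid `MC²(𝔥)`. -/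
structure MC where
  /-- The underlying element. -/
  elt : H
  mem : elt ∈ h.gr 1
  eqn : h.d elt + (1 / 2 : ℚ) • h.bracket elt elt = 0

variable {h}

theorem twist_twist (γ : h.MC) (x : H) : h.twist γ.elt (h.twist γ.elt x) = 0 := by
  have h1 : h.d (h.bracket γ.elt x) = h.bracket (h.d γ.elt) x - h.bracket γ.elt (h.d x) := by
    rw [h.leibniz γ.mem, zpow_one, neg_smul, one_smul, sub_eq_add_neg]
  have h2 : (2 : ℚ) • h.bracket γ.elt (h.bracket γ.elt x) =
      h.bracket (h.bracket γ.elt γ.elt) x := by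
    have := h.jacobi γ.mem γ.mem x
    rw [mul_one, zpow_one, neg_smul, one_smul] at this
    rw [two_smul]
    nth_rewrite 1 [this]
    abel
  have h3 : h.bracket γ.elt (h.bracket γ.elt x) =
      (1 / 2 : ℚ) • h.bracket (h.bracket γ.elt γ.elt) x := by
    rw [← h2, smul_smul]; norm_num
  have h4 := congrArg (fun z => h.bracket z x) γ.eqn
  simp only [map_add, map_smul, LinearMap.add_apply, LinearMap.smul_apply, map_zero,
    LinearMap.zero_apply] at h4
  simp only [twist_apply, map_add, h.d_d, h1, h3, zero_add]
  rw [← h4]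
  abel

/-! ### The Lie algebras of degree minus one elements -/

/-- The Lie algebra `𝔥⁻¹` with the bracket `[a, b]_γ = [a, d b + [γ, b]]`. -/
def NegOne (_γ : h.MC) : Type u := h.gr (-1)

namespace NegOne
variable {γ : h.MC}

instance : AddCommGroup (NegOne γ) := inferInstanceAs (AddCommGroup (h.gr (-1)))

instance : Module ℚ (NegOne γ) := inferInstanceAs (Module ℚ (h.gr (-1)))

/-- The underlying element of `𝔥`. -/
def val : NegOne γ →ₗ[ℚ] H := (h.gr (-1)).subtype

theorem mem (a : NegOne γ) : val a ∈ h.gr (-1) := a.2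

theorem val_injective : Function.Injective (val (γ := γ)) := Subtype.val_injective

/-- The element of `𝔥⁻¹` given by a homogeneous element of `𝔥`. -/
def mk (x : H) (hx : x ∈ h.gr (-1)) : NegOne γ := ⟨x, hx⟩

theorem val_mk (x : H) (hx : x ∈ h.gr (-1)) : val (mk x hx : NegOne γ) = x := rfl

/-- The map `δ_γ : 𝔥⁻¹ → 𝔥⁰`, `a ↦ d a + [γ, a]`. -/
def delta : NegOne γ →ₗ[ℚ] h.Zero where
  toFun a := Zero.mk (h.d (val a) + h.bracket γ.elt (val a)) (twist_mem γ.mem a.mem)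
  map_add' a b := Zero.val_injective (map_add (h.twist γ.elt) (val a) (val b))
  map_smul' t a := Zero.val_injective (map_smul (h.twist γ.elt) t (val a))

theorem val_delta (a : NegOne γ) : Zero.val (delta a) = h.twist γ.elt (val a) := rfl

variable [h.IsGENegOne]

theorem bracket_twist (a b : NegOne γ) :
    h.bracket (val a) (h.twist γ.elt (val b)) = h.bracket (h.twist γ.elt (val a)) (val b) := by
  have h0 : h.bracket (val a) (val b) = 0 := by
    have := h.bracket_mem a.mem b.mem
    rwa [IsGENegOne.gr_eq_bot (-1 + -1) (by norm_num), Submodule.mem_bot] at this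
  have h1 := twist_leibniz γ.mem a.mem (val b)
  rw [h0, map_zero, zpow_neg_one, inv_neg, inv_one, neg_smul, one_smul, ← sub_eq_add_neg] at h1
  exact (sub_eq_zero.1 h1.symm).symm

theorem bracket_twist_comm (a b : NegOne γ) :
    h.bracket (val a) (h.twist γ.elt (val b)) = -h.bracket (val b) (h.twist γ.elt (val a)) := by
  rw [bracket_twist]
  exact bracket_zero_comm (delta a).mem b.mem

theorem bracket_twist_self (a : NegOne γ) : h.bracket (val a) (h.twist γ.elt (val a)) = 0 := by
  have h2 : (2 : ℚ) • h.bracket (val a) (h.twist γ.elt (val a)) = 0 := by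
    rw [two_smul]; nth_rewrite 1 [bracket_twist_comm]; exact neg_add_cancel _
  exact (smul_eq_zero.1 h2).resolve_left two_ne_zero

theorem twist_bracket_twist (a b : NegOne γ) :
    h.twist γ.elt (h.bracket (val a) (h.twist γ.elt (val b))) =
      h.bracket (h.twist γ.elt (val a)) (h.twist γ.elt (val b)) := by
  rw [twist_leibniz γ.mem a.mem, twist_twist, map_zero, smul_zero, add_zero]

instance : Bracket (NegOne γ) (NegOne γ) where
  bracket a b := mk (h.bracket (val a) (h.d (val b) + h.bracket γ.elt (val b)))
    (h.bracket_mem a.mem (delta b).mem)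

theorem val_lie (a b : NegOne γ) :
    val ⁅a, b⁆ = h.bracket (val a) (h.twist γ.elt (val b)) := rfl

theorem val_lie' (a b : NegOne γ) :
    val ⁅a, b⁆ = h.bracket (h.twist γ.elt (val a)) (val b) := by
  rw [val_lie, bracket_twist]

instance : LieRing (NegOne γ) where
  add_lie a b c := val_injective (by
    simp only [map_add, val_lie, LinearMap.add_apply])
  lie_add a b c := val_injective (by
    simp only [map_add, val_lie])
  lie_self a := val_injective (bracket_twist_self a)
  leibniz_lie a b c := val_injective (by
    simp only [map_add, val_lie']
    rw [← bracket_twist a b, twist_bracket_twist]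
    exact bracket_zero_jacobi (delta a).mem (delta b).mem (val c))

instance : LieAlgebra ℚ (NegOne γ) where
  lie_smul t a b := val_injective (by simp only [map_smul, val_lie])

instance [h.IsNilpotent] : LieRing.IsNilpotent (NegOne γ) :=
  isNilpotent_of_filtration (fun k => (h.lcs k).comap val)
    (by rw [lcs, Submodule.comap_top])
    (fun k x m hm => by
      rw [Submodule.mem_comap, val_lie']
      exact h.bracket_mem_lcs _ hm)
    (by
      obtain ⟨k, hk⟩ := IsNilpotent.exists_lcs_eq_bot (h := h)
      refine ⟨k, ?_⟩
      rw [hk, Submodule.comap_bot]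
      exact LinearMap.ker_eq_bot.2 val_injective)

/-- The map `δ_γ` as a homomorphism of Lie algebras. -/
def deltaHom : NegOne γ →ₗ⁅ℚ⁆ h.Zero where
  toLinearMap := delta
  map_lie' {a b} := Zero.val_injective (twist_bracket_twist a b)

variable [h.IsNilpotent]

theorem delta_bch (a b : NegOne γ) : delta (bch a b) = bch (delta a) (delta b) :=
  map_bch (deltaHom (γ := γ)) a b

theorem peiffer (a b : NegOne γ) :
    nexp (act H (delta a)) (val b) = val (bch (bch a b) (-a)) := by
  rw [bch_conj]
  exact (nilEval_intertwine val _ (isNilpotent_act a) (isNilpotent_act (delta a))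
    (fun m => val_lie' a m) b).symm

end NegOne
end DGLA

/-! ### The Deligne-Getzler 2-groupoid -/

open CategoryTheory

namespace DGLA
variable {H : Type u} [AddCommGroup H] [Module ℚ H] {h : DGLA H}

theorem bracket_zero_jacobi' {x : H} (hx : x ∈ h.gr 0) (y z : H) :
    h.bracket x (h.bracket y z) = h.bracket (h.bracket x y) z + h.bracket y (h.bracket x z) := by
  have hy : y ∈ ⨆ i, h.gr i := by rw [h.internal.submodule_iSup_eq_top]; exact Submodule.mem_top
  refine Submodule.iSup_induction _ (motive := fun y => h.bracket x (h.bracket y z) =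
    h.bracket (h.bracket x y) z + h.bracket y (h.bracket x z)) hy (fun i y hy => bracket_zero_jacobi hx hy z) ?_ ?_
  · simp
  · intro a b ha hb
    simp only [map_add, LinearMap.add_apply, ha, hb]
    abel

section Exp
variable [h.IsNilpotent]

/-- The operator `e^{ad X}` for `X ∈ 𝔥⁰`. -/
def expAd (X : h.Zero) : H →ₗ[ℚ] H := nexp (act H X)

theorem expAd_mem (X : h.Zero) {i : ℤ} {m : H} (hm : m ∈ h.gr i) : expAd X m ∈ h.gr i :=
  nilEval_mem_gr _ X hm

theorem expAd_bch (X Y : h.Zero) (m : H) : expAd (bch X Y) m = expAd X (expAd Y m) :=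
  LinearMap.congr_fun (nexp_bch X Y) m

theorem expAd_zero (m : H) : expAd (0 : h.Zero) m = m := by
  rw [expAd, map_zero, nexp_zero, Module.End.one_apply]

theorem nexp_neg_apply_nexp (X : h.Zero) (m : H) : nexp (-(act H X)) (nexp (act H X) m) = m :=
  LinearMap.congr_fun (nexp_neg_mul (isNilpotent_act X)) m

theorem expAd_bracket (X : h.Zero) (x y : H) :
    expAd X (h.bracket x y) = h.bracket (expAd X x) (expAd X y) := by
  have hi : h.bracket (nexp (act H X) x) = nexp (comm (act H X)) (h.bracket x) := by
    refine nilEval_intertwine (h.bracket : H →ₗ[ℚ] Module.End ℚ H) _ (isNilpotent_act X)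
      (isNilpotent_comm (isNilpotent_act X)) (fun m => LinearMap.ext fun z => ?_) x
    have := bracket_zero_jacobi' X.mem m z
    rw [comm_apply, LinearMap.sub_apply, Module.End.mul_apply, Module.End.mul_apply, act_apply,
      act_apply, act_apply, zero_lie_def, zero_lie_def, zero_lie_def, this, add_sub_cancel_right]
  rw [expAd, hi, nexp_comm (isNilpotent_act X), Module.End.mul_apply, Module.End.mul_apply,
    nexp_neg_apply_nexp]

variable (h) in
/-- The map `(m, c) ↦ ad m + c d`. -/
def twistAff : AffExt h.dZero →ₗ[ℚ] Module.End ℚ H :=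
  LinearMap.coprod h.bracket (LinearMap.toSpanSingleton ℚ (Module.End ℚ H) h.d)

theorem twistAff_apply (z : AffExt h.dZero) (x : H) :
    twistAff h z x = h.bracket z.1 x + z.2 • h.d x := rfl

theorem expAd_twist (X : h.Zero) {γ : H} (hγ : γ ∈ h.gr 1) (x : H) :
    expAd X (h.twist γ x) = h.twist (h.gauge X γ) (expAd X x) := by
  have hi : twistAff h (nexp (act (AffExt h.dZero) X) (affMk h.dZero γ 1)) =
      nexp (comm (act H X)) (twistAff h (affMk h.dZero γ 1)) := by
    refine nilEval_intertwine (twistAff h) _ (isNilpotent_act X)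
      (isNilpotent_comm (isNilpotent_act X)) (fun z => LinearMap.ext fun y => ?_) _
    have h1 := bracket_zero_jacobi' X.mem z.1 y
    have h2 := bracket_zero_leibniz X.mem y
    rw [comm_apply, LinearMap.sub_apply, Module.End.mul_apply, Module.End.mul_apply, act_apply,
      act_apply, act_apply, zero_lie_def, zero_lie_def, twistAff_apply, twistAff_apply,
      twistAff_apply, affExt_lie, zero_lie_def, dZero_apply, map_add, h1, map_smul, h2, map_sub,
      LinearMap.sub_apply, map_smul, LinearMap.smul_apply, smul_add, zero_smul]
    abel
  have ht : ∀ m : H, twistAff h (affMk h.dZero m 1) = h.twist m := by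
    intro m
    refine LinearMap.ext fun x => ?_
    rw [twistAff_apply, twist_apply, add_comm]
    congr 1
    exact one_smul _ _
  rw [nexp_affExt, ht, ht, nexp_comm (isNilpotent_act X), ← gauge_eq X hγ] at hi
  rw [hi, expAd, Module.End.mul_apply, Module.End.mul_apply, nexp_neg_apply_nexp]

theorem gauge_zero (γ : h.MC) : h.gauge 0 γ.elt = γ.elt := by
  rw [gauge_eq _ γ.mem, gaugeAct_zero]

end Exp

namespace MC

/-- A gauge equivalence `exp X : γ₁ → γ₂`, that is an element `X ∈ 𝔥⁰` such that
`(exp X) · γ₁ = γ₂`: a 1-morphism of `MC²(𝔥)`. -/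
@[ext]
structure Hom (γ₁ γ₂ : h.MC) where
  /-- The logarithm of the gauge equivalence. -/
  log : h.Zero
  gauge_eq : h.gauge log γ₁.elt = γ₂.elt

/-- A 2-morphism from `exp X` to `exp Y`, that is an element `exp_{γ₂} t` of the
group `exp_{γ₂} 𝔥⁻¹` such that `exp (d t + [γ₂, t]) exp X = exp Y`. -/
@[ext]
structure Hom₂ {γ₁ γ₂ : h.MC} (X Y : Hom γ₁ γ₂) where
  /-- The logarithm of the 2-morphism. -/
  log : NegOne γ₂
  eq : bch (NegOne.delta log) X.log = Y.log

variable [h.IsNilpotent]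

theorem Hom.expAd_twist {γ₁ γ₂ : h.MC} (X : Hom γ₁ γ₂) (x : H) :
    expAd X.log (h.twist γ₁.elt x) = h.twist γ₂.elt (expAd X.log x) := by
  rw [DGLA.expAd_twist _ γ₁.mem, X.gauge_eq]

/-- The composition of 1-morphisms is the product in `exp 𝔥⁰`. -/
instance : CategoryStruct h.MC where
  Hom := Hom
  id γ := ⟨0, gauge_zero γ⟩
  comp {γ₁ _ _} X Y := ⟨bch Y.log X.log, by
    rw [DGLA.gauge_eq _ γ₁.mem, gaugeAct_bch, ← DGLA.gauge_eq _ γ₁.mem, X.gauge_eq,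
      ← DGLA.gauge_eq _ (MC.mem _), Y.gauge_eq]⟩

theorem id_log (γ : h.MC) : Hom.log (𝟙 γ) = 0 := rfl

theorem comp_log {γ₁ γ₂ γ₃ : h.MC} (X : γ₁ ⟶ γ₂) (Y : γ₂ ⟶ γ₃) :
    Hom.log (X ≫ Y) = bch Y.log X.log := rfl

theorem hom_ext {γ₁ γ₂ : h.MC} {X Y : γ₁ ⟶ γ₂} (e : X.log = Y.log) : X = Y := Hom.ext e

variable [h.IsGENegOne]

/-- The groupoid of 1-morphisms is the action groupoid of `exp_{γ₂} 𝔥⁻¹`. -/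
instance (γ₁ γ₂ : h.MC) : Groupoid (γ₁ ⟶ γ₂) where
  Hom X Y := Hom₂ X Y
  id X := ⟨0, by rw [map_zero, bch_zero_left]⟩
  comp s t := ⟨bch t.log s.log, by rw [NegOne.delta_bch, bch_assoc, s.eq, t.eq]⟩
  id_comp s := Hom₂.ext (bch_zero_right _)
  comp_id s := Hom₂.ext (bch_zero_left _)
  assoc s t r := Hom₂.ext (bch_assoc _ _ _).symm
  inv {X Y} s := ⟨-s.log, by
    rw [← s.eq, ← bch_assoc, ← NegOne.delta_bch, bch_neg_left, map_zero, bch_zero_left]⟩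
  inv_comp s := Hom₂.ext (bch_neg_right _)
  comp_inv s := Hom₂.ext (bch_neg_left _)

theorem id₂_log {γ₁ γ₂ : h.MC} (X : γ₁ ⟶ γ₂) : Hom₂.log (𝟙 X) = 0 := rfl

theorem comp₂_log {γ₁ γ₂ : h.MC} {X Y Z : γ₁ ⟶ γ₂} (s : X ⟶ Y) (t : Y ⟶ Z) :
    Hom₂.log (s ≫ t) = bch t.log s.log := rfl

theorem hom₂_ext {γ₁ γ₂ : h.MC} {X Y : γ₁ ⟶ γ₂} {s t : X ⟶ Y} (e : s.log = t.log) : s = t :=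
  Hom₂.ext e

theorem eqToHom_log {γ₁ γ₂ : h.MC} {X Y : γ₁ ⟶ γ₂} (e : X = Y) :
    Hom₂.log (eqToHom e) = 0 := by
  subst e; rfl

/-- The map `e^{ad X} : 𝔥⁻¹ → 𝔥⁻¹` intertwining the brackets `[·, ·]_{γ₁}` and `[·, ·]_{γ₂}`,
for a gauge equivalence `exp X : γ₁ → γ₂`. -/
def expHom {γ₁ γ₂ : h.MC} (X : γ₁ ⟶ γ₂) : NegOne γ₁ →ₗ⁅ℚ⁆ NegOne γ₂ where
  toFun a := NegOne.mk (expAd X.log (NegOne.val a)) (expAd_mem _ a.mem)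
  map_add' a b := NegOne.val_injective (map_add (expAd X.log ∘ₗ NegOne.val) a b)
  map_smul' t a := NegOne.val_injective (map_smul (expAd X.log ∘ₗ NegOne.val) t a)
  map_lie' {a b} := NegOne.val_injective (by
    change expAd X.log (h.bracket (NegOne.val a) (h.twist γ₁.elt (NegOne.val b))) =
      h.bracket (expAd X.log (NegOne.val a)) (h.twist γ₂.elt (expAd X.log (NegOne.val b)))
    rw [expAd_bracket, X.expAd_twist])

theorem val_expHom {γ₁ γ₂ : h.MC} (X : γ₁ ⟶ γ₂) (a : NegOne γ₁) :
    NegOne.val (expHom X a) = expAd X.log (NegOne.val a) := rfl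

theorem expHom_id (γ : h.MC) (a : NegOne γ) : expHom (𝟙 γ) a = a :=
  NegOne.val_injective (expAd_zero _)

theorem expHom_comp {γ₁ γ₂ γ₃ : h.MC} (X : γ₁ ⟶ γ₂) (Y : γ₂ ⟶ γ₃) (a : NegOne γ₁) :
    expHom (X ≫ Y) a = expHom Y (expHom X a) :=
  NegOne.val_injective (expAd_bch _ _ _)

theorem bch_delta_expHom {γ₁ γ₂ : h.MC} (X : γ₁ ⟶ γ₂) (a : NegOne γ₁) :
    bch (NegOne.delta (expHom X a)) X.log = bch X.log (NegOne.delta a) := by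
  have e : NegOne.delta (expHom X a) = bch (bch X.log (NegOne.delta a)) (-X.log) := by
    rw [bch_conj]
    apply Zero.val_injective
    rw [NegOne.val_delta, val_expHom, ← X.expAd_twist]
    exact (nilEval_intertwine Zero.val _ (isNilpotent_act X.log) (isNilpotent_act X.log)
      (fun m => rfl) (NegOne.delta a)).symm
  rw [e, bch_assoc, bch_neg_left, bch_zero_right]

theorem expHom_hom₂ {γ₁ γ₂ : h.MC} {X Y : γ₁ ⟶ γ₂} (s : X ⟶ Y) (a : NegOne γ₁) :
    bch (expHom Y a) s.log = bch s.log (expHom X a) := by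
  have e : expHom Y a = bch (bch s.log (expHom X a)) (-s.log) := by
    apply NegOne.val_injective
    rw [← NegOne.peiffer, val_expHom, val_expHom, ← s.eq, expAd_bch]
    rfl
  rw [e, bch_assoc, bch_neg_left, bch_zero_right]

/-- The Deligne-Getzler 2-groupoid `MC²(𝔥)`. -/
instance : Bicategory h.MC where
  homCategory _ _ := inferInstance
  whiskerLeft X _ _ t := ⟨t.log, by rw [comp_log, comp_log, ← bch_assoc, t.eq]⟩
  whiskerRight t Z := ⟨expHom Z t.log, by
    rw [comp_log, comp_log, ← bch_assoc, bch_delta_expHom, bch_assoc, t.eq]⟩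
  associator X Y Z := eqToIso (hom_ext (bch_assoc _ _ _).symm)
  leftUnitor X := eqToIso (hom_ext (bch_zero_right _))
  rightUnitor X := eqToIso (hom_ext (bch_zero_left _))
  whiskerLeft_id X Y := rfl
  whiskerLeft_comp X _ _ _ s t := rfl
  id_whiskerLeft s := hom₂_ext (by
    simp only [comp₂_log, eqToIso.hom, eqToIso.inv, eqToHom_log, bch_zero_left, bch_zero_right])
  comp_whiskerLeft X Y _ _ s := hom₂_ext (by
    simp only [comp₂_log, eqToIso.hom, eqToIso.inv, eqToHom_log, bch_zero_left, bch_zero_right])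
  id_whiskerRight X Y := hom₂_ext (map_zero _)
  comp_whiskerRight s t X := hom₂_ext (map_bch (expHom X) _ _)
  whiskerRight_id s := hom₂_ext (by
    simp only [comp₂_log, eqToIso.hom, eqToIso.inv, eqToHom_log, bch_zero_left, bch_zero_right,
      expHom_id])
  whiskerRight_comp s X Y := hom₂_ext (by
    simp only [comp₂_log, eqToIso.hom, eqToIso.inv, eqToHom_log, bch_zero_left, bch_zero_right,
      expHom_comp])
  whisker_assoc X _ _ s Y := hom₂_ext (by
    simp only [comp₂_log, eqToIso.hom, eqToIso.inv, eqToHom_log, bch_zero_left, bch_zero_right])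
  whisker_exchange s t := hom₂_ext (by
    simp only [comp₂_log]
    exact expHom_hom₂ t s.log)
  pentagon X Y Z W := hom₂_ext (by
    simp only [comp₂_log, eqToIso.hom, eqToHom_log, bch_zero_right,
      map_zero])
  triangle X Y := hom₂_ext (by
    simp only [comp₂_log, eqToIso.hom, eqToHom_log, bch_zero_right,
      map_zero])

end MC
end DGLA

open CategoryTheory.Bicategory

namespace DGLA

namespace MC
variable {H : Type u} [AddCommGroup H] [Module ℚ H] {h : DGLA H} [h.IsNilpotent] [h.IsGENegOne]

instance : Bicategory.Strict h.MC where
  id_comp _ := hom_ext (bch_zero_right _)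
  comp_id _ := hom_ext (bch_zero_left _)
  assoc _ _ _ := hom_ext (bch_assoc _ _ _).symm
  leftUnitor_eqToIso _ := rfl
  rightUnitor_eqToIso _ := rfl
  associator_eqToIso _ _ _ := rfl

/-- The 2-morphisms of `MC²(𝔥)` are invertible. -/
theorem isLocallyGroupoid : Bicategory.IsLocallyGroupoid h.MC := fun _ _ => inferInstance

/-- The 1-morphisms of `MC²(𝔥)` are invertible. -/
theorem exists_inv {γ₁ γ₂ : h.MC} (X : γ₁ ⟶ γ₂) :
    ∃ Y : γ₂ ⟶ γ₁, X ≫ Y = 𝟙 γ₁ ∧ Y ≫ X = 𝟙 γ₂ := by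
  refine ⟨⟨-X.log, ?_⟩, hom_ext (bch_neg_left _), hom_ext (bch_neg_right _)⟩
  rw [← X.gauge_eq, DGLA.gauge_eq X.log γ₁.mem, DGLA.gauge_eq, ← gaugeAct_bch, bch_neg_left,
    gaugeAct_zero]
  rw [← DGLA.gauge_eq X.log γ₁.mem, X.gauge_eq]
  exact γ₂.mem

end MC

/-- A homomorphism of DGLAs. -/
structure Hom {H : Type u} [AddCommGroup H] [Module ℚ H] {K : Type v} [AddCommGroup K] [Module ℚ K]
    (h : DGLA H) (k : DGLA K) where
  /-- The underlying linear map. -/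
  toLin : H →ₗ[ℚ] K
  map_mem : ∀ {i x}, x ∈ h.gr i → toLin x ∈ k.gr i
  map_bracket : ∀ x y, toLin (h.bracket x y) = k.bracket (toLin x) (toLin y)
  map_d : ∀ x, toLin (h.d x) = k.d (toLin x)

namespace Hom
variable {H : Type u} [AddCommGroup H] [Module ℚ H] {K : Type v} [AddCommGroup K] [Module ℚ K]
  {h : DGLA H} {k : DGLA K} (f : Hom h k)

/-- The restriction to elements of degree zero. -/
def zero : h.Zero →ₗ⁅ℚ⁆ k.Zero where
  toFun x := Zero.mk (f.toLin (Zero.val x)) (f.map_mem x.mem)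
  map_add' x y := Zero.val_injective (map_add (f.toLin ∘ₗ Zero.val) x y)
  map_smul' t x := Zero.val_injective (map_smul (f.toLin ∘ₗ Zero.val) t x)
  map_lie' {x y} := Zero.val_injective (f.map_bracket (Zero.val x) (Zero.val y))

theorem val_zero (x : h.Zero) : Zero.val (f.zero x) = f.toLin (Zero.val x) := rfl

/-- The action on Maurer-Cartan elements. -/
def mcObj (γ : h.MC) : k.MC where
  elt := f.toLin γ.elt
  mem := f.map_mem γ.mem
  eqn := by rw [← f.map_bracket, ← f.map_d, ← map_smul, ← map_add, γ.eqn, map_zero]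

/-- The restriction to elements of degree minus one. -/
def negOneLin (γ : h.MC) : NegOne γ →ₗ[ℚ] NegOne (f.mcObj γ) where
  toFun a := NegOne.mk (f.toLin (NegOne.val a)) (f.map_mem a.mem)
  map_add' x y := NegOne.val_injective (map_add (f.toLin ∘ₗ NegOne.val) x y)
  map_smul' t x := NegOne.val_injective (map_smul (f.toLin ∘ₗ NegOne.val) t x)

theorem val_negOneLin (γ : h.MC) (a : NegOne γ) :
    NegOne.val (f.negOneLin γ a) = f.toLin (NegOne.val a) := rfl

theorem map_twist (γ : h.MC) (x : H) :
    f.toLin (h.twist γ.elt x) = k.twist (f.mcObj γ).elt (f.toLin x) := by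
  rw [twist_apply, map_add, f.map_bracket, f.map_d]
  rfl

theorem delta_negOneLin (γ : h.MC) (a : NegOne γ) :
    NegOne.delta (f.negOneLin γ a) = f.zero (NegOne.delta a) :=
  Zero.val_injective (f.map_twist γ (NegOne.val a)).symm

variable [h.IsNilpotent] [k.IsNilpotent]

theorem map_nilEval (p : PowerSeries ℚ) (X : h.Zero) (m : H) :
    f.toLin (nilEval p (act H X) m) = nilEval p (act K (f.zero X)) (f.toLin m) :=
  nilEval_intertwine f.toLin p (isNilpotent_act X) (isNilpotent_act (f.zero X))
    (fun m => f.map_bracket (Zero.val X) m) m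

theorem map_gauge (X : h.Zero) (γ : H) :
    f.toLin (h.gauge X γ) = k.gauge (f.zero X) (f.toLin γ) := by
  rw [gauge, map_sub, f.map_nilEval, map_add, f.map_bracket, f.map_d]
  rfl

/-- The action on gauge equivalences. -/
def mcMap {γ₁ γ₂ : h.MC} (X : γ₁ ⟶ γ₂) : f.mcObj γ₁ ⟶ f.mcObj γ₂ :=
  ⟨f.zero X.log, by
    change k.gauge (f.zero X.log) (f.toLin γ₁.elt) = f.toLin γ₂.elt
    rw [← f.map_gauge, X.gauge_eq]⟩

variable [h.IsGENegOne] [k.IsGENegOne]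

/-- The homomorphism of Lie algebras induced on elements of degree minus one. -/
def negOne (γ : h.MC) : NegOne γ →ₗ⁅ℚ⁆ NegOne (f.mcObj γ) where
  toLinearMap := f.negOneLin γ
  map_lie' {a b} := NegOne.val_injective (by
    change f.toLin (h.bracket (NegOne.val a) (h.twist γ.elt (NegOne.val b))) =
      k.bracket (f.toLin (NegOne.val a)) (k.twist (f.mcObj γ).elt (f.toLin (NegOne.val b)))
    rw [f.map_bracket, f.map_twist])

/-- The action on 2-morphisms. -/
def mcMap₂ {γ₁ γ₂ : h.MC} {X Y : γ₁ ⟶ γ₂} (t : X ⟶ Y) : f.mcMap X ⟶ f.mcMap Y :=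
  ⟨f.negOne γ₂ t.log, by
    change bch (NegOne.delta (f.negOneLin γ₂ t.log)) (f.zero X.log) = f.zero Y.log
    rw [delta_negOneLin, ← map_bch, t.eq]⟩

/-- The strict 2-functor `MC²(𝔥) → MC²(𝔨)` induced by a homomorphism of DGLAs. -/
def mc : StrictPseudofunctor h.MC k.MC := StrictPseudofunctor.mk'' {
  obj := f.mcObj
  map := f.mcMap
  map₂ := f.mcMap₂
  map₂_id := fun _ => MC.hom₂_ext (map_zero _)
  map₂_comp := fun _ _ => MC.hom₂_ext (map_bch (f.negOne _) _ _)
  map_id := fun _ => MC.hom_ext (map_zero _)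
  map_comp := fun _ _ => MC.hom_ext (map_bch f.zero _ _)
  map₂_whisker_left := fun X _ _ t => MC.hom₂_ext (by
    simp only [MC.comp₂_log, MC.eqToHom_log, bch_zero_left, bch_zero_right]
    rfl)
  map₂_whisker_right := fun t X => MC.hom₂_ext (by
    simp only [MC.comp₂_log, MC.eqToHom_log, bch_zero_left, bch_zero_right]
    exact NegOne.val_injective (f.map_nilEval _ X.log (NegOne.val t.log))) }

end Hom
end DGLA

/-- A pseudofunctor is a biequivalence if it is essentially surjective on objects (up to
equivalence) and an equivalence on all categories of morphisms. -/
def IsBiequivalence {B : Type*} [Bicategory B] {C : Type*} [Bicategory C]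
    (F : Pseudofunctor B C) : Prop :=
  (∀ Y : C, ∃ X : B, Nonempty (Bicategory.Equivalence (F.obj X) Y)) ∧
    ∀ X X' : B, (F.mapFunctor X X').IsEquivalence

/-! ### Commutative differential graded algebras and tensor products -/

section Graded
variable {ι M N : Type*} [DecidableEq ι] [AddCommGroup M] [Module ℚ M] [AddCommMonoid N]
  [Module ℚ N] {A : ι → Submodule ℚ M}

/-- The linear map on a graded vector space that is given by `φ i` in degree `i`. -/
def grLift (hA : DirectSum.IsInternal A) (φ : ι → M →ₗ[ℚ] N) : M →ₗ[ℚ] N :=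
  DirectSum.toModule ℚ ι N (fun i => φ i ∘ₗ (A i).subtype) ∘ₗ
    (LinearEquiv.ofBijective (DirectSum.coeLinearMap A) hA).symm.toLinearMap

theorem grLift_of_mem (hA : DirectSum.IsInternal A) (φ : ι → M →ₗ[ℚ] N) {i : ι} {x : M}
    (hx : x ∈ A i) : grLift hA φ x = φ i x := by
  have h1 : (LinearEquiv.ofBijective (DirectSum.coeLinearMap A) hA).symm x =
      DirectSum.lof ℚ ι (fun i => A i) i ⟨x, hx⟩ := by
    rw [LinearEquiv.symm_apply_eq]
    exact (DirectSum.coeLinearMap_lof A i ⟨x, hx⟩).symm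
  rw [grLift, LinearMap.comp_apply, LinearEquiv.coe_coe, h1, DirectSum.toModule_lof]
  rfl

theorem isInternal_of_proj (hA : ⨆ i, A i = ⊤) (P : ι → M →ₗ[ℚ] M)
    (h1 : ∀ i, ∀ x ∈ A i, P i x = x) (h2 : ∀ i j, i ≠ j → ∀ x ∈ A i, P j x = 0) :
    DirectSum.IsInternal A := by
  rw [DirectSum.isInternal_submodule_iff_iSupIndep_and_iSup_eq_top]
  refine ⟨fun i => ?_, hA⟩
  rw [Submodule.disjoint_def]
  intro x hx hx'
  have hle : ⨆ j, ⨆ (_ : j ≠ i), A j ≤ LinearMap.ker (P i) :=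
    iSup₂_le fun j hj y hy => LinearMap.mem_ker.2 (h2 j i hj y hy)
  rw [← h1 i x hx]
  exact LinearMap.mem_ker.1 (hle hx')

theorem gr_induction (hA : DirectSum.IsInternal A) {p : M → Prop} (x : M)
    (mem : ∀ i, ∀ x ∈ A i, p x) (zero : p 0) (add : ∀ x y, p x → p y → p (x + y)) : p x := by
  have hx : x ∈ ⨆ i, A i := by rw [hA.submodule_iSup_eq_top]; exact Submodule.mem_top
  exact Submodule.iSup_induction _ (motive := p) hx mem zero add

theorem map₂_induction {M N P : Type*} [AddCommGroup M] [Module ℚ M] [AddCommGroup N] [Module ℚ N]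
    [AddCommGroup P] [Module ℚ P] {f : M →ₗ[ℚ] N →ₗ[ℚ] P} {p : Submodule ℚ M} {q : Submodule ℚ N}
    {C : P → Prop} {t : P} (ht : t ∈ Submodule.map₂ f p q)
    (apply : ∀ m ∈ p, ∀ n ∈ q, C (f m n)) (zero : C 0) (add : ∀ s t, C s → C t → C (s + t)) :
    C t := by
  refine Submodule.iSup_induction _ (motive := C) ht (fun m s hs => ?_) zero add
  obtain ⟨n, hn, rfl⟩ := hs
  exact apply m m.2 n hn

end Graded

theorem sign_congr {a b : ℤ} (hab : Even (a - b)) : (-1 : ℚ) ^ a = (-1 : ℚ) ^ b := by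
  rw [← sub_add_cancel a b, zpow_add₀ (by norm_num), hab.neg_one_zpow, one_mul]

/-- A (graded) commutative differential graded algebra over `ℚ` in non-negative degrees. -/
structure CDGA (Ω : Type v) [Ring Ω] [Algebra ℚ Ω] where
  /-- The homogeneous components. -/
  gr : ℕ → Submodule ℚ Ω
  internal : DirectSum.IsInternal gr
  one_mem : 1 ∈ gr 0
  mul_mem : ∀ {p q a b}, a ∈ gr p → b ∈ gr q → a * b ∈ gr (p + q)
  mul_comm : ∀ {p q a b}, a ∈ gr p → b ∈ gr q → a * b = (-1 : ℚ) ^ (p * q) • (b * a)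
  /-- The differential. -/
  d : Ω →ₗ[ℚ] Ω
  d_mem : ∀ {p a}, a ∈ gr p → d a ∈ gr (p + 1)
  d_d : ∀ a, d (d a) = 0
  leibniz : ∀ {p a}, a ∈ gr p → ∀ b, d (a * b) = d a * b + (-1 : ℚ) ^ p • (a * d b)

namespace CDGA
variable {Ω : Type v} [Ring Ω] [Algebra ℚ Ω] (a : CDGA Ω) {H : Type u} [AddCommGroup H]
  [Module ℚ H] (h : DGLA H)

theorem d_one : a.d 1 = 0 := by
  have := a.leibniz a.one_mem 1
  rw [mul_one, mul_one, pow_zero, one_smul, one_mul] at this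
  exact left_eq_add.1 this

/-- The map `ω ↦ (-1)^{q |ω|} ω`. -/
def sign (q : ℤ) : Ω →ₗ[ℚ] Ω :=
  grLift a.internal fun p => (-1 : ℚ) ^ (q * p) • LinearMap.id

variable {a} in
theorem sign_of_mem (q : ℤ) {p : ℕ} {ω : Ω} (hω : ω ∈ a.gr p) :
    a.sign q ω = (-1 : ℚ) ^ (q * p) • ω :=
  grLift_of_mem _ _ hω

variable {a} in
theorem sign_mem (q : ℤ) {p : ℕ} {ω : Ω} (hω : ω ∈ a.gr p) : a.sign q ω ∈ a.gr p := by
  rw [sign_of_mem q hω]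
  exact Submodule.smul_mem _ _ hω

theorem sign_one (q : ℤ) : a.sign q 1 = 1 := by
  rw [sign_of_mem q a.one_mem, Nat.cast_zero, mul_zero, zpow_zero, one_smul]

theorem sign_mul (q : ℤ) (ω η : Ω) : a.sign q (ω * η) = a.sign q ω * a.sign q η := by
  refine gr_induction a.internal (p := fun ω => a.sign q (ω * η) = a.sign q ω * a.sign q η) ω
    (fun i ω hω => ?_) (by simp) (fun x y hx hy => by simp only [add_mul, map_add, hx, hy])
  refine gr_induction a.internal (p := fun η => a.sign q (ω * η) = a.sign q ω * a.sign q η) η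
    (fun j η hη => ?_) (by simp) (fun x y hx hy => by simp only [mul_add, map_add, hx, hy])
  rw [sign_of_mem q hω, sign_of_mem q hη, sign_of_mem q (a.mul_mem hω hη), smul_mul_smul_comm,
    ← zpow_add₀ (by norm_num), Nat.cast_add, mul_add]

theorem sign_sign (q r : ℤ) (ω : Ω) : a.sign q (a.sign r ω) = a.sign (q + r) ω := by
  refine gr_induction a.internal (p := fun ω => a.sign q (a.sign r ω) = a.sign (q + r) ω) ω
    (fun i ω hω => ?_) (by simp) (fun x y hx hy => by simp only [map_add, hx, hy])
  rw [sign_of_mem _ hω, sign_of_mem _ hω, map_smul, sign_of_mem _ hω, smul_smul,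
    ← zpow_add₀ (by norm_num), ← add_mul, add_comm]

theorem sign_d (q : ℤ) (ω : Ω) : a.sign q (a.d ω) = (-1 : ℚ) ^ q • a.d (a.sign q ω) := by
  refine gr_induction a.internal
    (p := fun ω => a.sign q (a.d ω) = (-1 : ℚ) ^ q • a.d (a.sign q ω)) ω
    (fun i ω hω => ?_) (by simp) (fun x y hx hy => by simp only [map_add, hx, hy, smul_add])
  rw [sign_of_mem _ hω, sign_of_mem _ (a.d_mem hω), map_smul, smul_smul,
    ← zpow_add₀ (by norm_num), Nat.cast_add, mul_add, Nat.cast_one, mul_one, add_comm]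

/-- The homogeneous components `(Ω ⊗ 𝔥)ⁱ = ⨁ₚ Ωᵖ ⊗ 𝔥ⁱ⁻ᵖ`. -/
def tensorGr (i : ℤ) : Submodule ℚ (Ω ⊗[ℚ] H) :=
  ⨆ p : ℕ, Submodule.map₂ (TensorProduct.mk ℚ Ω H) (a.gr p) (h.gr (i - p))

variable {a h}

theorem tmul_mem {p : ℕ} {j i : ℤ} {ω : Ω} {x : H} (hω : ω ∈ a.gr p) (hx : x ∈ h.gr j)
    (hi : i = p + j) : ω ⊗ₜ[ℚ] x ∈ a.tensorGr h i := by
  subst hi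
  refine Submodule.mem_iSup_of_mem p ?_
  refine Submodule.apply_mem_map₂ (TensorProduct.mk ℚ Ω H) hω ?_
  rwa [add_sub_cancel_left]

theorem tensorGr_induction {i : ℤ} {P : Ω ⊗[ℚ] H → Prop} {t : Ω ⊗[ℚ] H}
    (ht : t ∈ a.tensorGr h i)
    (tmul : ∀ (p : ℕ) (j : ℤ) (ω : Ω) (x : H), i = p + j → ω ∈ a.gr p → x ∈ h.gr j →
      P (ω ⊗ₜ x)) (zero : P 0) (add : ∀ s t, P s → P t → P (s + t)) : P t := by
  refine Submodule.iSup_induction _ (motive := P) ht (fun p s hs => ?_) zero add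
  exact map₂_induction (C := P) hs
    (fun ω hω x hx => tmul p (i - p) ω x (by omega) hω hx) zero add

theorem tensor_induction {P : Ω ⊗[ℚ] H → Prop} (t : Ω ⊗[ℚ] H)
    (tmul : ∀ (p : ℕ) (j : ℤ) (ω : Ω) (x : H), ω ∈ a.gr p → x ∈ h.gr j → P (ω ⊗ₜ x))
    (zero : P 0) (add : ∀ s t, P s → P t → P (s + t)) : P t := by
  induction t using TensorProduct.induction_on with
  | zero => exact zero
  | add s t hs ht => exact add s t hs ht
  | tmul ω x =>
    refine gr_induction a.internal (p := fun ω => P (ω ⊗ₜ x)) ω (fun p ω hω => ?_)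
      (by rwa [TensorProduct.zero_tmul])
      (fun s t hs ht => by rw [TensorProduct.add_tmul]; exact add _ _ hs ht)
    refine gr_induction h.internal (p := fun x => P (ω ⊗ₜ x)) x (fun j x hx => ?_)
      (by rwa [TensorProduct.tmul_zero])
      (fun s t hs ht => by rw [TensorProduct.tmul_add]; exact add _ _ hs ht)
    exact tmul p j ω x hω hx

variable (a h)

theorem tensorGr_internal : DirectSum.IsInternal (a.tensorGr h) := by
  let π : ℤ → H →ₗ[ℚ] H := fun j => grLift h.internal fun i => if i = j then LinearMap.id else 0
  let P : ℤ → Ω ⊗[ℚ] H →ₗ[ℚ] Ω ⊗[ℚ] H := fun i => TensorProduct.lift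
    (grLift a.internal fun p => (TensorProduct.mk ℚ Ω H).compl₂ (π (i - p)))
  have hP : ∀ (i : ℤ) (p : ℕ) (j : ℤ) (ω : Ω) (x : H), ω ∈ a.gr p → x ∈ h.gr j →
      P i (ω ⊗ₜ x) = if i = p + j then ω ⊗ₜ x else 0 := by
    intro i p j ω x hω hx
    change grLift a.internal (fun p : ℕ => (TensorProduct.mk ℚ Ω H).compl₂ (π (i - p))) ω x = _
    rw [grLift_of_mem _ _ hω, LinearMap.compl₂_apply, grLift_of_mem _ _ hx]
    by_cases hi : i = p + j
    · rw [if_pos hi, if_pos (by omega)]; rfl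
    · rw [if_neg hi, if_neg (by omega), LinearMap.zero_apply, map_zero]
  refine isInternal_of_proj ?_ P (fun i t ht => ?_) (fun i k hik t ht => ?_)
  · rw [eq_top_iff]
    intro t _
    refine tensor_induction (a := a) (h := h) (P := fun t => t ∈ ⨆ i, a.tensorGr h i) t
      (fun p j ω x hω hx => Submodule.mem_iSup_of_mem (p + j) (tmul_mem hω hx rfl))
      (zero_mem _) (fun _ _ => add_mem)
  · refine tensorGr_induction (P := fun t => P i t = t) ht (fun p j ω x hi hω hx => ?_)
      (map_zero _) (fun s t hs ht => by rw [map_add, hs, ht])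
    rw [hP _ _ _ _ _ hω hx, if_pos hi]
  · refine tensorGr_induction (P := fun t => P k t = 0) ht (fun p j ω x hi hω hx => ?_)
      (map_zero _) (fun s t hs ht => by rw [map_add, hs, ht, add_zero])
    rw [hP _ _ _ _ _ hω hx, if_neg (by omega)]

/-- The bracket `[ω ⊗ x, η ⊗ y] = (-1)^{|x| |η|} ω η ⊗ [x, y]`. -/
def tensorBracket : Ω ⊗[ℚ] H →ₗ[ℚ] Ω ⊗[ℚ] H →ₗ[ℚ] Ω ⊗[ℚ] H :=
  TensorProduct.lift (grLift h.internal fun q =>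
    ((TensorProduct.mapBilinear (RingHom.id ℚ) Ω H Ω H).compl₁₂
      (LinearMap.lcomp ℚ Ω (a.sign q) ∘ₗ LinearMap.mul ℚ Ω) h.bracket).flip).flip

/-- The differential `ω ⊗ x ↦ d ω ⊗ x + (-1)^{|ω|} ω ⊗ δ x`. -/
def tensorD : Ω ⊗[ℚ] H →ₗ[ℚ] Ω ⊗[ℚ] H :=
  TensorProduct.map a.d LinearMap.id + TensorProduct.map (a.sign 1) h.d

variable {a h}

theorem tensorBracket_tmul {q : ℤ} {x : H} (hx : x ∈ h.gr q) (ω η : Ω) (y : H) :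
    a.tensorBracket h (ω ⊗ₜ x) (η ⊗ₜ y) = (ω * a.sign q η) ⊗ₜ h.bracket x y := by
  rw [tensorBracket, TensorProduct.lift.tmul, LinearMap.flip_apply, grLift_of_mem _ _ hx]
  rfl

theorem tensorD_tmul (ω : Ω) (x : H) :
    a.tensorD h (ω ⊗ₜ x) = a.d ω ⊗ₜ x + a.sign 1 ω ⊗ₜ h.d x := rfl

variable (a h)

/-- The tensor product `Ω ⊗ 𝔥` of a CDGA and a DGLA. -/
def tensor : DGLA (Ω ⊗[ℚ] H) where
  gr := a.tensorGr h
  internal := a.tensorGr_internal h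
  bracket := a.tensorBracket h
  d := a.tensorD h
  bracket_mem {i j s t} hs ht := by
    refine tensorGr_induction (P := fun s => a.tensorBracket h s t ∈ a.tensorGr h (i + j)) hs
      (fun p q ω x hi hω hx => ?_) (by simp)
      (fun s s' h h' => by rw [map_add, LinearMap.add_apply]; exact add_mem h h')
    refine tensorGr_induction
      (P := fun t => a.tensorBracket h (ω ⊗ₜ x) t ∈ a.tensorGr h (i + j)) ht
      (fun p' q' η y hj hη hy => ?_) (by simp)
      (fun s s' h h' => by rw [map_add]; exact add_mem h h')
    rw [tensorBracket_tmul hx]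
    exact tmul_mem (a.mul_mem hω (sign_mem q hη)) (h.bracket_mem hx hy) (by push_cast; omega)
  d_mem {i s} hs := by
    refine tensorGr_induction (P := fun s => a.tensorD h s ∈ a.tensorGr h (i + 1)) hs
      (fun p q ω x hi hω hx => ?_) (by simp)
      (fun s s' h h' => by rw [map_add]; exact add_mem h h')
    rw [tensorD_tmul]
    exact add_mem (tmul_mem (a.d_mem hω) hx (by push_cast; omega))
      (tmul_mem (sign_mem 1 hω) (h.d_mem hx) (by omega))
  d_d s := by
    induction s using TensorProduct.induction_on with
    | zero => simp
    | add s t hs ht => rw [map_add, map_add, hs, ht, add_zero]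
    | tmul ω x =>
      rw [tensorD_tmul, map_add, tensorD_tmul, tensorD_tmul, a.d_d, h.d_d, sign_d, zpow_one,
        neg_smul, one_smul, TensorProduct.zero_tmul, TensorProduct.tmul_zero, zero_add, add_zero,
        TensorProduct.neg_tmul, neg_add_cancel]
  bracket_comm {i j s t} hs ht := by
    refine tensorGr_induction (P := fun s => a.tensorBracket h s t =
        -((-1 : ℚ) ^ (i * j) • a.tensorBracket h t s)) hs
      (fun p q ω x hi hω hx => ?_) (by simp)
      (fun s s' h h' => by
        rw [map_add, map_add, LinearMap.add_apply, h, h', smul_add, neg_add])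
    refine tensorGr_induction (P := fun t => a.tensorBracket h (ω ⊗ₜ x) t =
        -((-1 : ℚ) ^ (i * j) • a.tensorBracket h t (ω ⊗ₜ x))) ht
      (fun p' q' η y hj hη hy => ?_) (by simp)
      (fun s s' h h' => by
        rw [map_add, map_add, LinearMap.add_apply, h, h', smul_add, neg_add])
    rw [tensorBracket_tmul hx, tensorBracket_tmul hy, sign_of_mem _ hω, sign_of_mem _ hη,
      mul_smul_comm, mul_smul_comm, a.mul_comm hω hη, h.bracket_comm hx hy]
    simp only [TensorProduct.tmul_neg, TensorProduct.tmul_smul, ← TensorProduct.smul_tmul',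
      smul_smul, ← zpow_natCast]
    rw [← zpow_add₀ (by norm_num), ← zpow_add₀ (by norm_num), ← zpow_add₀ (by norm_num)]
    congr 2
    apply sign_congr
    subst hi hj
    refine ⟨-(q' * p), ?_⟩
    push_cast
    ring
  leibniz {i s} hs t := by
    refine tensorGr_induction (P := fun s => a.tensorD h (a.tensorBracket h s t) =
        a.tensorBracket h (a.tensorD h s) t +
          (-1 : ℚ) ^ i • a.tensorBracket h s (a.tensorD h t)) hs
      (fun p q ω x hi hω hx => ?_) (by simp)
      (fun s s' h h' => by
        simp only [map_add, LinearMap.add_apply, h, h', smul_add]; abel)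
    induction t using TensorProduct.induction_on with
    | zero => simp
    | add s t hs ht => simp only [map_add, hs, ht, smul_add]; abel
    | tmul η y =>
      rw [tensorBracket_tmul hx, tensorD_tmul, tensorD_tmul, tensorD_tmul, map_add, map_add,
        LinearMap.add_apply, tensorBracket_tmul hx, tensorBracket_tmul hx, tensorBracket_tmul hx,
        tensorBracket_tmul (h.d_mem hx), h.leibniz hx, a.leibniz hω, sign_mul, sign_d, sign_sign,
        sign_sign, add_comm 1 q, sign_of_mem 1 hω]
      simp only [TensorProduct.tmul_add, TensorProduct.add_tmul, TensorProduct.tmul_smul,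
        ← TensorProduct.smul_tmul', smul_smul, smul_add, smul_mul_assoc, mul_smul_comm]
      have e1 : (-1 : ℚ) ^ i * (-1) ^ q = (-1) ^ p := by
        rw [← zpow_add₀ (by norm_num), ← zpow_natCast]
        apply sign_congr
        exact ⟨q, by omega⟩
      have e2 : (-1 : ℚ) ^ i = (-1) ^ q * (-1) ^ (1 * (p : ℤ)) := by
        rw [← zpow_add₀ (by norm_num)]
        congr 1
        omega
      rw [e1, ← e2]
      abel
  jacobi {i j s t} hs ht u := by
    refine tensorGr_induction (P := fun s => a.tensorBracket h s (a.tensorBracket h t u) =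
        a.tensorBracket h (a.tensorBracket h s t) u +
          (-1 : ℚ) ^ (i * j) • a.tensorBracket h t (a.tensorBracket h s u)) hs
      (fun p q ω x hi hω hx => ?_) (by simp)
      (fun s s' h h' => by
        simp only [map_add, LinearMap.add_apply, h, h', smul_add]; abel)
    refine tensorGr_induction (P := fun t =>
        a.tensorBracket h (ω ⊗ₜ x) (a.tensorBracket h t u) =
        a.tensorBracket h (a.tensorBracket h (ω ⊗ₜ x) t) u +
          (-1 : ℚ) ^ (i * j) • a.tensorBracket h t (a.tensorBracket h (ω ⊗ₜ x) u)) ht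
      (fun p' q' η y hj hη hy => ?_) (by simp)
      (fun s s' h h' => by
        simp only [map_add, LinearMap.add_apply, h, h', smul_add]; abel)
    induction u using TensorProduct.induction_on with
    | zero => simp
    | add s t hs ht => simp only [map_add, hs, ht, smul_add]; abel
    | tmul ζ z =>
      rw [tensorBracket_tmul hy, tensorBracket_tmul hx, tensorBracket_tmul hx,
        tensorBracket_tmul hx, tensorBracket_tmul hy, tensorBracket_tmul (h.bracket_mem hx hy),
        h.jacobi hx hy, sign_mul, sign_mul, sign_sign, sign_sign, add_comm q' q,
        TensorProduct.tmul_add, ← mul_assoc, ← mul_assoc]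
      congr 1
      rw [sign_of_mem _ hω, sign_of_mem _ hη, mul_smul_comm, mul_smul_comm, a.mul_comm hω hη]
      simp only [TensorProduct.tmul_smul, ← TensorProduct.smul_tmul', smul_mul_assoc, smul_smul,
        ← zpow_natCast]
      rw [← zpow_add₀ (by norm_num), ← zpow_add₀ (by norm_num), ← zpow_add₀ (by norm_num)]
      congr 1
      apply sign_congr
      subst hi hj
      refine ⟨-(q' * p), ?_⟩
      push_cast
      ring

/-- The inclusion of constants `x ↦ 1 ⊗ x`. -/
def const : DGLA.Hom h (a.tensor h) where
  toLin := TensorProduct.mk ℚ Ω H 1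
  map_mem hx := tmul_mem a.one_mem hx (by simp)
  map_bracket x y := by
    refine gr_induction h.internal (p := fun x => (1 : Ω) ⊗ₜ[ℚ] h.bracket x y =
      a.tensorBracket h ((1 : Ω) ⊗ₜ x) ((1 : Ω) ⊗ₜ y)) x (fun q x hx => ?_) (by simp)
      (fun x x' h h' => by
        simp only [map_add, LinearMap.add_apply, TensorProduct.tmul_add, h, h'])
    rw [tensorBracket_tmul hx, sign_one, one_mul]
  map_d x := by
    change (1 : Ω) ⊗ₜ[ℚ] h.d x = a.tensorD h ((1 : Ω) ⊗ₜ x)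
    rw [tensorD_tmul, a.d_one, sign_one, TensorProduct.zero_tmul, zero_add]

theorem tensor_lcs_le (k : ℕ) :
    (a.tensor h).lcs k ≤ Submodule.map₂ (TensorProduct.mk ℚ Ω H) ⊤ (h.lcs k) := by
  induction k with
  | zero =>
    intro t _
    induction t using TensorProduct.induction_on with
    | zero => exact zero_mem _
    | tmul ω x =>
      exact Submodule.apply_mem_map₂ (TensorProduct.mk ℚ Ω H) Submodule.mem_top Submodule.mem_top
    | add s t hs ht => exact add_mem (hs trivial) (ht trivial)
  | succ k ih =>
    refine Submodule.map₂_le.2 fun s _ t ht => ?_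
    replace ht := ih ht
    refine tensor_induction (a := a) (h := h) (P := fun s => a.tensorBracket h s t ∈ _) s
      (fun p j ω x hω hx => ?_) (by simp)
      (fun s s' h h' => by rw [map_add, LinearMap.add_apply]; exact add_mem h h')
    refine map₂_induction (C := fun t => a.tensorBracket h (ω ⊗ₜ x) t ∈ _) ht
      (fun η _ y hy => ?_) (by simp)
      (fun s s' h h' => by rw [map_add]; exact add_mem h h')
    rw [TensorProduct.mk_apply, tensorBracket_tmul hx]
    exact Submodule.apply_mem_map₂ (TensorProduct.mk ℚ Ω H) Submodule.mem_top
      (h.bracket_mem_lcs x hy)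

instance [h.IsNilpotent] : (a.tensor h).IsNilpotent where
  exists_lcs_eq_bot := by
    obtain ⟨k, hk⟩ := DGLA.IsNilpotent.exists_lcs_eq_bot (h := h)
    refine ⟨k, ?_⟩
    rw [eq_bot_iff]
    refine (a.tensor_lcs_le h k).trans ?_
    rw [hk, Submodule.map₂_bot_right]

instance [h.IsGENegOne] : (a.tensor h).IsGENegOne where
  gr_eq_bot i hi := by
    refine iSup_eq_bot.2 fun p => ?_
    rw [DGLA.IsGENegOne.gr_eq_bot (i - p) (by omega), Submodule.map₂_bot_right]

end CDGA

/-! ### Polynomial differential forms on the simplex -/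

section Forms
variable (n : ℕ)

/-- The exterior algebra on generators `dt₁, …, dtₙ`. -/
abbrev Ext : Type := ExteriorAlgebra ℚ (Fin n → ℚ)

/-- The algebra `ℚ[t₁, …, tₙ] ⊗ Λ(dt₁, …, dtₙ)` of polynomial differential forms on the simplex
`Δⁿ`, in terms of the coordinates `t₁, …, tₙ` (and `t₀ = 1 - t₁ - … - tₙ`). -/
abbrev Forms : Type := MvPolynomial (Fin n) ℚ ⊗[ℚ] Ext n

variable {n}

/-- The generator `dtᵢ`. -/
def dt (i : Fin n) : Ext n := ExteriorAlgebra.ι ℚ (Pi.single i 1)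

theorem ι_mul_comm (v : Fin n → ℚ) {q : ℕ} {b : Ext n} (hb : b ∈ ⋀[ℚ]^q (Fin n → ℚ)) :
    ExteriorAlgebra.ι ℚ v * b = (-1 : ℚ) ^ q • (b * ExteriorAlgebra.ι ℚ v) := by
  induction q generalizing b with
  | zero =>
    rw [ExteriorAlgebra.exteriorPower, pow_zero, Submodule.mem_one] at hb
    obtain ⟨c, rfl⟩ := hb
    rw [pow_zero, one_smul, Algebra.commutes]
  | succ q ih =>
    rw [ExteriorAlgebra.exteriorPower, pow_succ] at hb
    refine Submodule.mul_induction_on hb ?_ ?_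
    · rintro c hc _ ⟨w, rfl⟩
      have h1 : ExteriorAlgebra.ι ℚ v * ExteriorAlgebra.ι ℚ w =
          -(ExteriorAlgebra.ι ℚ w * ExteriorAlgebra.ι ℚ v) :=
        eq_neg_of_add_eq_zero_left (ExteriorAlgebra.ι_add_mul_swap v w)
      rw [← mul_assoc, ih hc, smul_mul_assoc, mul_assoc, h1, pow_succ, mul_neg, mul_neg_one,
        neg_smul, smul_neg, mul_assoc]
    · intro x y hx hy
      rw [mul_add, add_mul, hx, hy, smul_add]

theorem ext_mul_comm {p q : ℕ} {a b : Ext n} (ha : a ∈ ⋀[ℚ]^p (Fin n → ℚ))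
    (hb : b ∈ ⋀[ℚ]^q (Fin n → ℚ)) : a * b = (-1 : ℚ) ^ (p * q) • (b * a) := by
  induction p generalizing a with
  | zero =>
    rw [ExteriorAlgebra.exteriorPower, pow_zero, Submodule.mem_one] at ha
    obtain ⟨c, rfl⟩ := ha
    rw [zero_mul, pow_zero, one_smul, Algebra.commutes]
  | succ p ih =>
    rw [ExteriorAlgebra.exteriorPower, pow_succ] at ha
    refine Submodule.mul_induction_on ha ?_ ?_
    · rintro c hc _ ⟨w, rfl⟩
      rw [mul_assoc, ι_mul_comm w hb, mul_smul_comm, ← mul_assoc, ih hc, smul_mul_assoc, smul_smul,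
        mul_assoc, ← pow_add]
      congr 2
      ring
    · intro x y hx hy
      rw [mul_add, add_mul, hx, hy, smul_add]

theorem dt_mem (i : Fin n) : dt i ∈ ⋀[ℚ]^1 (Fin n → ℚ) := by
  rw [ExteriorAlgebra.exteriorPower, pow_one]
  exact ⟨_, rfl⟩

variable (n)

/-- Forms of degree `p`. -/
def formsGr (p : ℕ) : Submodule ℚ (Forms n) :=
  Submodule.map₂ (TensorProduct.mk ℚ (MvPolynomial (Fin n) ℚ) (Ext n)) ⊤ (⋀[ℚ]^p (Fin n → ℚ))

theorem formsGr_internal : DirectSum.IsInternal (formsGr n) := by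
  have hE : DirectSum.IsInternal fun p : ℕ => (⋀[ℚ]^p (Fin n → ℚ)) :=
    DirectSum.Decomposition.isInternal _
  refine isInternal_of_proj ?_ (fun j => TensorProduct.map LinearMap.id
    (grLift hE fun i => if i = j then LinearMap.id else 0)) (fun i t ht => ?_)
    (fun i k hik t ht => ?_)
  · rw [eq_top_iff]
    intro t _
    induction t using TensorProduct.induction_on with
    | zero => exact zero_mem _
    | add s t hs ht => exact add_mem (hs trivial) (ht trivial)
    | tmul f α =>
      refine gr_induction hE (p := fun α => f ⊗ₜ[ℚ] α ∈ ⨆ i, formsGr n i) α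
        (fun i α hα => ?_) (by simp)
        (fun s t hs ht => by rw [TensorProduct.tmul_add]; exact add_mem hs ht)
      exact Submodule.mem_iSup_of_mem i (Submodule.apply_mem_map₂
        (TensorProduct.mk ℚ (MvPolynomial (Fin n) ℚ) (Ext n)) Submodule.mem_top hα)
  · refine map₂_induction (C := fun t => TensorProduct.map LinearMap.id _ t = t) ht
      (fun f _ α hα => ?_) (map_zero _) (fun s t hs ht => by rw [map_add, hs, ht])
    rw [TensorProduct.mk_apply, TensorProduct.map_tmul, grLift_of_mem _ _ hα, if_pos rfl]
    rfl
  · refine map₂_induction (C := fun t => TensorProduct.map LinearMap.id _ t = 0) ht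
      (fun f _ α hα => ?_) (map_zero _) (fun s t hs ht => by rw [map_add, hs, ht, add_zero])
    rw [TensorProduct.mk_apply, TensorProduct.map_tmul, grLift_of_mem _ _ hα, if_neg hik,
      LinearMap.zero_apply, TensorProduct.tmul_zero]

/-- The de Rham differential `f α ↦ ∑ᵢ (∂f / ∂tᵢ) dtᵢ α`. -/
def formsD : Forms n →ₗ[ℚ] Forms n :=
  ∑ i, TensorProduct.map (MvPolynomial.pderiv i).toLinearMap (LinearMap.mulLeft ℚ (dt i))

variable {n}

theorem formsD_tmul (f : MvPolynomial (Fin n) ℚ) (α : Ext n) :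
    formsD n (f ⊗ₜ α) = ∑ i, MvPolynomial.pderiv i f ⊗ₜ[ℚ] (dt i * α) := by
  rw [formsD, LinearMap.sum_apply]
  rfl

theorem tmul_mem_formsGr {p : ℕ} (f : MvPolynomial (Fin n) ℚ) {α : Ext n}
    (hα : α ∈ ⋀[ℚ]^p (Fin n → ℚ)) : f ⊗ₜ[ℚ] α ∈ formsGr n p :=
  Submodule.apply_mem_map₂ (TensorProduct.mk ℚ (MvPolynomial (Fin n) ℚ) (Ext n))
    Submodule.mem_top hα

theorem pderiv_comm (i j : Fin n) (f : MvPolynomial (Fin n) ℚ) :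
    MvPolynomial.pderiv i (MvPolynomial.pderiv j f) =
      MvPolynomial.pderiv j (MvPolynomial.pderiv i f) := by
  have : ⁅MvPolynomial.pderiv (R := ℚ) i, MvPolynomial.pderiv (R := ℚ) j⁆ = 0 := by
    refine MvPolynomial.derivation_ext fun k => ?_
    rw [Derivation.commutator_apply, MvPolynomial.pderiv_X, MvPolynomial.pderiv_X]
    simp [Pi.single_apply, apply_ite]
  have h := DFunLike.congr_fun this f
  rw [Derivation.commutator_apply] at h
  exact sub_eq_zero.1 h

variable (n)

/-- The CDGA `Ωₙ` of polynomial differential forms on the simplex `Δⁿ`. -/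
def Omega : CDGA (Forms n) where
  gr := formsGr n
  internal := formsGr_internal n
  one_mem := tmul_mem_formsGr 1 (by rw [ExteriorAlgebra.exteriorPower, pow_zero]; exact Submodule.one_le.1 le_rfl)
  mul_mem {p q a b} ha hb := by
    refine map₂_induction (C := fun a => a * b ∈ formsGr n (p + q)) ha (fun f _ α hα => ?_)
      (by simp) (fun s t hs ht => by rw [add_mul]; exact add_mem hs ht)
    refine map₂_induction (C := fun b => _ * b ∈ formsGr n (p + q)) hb (fun g _ β hβ => ?_)
      (by simp) (fun s t hs ht => by rw [mul_add]; exact add_mem hs ht)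
    rw [TensorProduct.mk_apply, TensorProduct.mk_apply, Algebra.TensorProduct.tmul_mul_tmul]
    exact tmul_mem_formsGr _ (by rw [ExteriorAlgebra.exteriorPower, pow_add]; exact Submodule.mul_mem_mul hα hβ)
  mul_comm {p q a b} ha hb := by
    refine map₂_induction (C := fun a => a * b = (-1 : ℚ) ^ (p * q) • (b * a)) ha
      (fun f _ α hα => ?_)
      (by simp) (fun s t hs ht => by rw [add_mul, mul_add, hs, ht, smul_add])
    refine map₂_induction (C := fun b => _ * b = (-1 : ℚ) ^ (p * q) • (b * _)) hb
      (fun g _ β hβ => ?_)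
      (by simp) (fun s t hs ht => by rw [add_mul, mul_add, hs, ht, smul_add])
    rw [TensorProduct.mk_apply, TensorProduct.mk_apply, Algebra.TensorProduct.tmul_mul_tmul,
      Algebra.TensorProduct.tmul_mul_tmul, ext_mul_comm hα hβ, TensorProduct.tmul_smul,
      _root_.mul_comm f g]
  d := formsD n
  d_mem {p a} ha := by
    refine map₂_induction (C := fun a => formsD n a ∈ formsGr n (p + 1)) ha (fun f _ α hα => ?_)
      (by simp) (fun s t hs ht => by rw [map_add]; exact add_mem hs ht)
    rw [TensorProduct.mk_apply, formsD_tmul]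
    refine Submodule.sum_mem _ fun i _ => tmul_mem_formsGr _ ?_
    rw [add_comm, ExteriorAlgebra.exteriorPower, pow_add]
    exact Submodule.mul_mem_mul (dt_mem i) hα
  d_d a := by
    induction a using TensorProduct.induction_on with
    | zero => simp
    | add s t hs ht => rw [map_add, map_add, hs, ht, add_zero]
    | tmul f α =>
      have e : formsD n (formsD n (f ⊗ₜ α)) = -formsD n (formsD n (f ⊗ₜ α)) := by
        rw [formsD_tmul, map_sum]
        simp only [formsD_tmul]
        nth_rewrite 1 [Finset.sum_comm]
        rw [← Finset.sum_neg_distrib]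
        refine Finset.sum_congr rfl fun i _ => ?_
        rw [← Finset.sum_neg_distrib]
        refine Finset.sum_congr rfl fun j _ => ?_
        have h1 : dt i * dt j = -(dt j * dt i) :=
          eq_neg_of_add_eq_zero_left (ExteriorAlgebra.ι_add_mul_swap _ _)
        rw [← mul_assoc, ← mul_assoc, h1, neg_mul, TensorProduct.tmul_neg, pderiv_comm]
      have h2 : (2 : ℚ) • formsD n (formsD n (f ⊗ₜ α)) = 0 := by
        rw [two_smul]; nth_rewrite 1 [e]; exact neg_add_cancel _
      exact (smul_eq_zero.1 h2).resolve_left two_ne_zero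
  leibniz {p a} ha b := by
    refine map₂_induction (C := fun a => formsD n (a * b) =
      formsD n a * b + (-1 : ℚ) ^ p • (a * formsD n b)) ha (fun f _ α hα => ?_)
      (by simp) (fun s t hs ht => by simp only [map_add, add_mul, hs, ht, smul_add]; abel)
    induction b using TensorProduct.induction_on with
    | zero => simp
    | add s t hs ht => simp only [map_add, mul_add, hs, ht, smul_add]; abel
    | tmul g β =>
      rw [TensorProduct.mk_apply, Algebra.TensorProduct.tmul_mul_tmul, formsD_tmul, formsD_tmul,
        formsD_tmul, Finset.sum_mul, Finset.mul_sum, Finset.smul_sum, ← Finset.sum_add_distrib]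
      refine Finset.sum_congr rfl fun i _ => ?_
      rw [Algebra.TensorProduct.tmul_mul_tmul, Algebra.TensorProduct.tmul_mul_tmul,
        Derivation.leibniz, TensorProduct.add_tmul, smul_eq_mul, smul_eq_mul, add_comm,
        _root_.mul_comm g, mul_assoc]
      congr 1
      rw [← mul_assoc (dt i), dt, ι_mul_comm _ hα, smul_mul_assoc, TensorProduct.tmul_smul,
        mul_assoc]

end Forms

end Deligne
end

/-!
The Deligne-Getzler 2-groupoid is invariant under filtered contractions, and `Ωₙ ⊗ 𝔥` contracts
onto `𝔥` by the Poincaré lemma.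

Let `f : 𝔥 → 𝔨` be a homomorphism of DGLAs with a retraction `p`, again a homomorphism of DGLAs, and
a chain homotopy `S` of degree `-1` with `d S + S d = 1 - f p` and `p S = 0`. Suppose that `S`
preserves a finite filtration of `𝔨` that the adjoint action of any element raises by one step
(`DGLA.Hom.Contraction`). Then `f` induces an equivalence of 2-groupoids, for the following reasons.

* For a Maurer-Cartan element `γ` of `𝔨`, the kernel of `p` is acyclic for the twisted differential
  `δ_γ`, because `δ_γ S + S δ_γ` is the identity on it up to an operator that raises the filtration
  (`exists_twist_eq`).
* If `t ∈ 𝔨⁻¹` and `δ_γ t` lies in the image of `𝔥`, where `γ` does as well, then `t - f p t` is a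
  closed, hence exact, element of the kernel of `p` of lowest degree, so it vanishes
  (`map_retr_of_twist_eq`).
  This gives fullness on 2-morphisms; faithfulness is the injectivity of `f`.
* A 1-morphism `exp X` between elements in the image of `𝔥` differs from `exp (f p X)` by an element
  `exp V` of the stabilizer of the target `γ`, with `p V = 0`. That `exp V` stabilizes `γ` is the
  linear condition `δ_γ V = 0` (`twist_eq_zero_of_gauge_eq`), so `V = δ_γ t`, and `t` gives a
  2-isomorphism (`nonempty_hom_retrHom`).
* A Maurer-Cartan element `γ` is moved by the gauge transformation `exp (S (γ - f p γ))` one step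
  closer to `f p γ`, and finitely many steps connect the two (`nonempty_hom_retr`). This uses that
  gauge transformations preserve the Maurer-Cartan equation (`curvature_gauge`).

A contraction of a CDGA `Ω` onto `ℚ` gives one of `Ω ⊗ 𝔥` onto `𝔥`, filtered by `Ω ⊗ Fⁱ𝔥`
(`CDGA.Contraction.tensor`). For polynomial forms, the homotopy is the interior product with the
Euler vector field divided by the weight of a form, and the homotopy identity is Cartan's formula
(`formsD_eulerContract`, `omegaContraction`).
-/

noncomputable section
namespace Deligne
open CategoryTheory
universe u v

/-! ### Exponentials of derivations of bilinear maps -/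

section Bilinear
variable {M N P : Type*} [AddCommGroup M] [Module ℚ M] [AddCommGroup N] [Module ℚ N]
  [AddCommGroup P] [Module ℚ P]

/-- If `(a, b, c)` satisfies the Leibniz rule with respect to a bilinear map, then the
exponentials `(eᵃ, eᵇ, eᶜ)` preserve it. This is `e^{a ⊗ 1 + 1 ⊗ b} = eᵃ ⊗ eᵇ`. -/
theorem nexp_bilinear (B : M →ₗ[ℚ] N →ₗ[ℚ] P) {a : Module.End ℚ M} {b : Module.End ℚ N}
    {c : Module.End ℚ P} (ha : IsNilpotent a) (hb : IsNilpotent b) (hc : IsNilpotent c)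
    (h : ∀ m n, B (a m) n + B m (b n) = c (B m n)) (m : M) (n : N) :
    B (nexp a m) (nexp b n) = nexp c (B m n) := by
  let a' : Module.End ℚ (M ⊗[ℚ] N) := a.rTensor N
  let b' : Module.End ℚ (M ⊗[ℚ] N) := b.lTensor M
  have ha' : IsNilpotent a' := by
    obtain ⟨k, hk⟩ := ha
    exact ⟨k, by rw [LinearMap.rTensor_pow, hk, LinearMap.rTensor_zero]⟩
  have hb' : IsNilpotent b' := by
    obtain ⟨k, hk⟩ := hb
    exact ⟨k, by rw [LinearMap.lTensor_pow, hk, LinearMap.lTensor_zero]⟩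
  have hab : Commute a' b' :=
    (LinearMap.rTensor_comp_lTensor _ a b).trans (LinearMap.lTensor_comp_rTensor _ a b).symm
  have h1 : ∀ n, nexp a m ⊗ₜ[ℚ] n = nexp a' (m ⊗ₜ[ℚ] n) := fun n =>
    nilEval_intertwine ((TensorProduct.mk ℚ M N).flip n) _ ha ha' (fun _ => rfl) m
  have h2 : m ⊗ₜ[ℚ] nexp b n = nexp b' (m ⊗ₜ[ℚ] n) :=
    nilEval_intertwine (TensorProduct.mk ℚ M N m) _ hb hb' (fun _ => rfl) n
  have h3 : nexp a m ⊗ₜ[ℚ] nexp b n = nexp (a' + b') (m ⊗ₜ[ℚ] n) := by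
    rw [h1, h2, nexp_eq (a' + b'), IsNilpotent.exp_add_of_commute hab ha' hb', ← nexp_eq,
      ← nexp_eq, Module.End.mul_apply]
  change TensorProduct.lift B (nexp a m ⊗ₜ nexp b n) = nexp c (TensorProduct.lift B (m ⊗ₜ n))
  rw [h3]
  refine nilEval_intertwine (TensorProduct.lift B) _ (hab.isNilpotent_add ha' hb') hc
    (fun t => ?_) _
  induction t using TensorProduct.induction_on with
  | zero => simp
  | tmul m n => exact h m n
  | add s t hs ht => simp only [map_add, hs, ht]

/-- The version of `nexp_bilinear` in which the Leibniz rule holds on an invariant subspace. -/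
theorem nexp_bilinear_of_mem (B : M →ₗ[ℚ] M →ₗ[ℚ] P) {a : Module.End ℚ M} {c : Module.End ℚ P}
    (ha : IsNilpotent a) (hc : IsNilpotent c) (S : Submodule ℚ M) (hS : ∀ m ∈ S, a m ∈ S)
    (h : ∀ m ∈ S, ∀ n ∈ S, B (a m) n + B m (a n) = c (B m n)) {m n : M} (hm : m ∈ S)
    (hn : n ∈ S) : B (nexp a m) (nexp a n) = nexp c (B m n) := by
  have ha' : IsNilpotent (a.restrict hS) := Module.End.isNilpotent.restrict hS ha
  have hres : ∀ x : S, (nexp (a.restrict hS) x : M) = nexp a x := fun x =>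
    nilEval_intertwine S.subtype _ ha' ha (fun _ => rfl) x
  have := nexp_bilinear (B.domRestrict₁₂ S S) ha' ha' hc (fun x y => h x x.2 y y.2) ⟨m, hm⟩ ⟨n, hn⟩
  simpa only [LinearMap.domRestrict₁₂_apply, hres] using this

end Bilinear

namespace DGLA

/-! ### Gauge invariance of the Maurer-Cartan equation -/

section Curvature
variable {H : Type u} [AddCommGroup H] [Module ℚ H] {h : DGLA H}

theorem bracket_comm_of_mem_one {x y : H} (hx : x ∈ h.gr 1) (hy : y ∈ h.gr 1) :
    h.bracket x y = h.bracket y x := by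
  rw [h.bracket_comm hx hy, mul_one, zpow_one, neg_smul, one_smul, neg_neg]

variable (h) in
/-- The polarization `½ (c d m' + c' d m + [m, m'])` of the curvature, homogenized with respect to
the second coordinate of pairs `(m, c)`. -/
def curvatureForm : AffExt h.dZero →ₗ[ℚ] AffExt h.dZero →ₗ[ℚ] H :=
  LinearMap.mk₂ ℚ (fun z z' => (1 / 2 : ℚ) • (z.2 • h.d z'.1 + z'.2 • h.d z.1 + h.bracket z.1 z'.1))
    (fun z w z' => by
      change (1 / 2 : ℚ) • ((z.2 + w.2) • h.d z'.1 + z'.2 • h.d (z.1 + w.1) +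
        h.bracket (z.1 + w.1) z'.1) = _
      simp only [map_add, LinearMap.add_apply, add_smul, smul_add]; abel)
    (fun t z z' => by
      change (1 / 2 : ℚ) • ((t * z.2) • h.d z'.1 + z'.2 • h.d (t • z.1) +
        h.bracket (t • z.1) z'.1) = _
      simp only [map_smul, LinearMap.smul_apply]; module)
    (fun z z' w => by
      change (1 / 2 : ℚ) • (z.2 • h.d (z'.1 + w.1) + (z'.2 + w.2) • h.d z.1 +
        h.bracket z.1 (z'.1 + w.1)) = _
      simp only [map_add, add_smul, smul_add]; abel)
    (fun t z z' => by
      change (1 / 2 : ℚ) • (z.2 • h.d (t • z'.1) + (t * z'.2) • h.d z.1 +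
        h.bracket z.1 (t • z'.1)) = _
      simp only [map_smul]; module)

theorem curvatureForm_apply (z z' : AffExt h.dZero) : curvatureForm h z z' =
    (1 / 2 : ℚ) • (z.2 • h.d z'.1 + z'.2 • h.d z.1 + h.bracket z.1 z'.1) := rfl

theorem curvatureForm_affMk (γ : H) :
    curvatureForm h (affMk h.dZero γ 1) (affMk h.dZero γ 1) =
      h.d γ + (1 / 2 : ℚ) • h.bracket γ γ := by
  rw [curvatureForm_apply]
  change (1 / 2 : ℚ) • ((1 : ℚ) • h.d γ + (1 : ℚ) • h.d γ + h.bracket γ γ) = _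
  module

theorem gauge_mem (X : h.Zero) {γ : H} (hγ : γ ∈ h.gr 1) : h.gauge X γ ∈ h.gr 1 :=
  sub_mem hγ (nilEval_mem_gr _ X
    (add_mem (by simpa using h.d_mem X.mem) (by simpa using h.bracket_mem hγ X.mem)))

theorem curvatureForm_leibniz (X : h.Zero) {z z' : AffExt h.dZero} (hz : z.1 ∈ h.gr 1) :
    curvatureForm h (act _ X z) z' + curvatureForm h z (act _ X z') =
      act H X (curvatureForm h z z') := by
  have hX : h.d (Zero.val X) ∈ h.gr 1 := by simpa using h.d_mem X.mem
  have e1 : ∀ z : AffExt h.dZero, (⁅X, z⁆ : AffExt h.dZero).1 =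
      h.bracket (Zero.val X) z.1 - z.2 • h.d (Zero.val X) := fun _ => rfl
  have e2 : ∀ z : AffExt h.dZero, (⁅X, z⁆ : AffExt h.dZero).2 = 0 := fun _ => rfl
  simp only [curvatureForm_apply, e1, e2, act_apply, zero_lie_def, map_sub, map_smul,
    map_add, LinearMap.sub_apply, LinearMap.smul_apply, bracket_zero_leibniz X.mem, h.d_d,
    bracket_zero_jacobi X.mem hz, bracket_comm_of_mem_one hz hX]
  module

variable [h.IsNilpotent]

/-- The curvature `d γ + ½ [γ, γ]` is equivariant for the gauge action: the group `exp 𝔥⁰` acts on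
pairs `(γ, 1)` linearly and preserves `curvatureForm`. -/
theorem curvature_gauge (X : h.Zero) {γ : H} (hγ : γ ∈ h.gr 1) :
    h.d (h.gauge X γ) + (1 / 2 : ℚ) • h.bracket (h.gauge X γ) (h.gauge X γ) =
      expAd X (h.d γ + (1 / 2 : ℚ) • h.bracket γ γ) := by
  let S : Submodule ℚ (AffExt h.dZero) := (h.gr 1).prod (⊤ : Submodule ℚ ℚ)
  have hS : ∀ z ∈ S, act (AffExt h.dZero) X z ∈ S := fun z hz =>
    ⟨sub_mem (zero_add (1 : ℤ) ▸ h.bracket_mem X.mem hz.1)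
      (Submodule.smul_mem _ _ (zero_add (1 : ℤ) ▸ h.d_mem X.mem)), trivial⟩
  have hm : affMk h.dZero γ 1 ∈ S := ⟨hγ, trivial⟩
  have := nexp_bilinear_of_mem (curvatureForm h) (isNilpotent_act X) (isNilpotent_act (M := H) X) S
    hS (fun z hz z' _ => curvatureForm_leibniz X hz.1) hm hm
  rwa [nexp_affExt, ← gauge_eq X hγ, curvatureForm_affMk, curvatureForm_affMk] at this

/-- The Maurer-Cartan element `(exp X) · γ`. -/
def MC.gauge (X : h.Zero) (γ : h.MC) : h.MC where
  elt := h.gauge X γ.elt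
  mem := gauge_mem X γ.mem
  eqn := by rw [curvature_gauge X γ.mem, γ.eqn, map_zero]

/-- The 1-morphism `exp X : γ → (exp X) · γ`. -/
def MC.toGauge (X : h.Zero) (γ : h.MC) : γ ⟶ γ.gauge X := ⟨X, rfl⟩

/-- An element `X` such that `exp X` stabilizes `γ` is closed for the twisted differential `δ_γ`. -/
theorem twist_eq_zero_of_gauge_eq {X : h.Zero} {γ : H} (hX : h.gauge X γ = γ) :
    h.twist γ (Zero.val X) = 0 := by
  rw [gauge, sub_eq_self] at hX
  have := congrArg (fun x => logQuot (nexp (act H X)) x) hX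
  rwa [← Module.End.mul_apply, logQuot_nexp_mul (isNilpotent_act X), map_zero] at this

end Curvature

/-! ### Filtered contractions -/

namespace Hom
variable {H : Type u} [AddCommGroup H] [Module ℚ H] {K : Type v} [AddCommGroup K] [Module ℚ K]
  {h : DGLA H} {k : DGLA K}

/-- A contraction of `𝔨` onto `𝔥` along a homomorphism `f : 𝔥 → 𝔨`: a retraction by a homomorphism
of DGLAs and a chain homotopy from the resulting idempotent to the identity, together with a finite
central filtration of `𝔨` that is preserved by the homotopy. -/
structure Contraction (f : Hom h k) where
  /-- The retraction. -/
  retr : Hom k h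
  retr_map : ∀ x, retr.toLin (f.toLin x) = x
  /-- The homotopy. -/
  htpy : K →ₗ[ℚ] K
  htpy_mem : ∀ {i x}, x ∈ k.gr i → htpy x ∈ k.gr (i - 1)
  retr_htpy : ∀ x, retr.toLin (htpy x) = 0
  d_htpy : ∀ x, k.d (htpy x) + htpy (k.d x) = x - f.toLin (retr.toLin x)
  /-- The filtration. -/
  fil : ℕ → Submodule ℚ K
  fil_zero : fil 0 = ⊤
  fil_succ_le : ∀ i, fil (i + 1) ≤ fil i
  exists_fil_eq_bot : ∃ i, fil i = ⊥
  bracket_mem_fil : ∀ {i} x {y}, y ∈ fil i → k.bracket x y ∈ fil (i + 1)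
  htpy_mem_fil : ∀ {i x}, x ∈ fil i → htpy x ∈ fil i

namespace Contraction
variable {f : Hom h k}

theorem map_injective (c : Contraction f) : Function.Injective f.toLin := fun x y e => by
  rw [← c.retr_map x, e, c.retr_map]

variable (c : Contraction f)

/-- An induction principle for statements that can be moved up the filtration. -/
theorem fil_induction {α : Type*} (φ : α → K) {P : α → Prop} (zero : ∀ a, φ a = 0 → P a)
    (step : ∀ i a, φ a ∈ c.fil i → (∀ b, φ b ∈ c.fil (i + 1) → P b) → P a) (a : α) : P a := by
  obtain ⟨n, hn⟩ := c.exists_fil_eq_bot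
  have key : ∀ j i, i + j = n → ∀ a, φ a ∈ c.fil i → P a := by
    intro j
    induction j with
    | zero => rintro i rfl a ha; exact zero a (by rw [add_zero] at hn; rwa [hn] at ha)
    | succ j ih => exact fun i hij a ha => step i a ha (ih (i + 1) (by omega))
  exact key n 0 (zero_add n) a (by rw [c.fil_zero]; trivial)

/-- The kernel of the retraction is acyclic for every twisted differential `δ_γ`. If `x` is
`δ_γ`-closed then `x - δ_γ S x = - S [γ, x] - [γ, S x]`, where `S` is the homotopy, lies one step
deeper in the filtration. -/
theorem exists_twist_eq (γ : k.MC) {i : ℤ} {x : K} (hx : x ∈ k.gr i)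
    (hd : k.twist γ.elt x = 0) (hp : c.retr.toLin x = 0) :
    ∃ y ∈ k.gr (i - 1), k.twist γ.elt y = x ∧ c.retr.toLin y = 0 := by
  revert hx hd hp
  refine c.fil_induction (fun x => x) (P := fun x => x ∈ k.gr i → k.twist γ.elt x = 0 →
    c.retr.toLin x = 0 → ∃ y ∈ k.gr (i - 1), k.twist γ.elt y = x ∧ c.retr.toLin y = 0) ?_ ?_ x
  · rintro _ rfl - - -
    exact ⟨0, zero_mem _, map_zero _, map_zero _⟩
  · intro j x hj ih hx hd hp
    have hS := c.htpy_mem hx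
    have e : x - k.twist γ.elt (c.htpy x) =
        -(c.htpy (k.bracket γ.elt x) + k.bracket γ.elt (c.htpy x)) := by
      have h1 := c.d_htpy x
      rw [hp, map_zero, sub_zero] at h1
      have h2 : k.d x = -k.bracket γ.elt x := eq_neg_of_add_eq_zero_left hd
      rw [h2, map_neg] at h1
      nth_rewrite 1 [← h1]
      rw [twist_apply]
      abel
    obtain ⟨y, hy, hy', hy''⟩ := ih (x - k.twist γ.elt (c.htpy x))
      (by
        rw [e]
        exact neg_mem (add_mem (c.htpy_mem_fil (c.bracket_mem_fil _ hj))
          (c.bracket_mem_fil _ (c.htpy_mem_fil hj))))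
      (sub_mem hx (by simpa using twist_mem γ.mem hS))
      (by rw [map_sub, hd, twist_twist, sub_zero])
      (by rw [map_sub, hp, c.retr.map_twist, c.retr_htpy, map_zero, sub_zero])
    exact ⟨y + c.htpy x, add_mem hy hS, by rw [map_add, hy', sub_add_cancel],
      by rw [map_add, hy'', c.retr_htpy, add_zero]⟩

theorem nilEval_sub_mem_fil (p : PowerSeries ℚ) (X : k.Zero) [k.IsNilpotent] {i : ℕ} {x : K}
    (hx : x ∈ c.fil i) :
    nilEval p (act K X) x - PowerSeries.coeff 0 p • x ∈ c.fil (i + 1) := by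
  obtain ⟨n, hn⟩ := isNilpotent_act (M := K) X
  have hp : ∀ j : ℕ, (act K X ^ (j + 1)) x ∈ c.fil (i + 1) := by
    intro j
    induction j with
    | zero => rw [zero_add, pow_one]; exact c.bracket_mem_fil _ hx
    | succ j ih =>
      rw [pow_succ']
      exact c.fil_succ_le _ (c.bracket_mem_fil _ ih)
  rw [nilEval_eq_sum p (pow_eq_zero_of_le (Nat.le_succ n) hn), Finset.sum_range_succ',
    LinearMap.add_apply, LinearMap.smul_apply, pow_zero, Module.End.one_apply,
    add_sub_cancel_right, LinearMap.sum_apply]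
  exact sum_mem fun j _ => Submodule.smul_mem _ _ (hp j)

variable [k.IsNilpotent]

/-- The element `X = S (γ - f p γ)`, where `p` is the retraction and `S` is the homotopy, moves `γ`
closer to `f p γ`. -/
theorem gauge_htpy_sub_mem_fil (γ : k.MC) {i : ℕ} {X : k.Zero}
    (hX : Zero.val X = c.htpy (γ.elt - f.toLin (c.retr.toLin γ.elt)))
    (hγ : γ.elt - f.toLin (c.retr.toLin γ.elt) ∈ c.fil i) :
    k.gauge X γ.elt - f.toLin (c.retr.toLin γ.elt) ∈ c.fil (i + 1) := by
  set γ' := f.mcObj (c.retr.mcObj γ)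
  change k.gauge X γ.elt - γ'.elt ∈ _
  change γ.elt - γ'.elt ∈ _ at hγ
  change Zero.val X = c.htpy (γ.elt - γ'.elt) at hX
  set η := γ.elt - γ'.elt with hη
  have hη1 : η ∈ k.gr 1 := sub_mem γ.mem γ'.mem
  have hpη : c.retr.toLin η = 0 := by
    rw [hη, map_sub]
    change _ - c.retr.toLin (f.toLin (c.retr.toLin γ.elt)) = 0
    rw [c.retr_map, sub_self]
  have hdη : k.d η ∈ c.fil (i + 1) := by
    have e : k.d η = -(1 / 2 : ℚ) • (k.bracket γ.elt η + k.bracket γ'.elt η) := by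
      have e1 : k.d γ.elt = -((1 / 2 : ℚ) • k.bracket γ.elt γ.elt) :=
        eq_neg_of_add_eq_zero_left γ.eqn
      have e2 : k.d γ'.elt = -((1 / 2 : ℚ) • k.bracket γ'.elt γ'.elt) :=
        eq_neg_of_add_eq_zero_left γ'.eqn
      rw [hη, map_sub, e1, e2, map_sub, map_sub, bracket_comm_of_mem_one γ'.mem γ.mem]
      module
    rw [e]
    exact Submodule.smul_mem _ _ (add_mem (c.bracket_mem_fil _ hγ) (c.bracket_mem_fil _ hγ))
  have hdX : k.d (Zero.val X) = η - c.htpy (k.d η) := by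
    have := c.d_htpy η
    rw [hpη, map_zero, sub_zero] at this
    exact hX ▸ eq_sub_of_add_eq this
  have hbr : k.bracket γ.elt (Zero.val X) ∈ c.fil (i + 1) := by
    rw [hX]
    exact c.bracket_mem_fil _ (c.htpy_mem_fil hγ)
  have hSd := c.htpy_mem_fil hdη
  have hz : k.d (Zero.val X) + k.bracket γ.elt (Zero.val X) ∈ c.fil i := by
    rw [hdX]
    exact add_mem (sub_mem hγ (c.fil_succ_le _ hSd)) (c.fil_succ_le _ hbr)
  have h1 := c.nilEval_sub_mem_fil dexpSeries X hz
  rw [show PowerSeries.coeff 0 dexpSeries = 1 by simp [dexpSeries], one_smul] at h1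
  have e : k.gauge X γ.elt - γ'.elt =
      -(nilEval dexpSeries (act K X) (k.d (Zero.val X) + k.bracket γ.elt (Zero.val X)) -
        (k.d (Zero.val X) + k.bracket γ.elt (Zero.val X))) +
      (c.htpy (k.d η) - k.bracket γ.elt (Zero.val X)) := by
    have e' : γ.elt = γ'.elt + (k.d (Zero.val X) + c.htpy (k.d η)) := by
      rw [hdX, sub_add_cancel, hη, add_sub_cancel]
    rw [gauge, sub_right_comm, sub_eq_of_eq_add' e']
    abel
  rw [e]
  exact add_mem (neg_mem h1) (sub_mem hSd hbr)

variable [h.IsNilpotent]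

/-- Every Maurer-Cartan element `γ` of `𝔨` is gauge equivalent to the image of its retraction. -/
theorem nonempty_hom_retr (γ : k.MC) : Nonempty (γ ⟶ f.mcObj (c.retr.mcObj γ)) := by
  refine c.fil_induction (fun γ : k.MC => γ.elt - f.toLin (c.retr.toLin γ.elt))
    (P := fun γ => Nonempty (γ ⟶ f.mcObj (c.retr.mcObj γ))) ?_ ?_ γ
  · intro γ hγ
    exact ⟨⟨0, (DGLA.gauge_zero γ).trans (sub_eq_zero.1 hγ)⟩⟩
  · intro i γ hγ ih
    have hmem : γ.elt - f.toLin (c.retr.toLin γ.elt) ∈ k.gr 1 :=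
      sub_mem γ.mem (f.mcObj (c.retr.mcObj γ)).mem
    let X : k.Zero := Zero.mk (c.htpy (γ.elt - f.toLin (c.retr.toLin γ.elt)))
      (sub_self (1 : ℤ) ▸ c.htpy_mem hmem)
    have hX : c.retr.zero X = 0 := Zero.val_injective (c.retr_htpy _)
    have e : c.retr.toLin (k.gauge X γ.elt) = c.retr.toLin γ.elt := by
      rw [c.retr.map_gauge, hX]
      exact DGLA.gauge_zero (c.retr.mcObj γ)
    obtain ⟨Y⟩ := ih (γ.gauge X) (by
      have := c.gauge_htpy_sub_mem_fil γ (X := X) rfl hγ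
      rwa [← e] at this)
    exact ⟨γ.toGauge X ≫ ⟨Y.log, Y.gauge_eq.trans (congrArg f.toLin e)⟩⟩

end Contraction
end Hom
end DGLA

namespace DGLA

/-! ### Biequivalence from a contraction -/

theorem MC.nonempty_equivalence {H : Type u} [AddCommGroup H] [Module ℚ H] {h : DGLA H}
    [h.IsNilpotent] [h.IsGENegOne] {γ₁ γ₂ : h.MC} (X : γ₁ ⟶ γ₂) :
    Nonempty (Bicategory.Equivalence γ₁ γ₂) := by
  obtain ⟨Y, h1, h2⟩ := MC.exists_inv X
  exact ⟨Bicategory.Equivalence.mkOfAdjointifyCounit (eqToIso h1.symm) (eqToIso h2)⟩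

namespace Hom.Contraction
variable {H : Type u} [AddCommGroup H] [Module ℚ H] {K : Type v} [AddCommGroup K] [Module ℚ K]
  {h : DGLA H} {k : DGLA K} {f : Hom h k}

theorem retr_mcObj (c : Contraction f) (μ : h.MC) : (c.retr.mcObj (f.mcObj μ)).elt = μ.elt :=
  c.retr_map _

theorem retr_zero_zero (c : Contraction f) (z : h.Zero) : c.retr.zero (f.zero z) = z :=
  Zero.val_injective (c.retr_map _)

/-- An element of degree `-1` whose twisted differential lies in the image of `𝔥` is itself in the
image of `𝔥`: the difference to its retraction is closed, hence exact, and `𝔨⁻² = 0`. -/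
theorem map_retr_of_twist_eq (c : Contraction f) [k.IsGENegOne] (μ : h.MC) {t : K}
    (ht : t ∈ k.gr (-1)) {z : H} (hz : k.twist (f.mcObj μ).elt t = f.toLin z) :
    f.toLin (c.retr.toLin t) = t := by
  have h1 : h.twist μ.elt (c.retr.toLin t) = z := by
    rw [← c.retr_mcObj, ← c.retr.map_twist, hz, c.retr_map]
  obtain ⟨y, hy, hy', -⟩ := c.exists_twist_eq (f.mcObj μ)
    (sub_mem ht (f.map_mem (c.retr.map_mem ht)))
    (by rw [map_sub, hz, ← f.map_twist, h1, sub_self])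
    (by rw [map_sub, c.retr_map, sub_self])
  rw [IsGENegOne.gr_eq_bot _ (by norm_num), Submodule.mem_bot] at hy
  rw [hy, map_zero] at hy'
  exact (sub_eq_zero.1 hy'.symm).symm

variable [h.IsNilpotent] [k.IsNilpotent]

/-- The retraction of a gauge equivalence between elements in the image of `𝔥`. -/
def retrHom (c : Contraction f) {μ ν : h.MC} (X : f.mcObj μ ⟶ f.mcObj ν) : μ ⟶ ν :=
  ⟨c.retr.zero X.log, by
    rw [← c.retr_mcObj μ, ← c.retr_mcObj ν]
    exact (c.retr.mcMap X).gauge_eq⟩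

variable [k.IsGENegOne]

/-- A gauge equivalence between elements in the image of `𝔥` is 2-isomorphic to the image of its
retraction: the quotient of the two stabilizes the target, so its logarithm is closed for the
twisted differential and is killed by the retraction, hence is exact. -/
theorem nonempty_hom_retrHom (c : Contraction f) {μ ν : h.MC} (X : f.mcObj μ ⟶ f.mcObj ν) :
    Nonempty (f.mcMap (c.retrHom X) ⟶ X) := by
  obtain ⟨Y, h1, h2⟩ := MC.exists_inv (f.mcMap (c.retrHom X))
  let V : f.mcObj ν ⟶ f.mcObj ν := Y ≫ X
  have hV : c.retr.zero V.log = 0 := by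
    have e : c.retr.zero X.log = c.retr.zero (f.mcMap (c.retrHom X)).log :=
      (c.retr_zero_zero _).symm
    rw [MC.comp_log, map_bch, e, ← map_bch, ← MC.comp_log, h2, MC.id_log, map_zero]
  obtain ⟨y, hy, hy', -⟩ := c.exists_twist_eq (f.mcObj ν) V.log.mem
    (twist_eq_zero_of_gauge_eq V.gauge_eq) (congrArg Zero.val hV)
  let t : NegOne (f.mcObj ν) := NegOne.mk y hy
  have ht : NegOne.delta t = V.log := Zero.val_injective hy'
  refine ⟨⟨t, ?_⟩⟩
  rw [ht, ← MC.comp_log, ← Category.assoc, h1]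
  exact bch_zero_right _

variable [h.IsGENegOne]

theorem faithful_mapFunctor (c : Contraction f) (μ ν : h.MC) : (f.mc.mapFunctor μ ν).Faithful where
  map_injective {X Y s t} e := by
    refine MC.hom₂_ext (NegOne.val_injective (c.map_injective ?_))
    exact congrArg (fun r => NegOne.val (MC.Hom₂.log r)) e

theorem full_mapFunctor (c : Contraction f) (μ ν : h.MC) : (f.mc.mapFunctor μ ν).Full where
  map_surjective {X Y} t := by
    let t' : f.mcMap X ⟶ f.mcMap Y := t
    have hδ : NegOne.delta t'.log = f.zero (bch Y.log (-X.log)) := by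
      have := t'.eq
      have e := congrArg (fun z => bch z (-(f.mcMap X).log)) this
      rw [bch_assoc, bch_neg_right, bch_zero_right] at e
      rw [e, map_bch, map_neg]
      rfl
    have hr := c.map_retr_of_twist_eq ν t'.log.mem (congrArg Zero.val hδ)
    let s : NegOne ν := NegOne.mk (c.retr.toLin (NegOne.val t'.log)) (c.retr.map_mem t'.log.mem)
    have hs : f.negOneLin ν s = t'.log := NegOne.val_injective hr
    have hs' : NegOne.delta s = bch Y.log (-X.log) := by
      have := (f.delta_negOneLin ν s).symm
      rw [hs, hδ] at this
      exact Zero.val_injective (c.map_injective (congrArg Zero.val this))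
    refine ⟨⟨s, by rw [hs', bch_assoc, bch_neg_left, bch_zero_right]⟩, ?_⟩
    exact MC.hom₂_ext hs

theorem essSurj_mapFunctor (c : Contraction f) (μ ν : h.MC) : (f.mc.mapFunctor μ ν).EssSurj where
  mem_essImage X := by
    obtain ⟨t⟩ := c.nonempty_hom_retrHom X
    exact ⟨c.retrHom X, ⟨Groupoid.isoEquivHom _ _ |>.symm t⟩⟩

theorem isEquivalence_mapFunctor (c : Contraction f) (μ ν : h.MC) :
    (f.mc.mapFunctor μ ν).IsEquivalence where
  faithful := c.faithful_mapFunctor μ ν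
  full := c.full_mapFunctor μ ν
  essSurj := c.essSurj_mapFunctor μ ν

/-- A homomorphism that admits a filtered contraction induces an equivalence of Deligne-Getzler
2-groupoids. -/
theorem isBiequivalence (c : Contraction f) : IsBiequivalence f.mc.toPseudofunctor := by
  refine ⟨fun γ => ⟨c.retr.mcObj γ, ?_⟩, c.isEquivalence_mapFunctor⟩
  obtain ⟨X⟩ := c.nonempty_hom_retr γ
  obtain ⟨Y, -⟩ := MC.exists_inv X
  exact MC.nonempty_equivalence Y

end Hom.Contraction
end DGLA

/-! ### Contractions of commutative differential graded algebras -/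

theorem DGLA.lcs_succ_le {H : Type u} [AddCommGroup H] [Module ℚ H] (h : DGLA H) (i : ℕ) :
    h.lcs (i + 1) ≤ h.lcs i := by
  induction i with
  | zero => exact le_top
  | succ i ih => exact Submodule.map₂_le_map₂_right ih

namespace CDGA
variable {Ω : Type v} [Ring Ω] [Algebra ℚ Ω] {a : CDGA Ω}

/-- A contraction of a CDGA onto the ground field: an augmentation and a chain homotopy of degree
`-1` from it to the identity. -/
structure Contraction (a : CDGA Ω) where
  /-- The augmentation. -/
  aug : Ω →ₐ[ℚ] ℚ
  aug_of_mem : ∀ {p ω}, ω ∈ a.gr (p + 1) → aug ω = 0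
  /-- The homotopy. -/
  htpy : Ω →ₗ[ℚ] Ω
  htpy_of_mem_zero : ∀ {ω}, ω ∈ a.gr 0 → htpy ω = 0
  htpy_mem : ∀ {p ω}, ω ∈ a.gr (p + 1) → htpy ω ∈ a.gr p
  aug_htpy : ∀ ω, aug (htpy ω) = 0
  d_htpy : ∀ ω, a.d (htpy ω) + htpy (a.d ω) = ω - algebraMap ℚ Ω (aug ω)

namespace Contraction
variable (c : a.Contraction)

theorem aug_d (ω : Ω) : c.aug (a.d ω) = 0 :=
  gr_induction a.internal (p := fun ω => c.aug (a.d ω) = 0) ω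
    (fun _ _ hω => c.aug_of_mem (a.d_mem hω)) (by simp)
    (fun x y hx hy => by simp only [map_add, hx, hy, add_zero])

theorem aug_sign (q : ℤ) (ω : Ω) : c.aug (a.sign q ω) = c.aug ω := by
  refine gr_induction a.internal (p := fun ω => c.aug (a.sign q ω) = c.aug ω) ω
    (fun p ω hω => ?_) (by simp) (fun x y hx hy => by simp only [map_add, hx, hy])
  cases p with
  | zero => rw [sign_of_mem q hω, Nat.cast_zero, mul_zero, zpow_zero, one_smul]
  | succ p => rw [c.aug_of_mem hω, c.aug_of_mem (sign_mem q hω)]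

theorem sign_htpy (ω : Ω) : a.sign 1 (c.htpy ω) = -c.htpy (a.sign 1 ω) := by
  refine gr_induction a.internal (p := fun ω => a.sign 1 (c.htpy ω) = -c.htpy (a.sign 1 ω)) ω
    (fun p ω hω => ?_) (by simp) (fun x y hx hy => by simp only [map_add, hx, hy, neg_add])
  cases p with
  | zero => rw [c.htpy_of_mem_zero hω, c.htpy_of_mem_zero (sign_mem 1 hω), map_zero, neg_zero]
  | succ p =>
    rw [sign_of_mem 1 hω, sign_of_mem 1 (c.htpy_mem hω), map_smul, ← neg_smul]
    congr 1
    rw [one_mul, one_mul, Nat.cast_succ, zpow_add_one₀ (by norm_num)]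
    ring

variable {H : Type u} [AddCommGroup H] [Module ℚ H] (h : DGLA H)

/-- The linear map `ω ⊗ x ↦ ε(ω) x` defined by the augmentation `ε`. -/
def retrLin (H : Type u) [AddCommGroup H] [Module ℚ H] : Ω ⊗[ℚ] H →ₗ[ℚ] H :=
  (TensorProduct.lid ℚ H).toLinearMap ∘ₗ c.aug.toLinearMap.rTensor H

theorem retrLin_tmul (ω : Ω) (x : H) : c.retrLin H (ω ⊗ₜ x) = c.aug ω • x := rfl

/-- The homomorphism `Ω ⊗ 𝔥 → 𝔥` of DGLAs defined by the augmentation. -/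
def retr : DGLA.Hom (a.tensor h) h where
  toLin := c.retrLin H
  map_mem {i t} ht := by
    refine tensorGr_induction (P := fun t => c.retrLin H t ∈ h.gr i) ht
      (fun p j ω x hi hω hx => ?_) (by simp)
      (fun s t hs ht => by rw [map_add]; exact add_mem hs ht)
    rw [retrLin_tmul]
    cases p with
    | zero => rw [hi, Nat.cast_zero, zero_add]; exact Submodule.smul_mem _ _ hx
    | succ p => rw [c.aug_of_mem hω, zero_smul]; exact zero_mem _
  map_bracket s t := by
    refine tensor_induction (a := a) (h := h) (P := fun s => c.retrLin H (a.tensorBracket h s t) =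
      h.bracket (c.retrLin H s) (c.retrLin H t)) s (fun p q ω x hω hx => ?_) (by simp)
      (fun s s' hs hs' => by simp only [map_add, LinearMap.add_apply, hs, hs'])
    induction t using TensorProduct.induction_on with
    | zero => simp
    | add t t' ht ht' => simp only [map_add, ht, ht']
    | tmul η y =>
      rw [tensorBracket_tmul hx, retrLin_tmul, retrLin_tmul, retrLin_tmul, map_mul, c.aug_sign,
        map_smul, map_smul, LinearMap.smul_apply, smul_smul, _root_.mul_comm]
  map_d t := by
    change c.retrLin H (a.tensorD h t) = h.d (c.retrLin H t)
    induction t using TensorProduct.induction_on with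
    | zero => simp
    | add t t' ht ht' => simp only [map_add, ht, ht']
    | tmul ω x =>
      rw [tensorD_tmul, map_add, retrLin_tmul, retrLin_tmul, retrLin_tmul, c.aug_d, c.aug_sign,
        zero_smul, zero_add, map_smul]

/-- A contraction of a CDGA `Ω` onto the ground field induces a contraction of `Ω ⊗ 𝔥` onto a
nilpotent DGLA `𝔥`, filtered by the submodules `Ω ⊗ Fⁱ𝔥`. -/
def tensor [h.IsNilpotent] : (a.const h).Contraction where
  retr := c.retr h
  retr_map x := by
    change c.retrLin H ((1 : Ω) ⊗ₜ x) = x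
    rw [retrLin_tmul, map_one, one_smul]
  htpy := c.htpy.rTensor H
  htpy_mem {i t} ht := by
    refine tensorGr_induction (P := fun t => c.htpy.rTensor H t ∈ a.tensorGr h (i - 1)) ht
      (fun p j ω x hi hω hx => ?_) (by simp)
      (fun s t hs ht => by rw [map_add]; exact add_mem hs ht)
    rw [LinearMap.rTensor_tmul]
    cases p with
    | zero => rw [c.htpy_of_mem_zero hω, TensorProduct.zero_tmul]; exact zero_mem _
    | succ p => exact tmul_mem (c.htpy_mem hω) hx (by push_cast at hi; omega)
  retr_htpy t := by
    change c.retrLin H (c.htpy.rTensor H t) = 0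
    induction t using TensorProduct.induction_on with
    | zero => simp
    | add t t' ht ht' => simp only [map_add, ht, ht', add_zero]
    | tmul ω x => rw [LinearMap.rTensor_tmul, retrLin_tmul, c.aug_htpy, zero_smul]
  d_htpy t := by
    change a.tensorD h (c.htpy.rTensor H t) + c.htpy.rTensor H (a.tensorD h t) =
      t - (1 : Ω) ⊗ₜ c.retrLin H t
    induction t using TensorProduct.induction_on with
    | zero => simp
    | add t t' ht ht' =>
      rw [map_add, map_add, map_add, map_add, map_add, TensorProduct.tmul_add, add_add_add_comm, ht,
        ht', add_sub_add_comm]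
    | tmul ω x =>
      have e : algebraMap ℚ Ω (c.aug ω) ⊗ₜ[ℚ] x = (1 : Ω) ⊗ₜ[ℚ] (c.aug ω • x) := by
        rw [Algebra.algebraMap_eq_smul_one, TensorProduct.smul_tmul]
      rw [LinearMap.rTensor_tmul, tensorD_tmul, tensorD_tmul, map_add, LinearMap.rTensor_tmul,
        LinearMap.rTensor_tmul, c.sign_htpy, TensorProduct.neg_tmul, retrLin_tmul, ← e,
        ← TensorProduct.sub_tmul, ← c.d_htpy, TensorProduct.add_tmul]
      abel
  fil i := Submodule.map₂ (TensorProduct.mk ℚ Ω H) ⊤ (h.lcs i)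
  fil_zero := eq_top_iff.2 (a.tensor_lcs_le h 0)
  fil_succ_le i := Submodule.map₂_le_map₂_right (h.lcs_succ_le i)
  exists_fil_eq_bot := by
    obtain ⟨k, hk⟩ := DGLA.IsNilpotent.exists_lcs_eq_bot (h := h)
    exact ⟨k, by rw [hk, Submodule.map₂_bot_right]⟩
  bracket_mem_fil {i} s {t} ht := by
    refine tensor_induction (a := a) (h := h) (P := fun s => a.tensorBracket h s t ∈
        Submodule.map₂ (TensorProduct.mk ℚ Ω H) ⊤ (h.lcs (i + 1))) s
      (fun p j ω x hω hx => ?_) (by simp)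
      (fun s s' h h' => by rw [map_add, LinearMap.add_apply]; exact add_mem h h')
    refine map₂_induction (C := fun t => a.tensorBracket h (ω ⊗ₜ x) t ∈
        Submodule.map₂ (TensorProduct.mk ℚ Ω H) ⊤ (h.lcs (i + 1))) ht
      (fun η _ y hy => ?_) (by simp)
      (fun s s' h h' => by rw [map_add]; exact add_mem h h')
    rw [TensorProduct.mk_apply, tensorBracket_tmul hx]
    exact Submodule.apply_mem_map₂ (TensorProduct.mk ℚ Ω H) Submodule.mem_top
      (h.bracket_mem_lcs x hy)
  htpy_mem_fil {i t} ht := by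
    refine map₂_induction (C := fun t => c.htpy.rTensor H t ∈
        Submodule.map₂ (TensorProduct.mk ℚ Ω H) ⊤ (h.lcs i)) ht
      (fun η _ y hy => ?_) (by simp)
      (fun s s' h h' => by rw [map_add]; exact add_mem h h')
    exact Submodule.apply_mem_map₂ (TensorProduct.mk ℚ Ω H) Submodule.mem_top hy

end Contraction
end CDGA

/-! ### The Poincaré lemma for polynomial forms -/

section Poincare
variable {n : ℕ}

/-- The interior product with the vector field `∂ / ∂tᵢ`. -/
def contract (i : Fin n) : Ext n →ₗ[ℚ] Ext n :=
  CliffordAlgebra.contractLeft (Q := (0 : QuadraticForm ℚ (Fin n → ℚ))) (LinearMap.proj i)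

theorem contract_ι_mul (i : Fin n) (v : Fin n → ℚ) (α : Ext n) :
    contract i (ExteriorAlgebra.ι ℚ v * α) = v i • α - ExteriorAlgebra.ι ℚ v * contract i α :=
  CliffordAlgebra.contractLeft_ι_mul _ v α

theorem contract_dt_mul (i j : Fin n) (α : Ext n) :
    contract i (dt j * α) = (if i = j then α else 0) - dt j * contract i α := by
  rw [dt, contract_ι_mul, Pi.single_apply, ite_smul, one_smul, zero_smul]

theorem contract_of_mem_zero (i : Fin n) {α : Ext n} (hα : α ∈ ⋀[ℚ]^0 (Fin n → ℚ)) :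
    contract i α = 0 := by
  rw [ExteriorAlgebra.exteriorPower, pow_zero, Submodule.mem_one] at hα
  obtain ⟨r, rfl⟩ := hα
  exact CliffordAlgebra.contractLeft_algebraMap _ _ r

theorem contract_mem (i : Fin n) {p : ℕ} {α : Ext n} (hα : α ∈ ⋀[ℚ]^(p + 1) (Fin n → ℚ)) :
    contract i α ∈ ⋀[ℚ]^p (Fin n → ℚ) := by
  induction p generalizing α with
  | zero =>
    rw [ExteriorAlgebra.exteriorPower, zero_add, pow_one] at hα
    obtain ⟨v, rfl⟩ := hα
    rw [← mul_one (ExteriorAlgebra.ι ℚ v), contract_ι_mul, contract_of_mem_zero i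
      (by rw [ExteriorAlgebra.exteriorPower, pow_zero]; exact Submodule.one_le.1 le_rfl),
      mul_zero, sub_zero]
    refine Submodule.smul_mem _ _ ?_
    rw [ExteriorAlgebra.exteriorPower, pow_zero]
    exact Submodule.one_le.1 le_rfl
  | succ p ih =>
    rw [ExteriorAlgebra.exteriorPower, pow_succ'] at hα
    refine Submodule.mul_induction_on hα ?_ ?_
    · rintro _ ⟨v, rfl⟩ β hβ
      rw [contract_ι_mul]
      refine sub_mem (Submodule.smul_mem _ _ hβ) ?_
      rw [ExteriorAlgebra.exteriorPower, pow_succ']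
      exact Submodule.mul_mem_mul ⟨v, rfl⟩ (ih hβ)
    · intro x y hx hy
      rw [map_add]
      exact add_mem hx hy

theorem sum_single_smul_dt (v : Fin n → ℚ) : ∑ i, v i • dt i = ExteriorAlgebra.ι ℚ v := by
  simp only [dt, ← map_smul, ← map_sum]
  congr 1
  ext j
  simp [Finset.sum_apply, Pi.single_apply]

/-- The operator `∑ᵢ dtᵢ ∧ ι_{∂ᵢ}` counts the degree of an alternating form. -/
theorem sum_dt_mul_contract {p : ℕ} {α : Ext n} (hα : α ∈ ⋀[ℚ]^p (Fin n → ℚ)) :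
    ∑ i, dt i * contract i α = (p : ℚ) • α := by
  induction p generalizing α with
  | zero => simp [contract_of_mem_zero _ hα]
  | succ p ih =>
    rw [ExteriorAlgebra.exteriorPower, pow_succ'] at hα
    refine Submodule.mul_induction_on hα ?_ ?_
    · rintro _ ⟨v, rfl⟩ β hβ
      have h1 : ∀ i, dt i * contract i (ExteriorAlgebra.ι ℚ v * β) =
          (v i • dt i) * β + ExteriorAlgebra.ι ℚ v * (dt i * contract i β) := by
        intro i
        have h2 : dt i * ExteriorAlgebra.ι ℚ v = -(ExteriorAlgebra.ι ℚ v * dt i) :=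
          eq_neg_of_add_eq_zero_left (ExteriorAlgebra.ι_add_mul_swap _ _)
        rw [contract_ι_mul, mul_sub, mul_smul_comm, smul_mul_assoc, ← mul_assoc, h2, neg_mul,
          sub_neg_eq_add, mul_assoc]
      simp only [h1, Finset.sum_add_distrib, ← Finset.sum_mul, ← Finset.mul_sum]
      rw [sum_single_smul_dt, ih hβ, mul_smul_comm, Nat.cast_succ, add_smul, one_smul, add_comm]
    · intro x y hx hy
      simp only [map_add, mul_add, Finset.sum_add_distrib, hx, hy, smul_add]

variable (n) in
/-- The interior product with the Euler vector field `∑ᵢ tᵢ ∂ / ∂tᵢ`. -/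
def eulerContract : Forms n →ₗ[ℚ] Forms n :=
  ∑ i, TensorProduct.map (LinearMap.mulLeft ℚ (MvPolynomial.X i)) (contract i)

theorem eulerContract_tmul (f : MvPolynomial (Fin n) ℚ) (α : Ext n) :
    eulerContract n (f ⊗ₜ α) = ∑ i, (MvPolynomial.X i * f) ⊗ₜ[ℚ] contract i α := by
  rw [eulerContract, LinearMap.sum_apply]
  rfl

/-- Cartan's formula for the Euler vector field: its Lie derivative multiplies a form by its total
weight, the degree of the coefficients plus the degree of the form. -/
theorem formsD_eulerContract {f : MvPolynomial (Fin n) ℚ} {k p : ℕ} (hf : f.IsHomogeneous k)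
    {α : Ext n} (hα : α ∈ ⋀[ℚ]^p (Fin n → ℚ)) :
    formsD n (eulerContract n (f ⊗ₜ α)) + eulerContract n (formsD n (f ⊗ₜ α)) =
      ((k + p : ℕ) : ℚ) • (f ⊗ₜ α) := by
  have h1 : formsD n (eulerContract n (f ⊗ₜ α)) = f ⊗ₜ[ℚ] (∑ i, dt i * contract i α) +
      ∑ i, ∑ j, (MvPolynomial.X i * MvPolynomial.pderiv j f) ⊗ₜ[ℚ] (dt j * contract i α) := by
    rw [eulerContract_tmul, map_sum, TensorProduct.tmul_sum, ← Finset.sum_add_distrib]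
    refine Finset.sum_congr rfl fun i _ => ?_
    simp only [formsD_tmul, Derivation.leibniz, smul_eq_mul, TensorProduct.add_tmul,
      Finset.sum_add_distrib, MvPolynomial.pderiv_X]
    rw [add_comm]
    congr 1
    rw [Finset.sum_eq_single i (fun j _ hj => by simp [hj.symm])
      (fun hi => absurd (Finset.mem_univ i) hi)]
    simp
  have h2 : eulerContract n (formsD n (f ⊗ₜ α)) =
      (∑ i, MvPolynomial.X i * MvPolynomial.pderiv i f) ⊗ₜ[ℚ] α -
      ∑ i, ∑ j, (MvPolynomial.X i * MvPolynomial.pderiv j f) ⊗ₜ[ℚ] (dt j * contract i α) := by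
    rw [formsD_tmul, map_sum, TensorProduct.sum_tmul]
    simp only [eulerContract_tmul]
    rw [Finset.sum_comm, ← Finset.sum_sub_distrib]
    refine Finset.sum_congr rfl fun i _ => ?_
    simp only [contract_dt_mul, TensorProduct.tmul_sub, Finset.sum_sub_distrib]
    congr 1
    rw [Finset.sum_eq_single i (fun j _ hj => by simp [hj.symm])
      (fun hi => absurd (Finset.mem_univ i) hi), if_pos rfl]
  rw [h1, h2, sum_dt_mul_contract hα, hf.sum_X_mul_pderiv, TensorProduct.tmul_smul,
    ← Nat.cast_smul_eq_nsmul ℚ, ← TensorProduct.smul_tmul', Nat.cast_add, add_smul]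
  abel

/-- The operator that divides a monomial `f` by its weight `deg f + p` as a coefficient of a
`p`-form. By the convention `0⁻¹ = 0` it kills the constants if `p = 0`. -/
def invWeight (n p : ℕ) : MvPolynomial (Fin n) ℚ →ₗ[ℚ] MvPolynomial (Fin n) ℚ :=
  (MvPolynomial.basisMonomials (Fin n) ℚ).constr ℚ fun m =>
    ((m.degree + p : ℕ) : ℚ)⁻¹ • MvPolynomial.monomial m 1

theorem invWeight_monomial (p : ℕ) (m : Fin n →₀ ℕ) (r : ℚ) :
    invWeight n p (MvPolynomial.monomial m r) =
      ((m.degree + p : ℕ) : ℚ)⁻¹ • MvPolynomial.monomial m r := by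
  have h := (MvPolynomial.basisMonomials (Fin n) ℚ).constr_basis ℚ (fun m =>
    ((m.degree + p : ℕ) : ℚ)⁻¹ • MvPolynomial.monomial m (1 : ℚ)) m
  rw [MvPolynomial.coe_basisMonomials] at h
  have hr : MvPolynomial.monomial m r = r • MvPolynomial.monomial m (1 : ℚ) := by
    rw [MvPolynomial.smul_monomial, smul_eq_mul, mul_one]
  rw [hr, map_smul, smul_comm, ← h]
  rfl

variable (n) in
/-- The homotopy of the Poincaré lemma: interior product with the Euler vector field, divided by
the weight. -/
def poincareHtpy : Forms n →ₗ[ℚ] Forms n :=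
  eulerContract n ∘ₗ grLift (formsGr_internal n) fun p =>
    TensorProduct.map (invWeight n p) LinearMap.id

theorem poincareHtpy_tmul {p : ℕ} (f : MvPolynomial (Fin n) ℚ) {α : Ext n}
    (hα : α ∈ ⋀[ℚ]^p (Fin n → ℚ)) :
    poincareHtpy n (f ⊗ₜ α) = eulerContract n (invWeight n p f ⊗ₜ α) := by
  rw [poincareHtpy, LinearMap.comp_apply, grLift_of_mem _ _ (tmul_mem_formsGr f hα)]
  rfl

theorem poincareHtpy_monomial_tmul {p : ℕ} (m : Fin n →₀ ℕ) (r : ℚ) {α : Ext n}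
    (hα : α ∈ ⋀[ℚ]^p (Fin n → ℚ)) :
    poincareHtpy n (MvPolynomial.monomial m r ⊗ₜ α) =
      ((m.degree + p : ℕ) : ℚ)⁻¹ • eulerContract n (MvPolynomial.monomial m r ⊗ₜ α) := by
  rw [poincareHtpy_tmul _ hα, invWeight_monomial, ← TensorProduct.smul_tmul', map_smul]

/-- The de Rham differential preserves the weight. -/
theorem poincareHtpy_formsD {p : ℕ} (m : Fin n →₀ ℕ) (r : ℚ) {α : Ext n}
    (hα : α ∈ ⋀[ℚ]^p (Fin n → ℚ)) :
    poincareHtpy n (formsD n (MvPolynomial.monomial m r ⊗ₜ α)) =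
      ((m.degree + p : ℕ) : ℚ)⁻¹ • eulerContract n (formsD n (MvPolynomial.monomial m r ⊗ₜ α)) := by
  rw [formsD_tmul, map_sum, map_sum, Finset.smul_sum]
  refine Finset.sum_congr rfl fun i _ => ?_
  have hα' : dt i * α ∈ ⋀[ℚ]^(p + 1) (Fin n → ℚ) := by
    rw [ExteriorAlgebra.exteriorPower, pow_succ']
    exact Submodule.mul_mem_mul ⟨_, rfl⟩ hα
  rw [MvPolynomial.pderiv_monomial]
  rcases Nat.eq_zero_or_pos (m i) with hi | hi
  · simp [hi]
  · rw [poincareHtpy_monomial_tmul _ _ hα']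
    have e : m.degree = (m - Finsupp.single i 1).degree + 1 := by
      have := congrArg Finsupp.degree (Finsupp.sub_add_single_one_cancel hi.ne')
      rw [map_add, Finsupp.degree_single] at this
      exact this.symm
    rw [e, add_right_comm, add_assoc]

variable (n) in
/-- The augmentation of polynomial forms that evaluates at the vertex `t₁ = … = tₙ = 0`. -/
def formsAug : Forms n →ₐ[ℚ] ℚ :=
  Algebra.TensorProduct.lift (MvPolynomial.aeval 0) ExteriorAlgebra.algebraMapInv
    fun _ _ => Commute.all _ _

theorem formsAug_tmul (f : MvPolynomial (Fin n) ℚ) (α : Ext n) :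
    formsAug n (f ⊗ₜ α) = MvPolynomial.aeval 0 f * ExteriorAlgebra.algebraMapInv α := rfl

theorem algebraMapInv_of_mem {p : ℕ} {α : Ext n} (hα : α ∈ ⋀[ℚ]^(p + 1) (Fin n → ℚ)) :
    ExteriorAlgebra.algebraMapInv α = 0 := by
  rw [ExteriorAlgebra.exteriorPower, pow_succ'] at hα
  refine Submodule.mul_induction_on hα ?_ ?_
  · rintro _ ⟨v, rfl⟩ β -
    rw [map_mul, ExteriorAlgebra.algebraMapInv, ExteriorAlgebra.lift_ι_apply, LinearMap.zero_apply,
      zero_mul]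
  · intro x y hx hy
    rw [map_add, hx, hy, add_zero]

variable (n) in
/-- The Poincaré lemma: the polynomial forms on the simplex contract to the ground field. -/
def omegaContraction : (Omega n).Contraction where
  aug := formsAug n
  aug_of_mem {p ω} hω := by
    refine map₂_induction (C := fun ω => formsAug n ω = 0) hω (fun f _ α hα => ?_) (by simp)
      (fun s t hs ht => by rw [map_add, hs, ht, add_zero])
    rw [TensorProduct.mk_apply, formsAug_tmul, algebraMapInv_of_mem hα, mul_zero]
  htpy := poincareHtpy n
  htpy_of_mem_zero {ω} hω := by
    refine map₂_induction (C := fun ω => poincareHtpy n ω = 0) hω (fun f _ α hα => ?_) (by simp)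
      (fun s t hs ht => by rw [map_add, hs, ht, add_zero])
    rw [TensorProduct.mk_apply, poincareHtpy_tmul _ hα, eulerContract_tmul]
    simp [contract_of_mem_zero _ hα]
  htpy_mem {p ω} hω := by
    refine map₂_induction (C := fun ω => poincareHtpy n ω ∈ formsGr n p) hω (fun f _ α hα => ?_)
      (by simp) (fun s t hs ht => by rw [map_add]; exact add_mem hs ht)
    rw [TensorProduct.mk_apply, poincareHtpy_tmul _ hα, eulerContract_tmul]
    exact sum_mem fun i _ => tmul_mem_formsGr _ (contract_mem i hα)
  aug_htpy ω := by
    rw [poincareHtpy, LinearMap.comp_apply]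
    generalize grLift (formsGr_internal n) (fun p => TensorProduct.map (invWeight n p) LinearMap.id)
      ω = t
    induction t using TensorProduct.induction_on with
    | zero => simp
    | add s t hs ht => rw [map_add, map_add, hs, ht, add_zero]
    | tmul f α => simp [eulerContract_tmul, formsAug_tmul]
  d_htpy ω := by
    change formsD n (poincareHtpy n ω) + poincareHtpy n (formsD n ω) = _
    refine gr_induction (formsGr_internal n) (p := fun ω => formsD n (poincareHtpy n ω) +
      poincareHtpy n (formsD n ω) = ω - algebraMap ℚ _ (formsAug n ω)) ω (fun p ω hω => ?_)
      (by simp) (fun s t hs ht => by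
        simp only [map_add]; rw [add_add_add_comm, hs, ht, add_sub_add_comm])
    refine map₂_induction (C := fun ω => formsD n (poincareHtpy n ω) +
      poincareHtpy n (formsD n ω) = ω - algebraMap ℚ _ (formsAug n ω)) hω (fun f hf α hα => ?_)
      (by simp) (fun s t hs ht => by
        simp only [map_add]; rw [add_add_add_comm, hs, ht, add_sub_add_comm])
    rw [TensorProduct.mk_apply]
    clear hf
    induction f using MvPolynomial.induction_on' with
    | add f g hf hg =>
      simp only [TensorProduct.add_tmul, map_add]
      rw [add_add_add_comm, hf, hg, add_sub_add_comm]
    | monomial m r =>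
      rw [poincareHtpy_monomial_tmul m r hα, poincareHtpy_formsD m r hα, map_smul, ← smul_add,
        formsD_eulerContract (MvPolynomial.isHomogeneous_monomial r rfl) hα, smul_smul]
      rcases Nat.eq_zero_or_pos (m.degree + p) with h0 | h0
      -- On constant functions the homotopy vanishes and the augmentation is the identity.
      · obtain ⟨hm, rfl⟩ := Nat.add_eq_zero_iff.1 h0
        rw [ExteriorAlgebra.exteriorPower, pow_zero, Submodule.mem_one] at hα
        obtain ⟨s, rfl⟩ := hα
        rw [Finsupp.degree_eq_zero_iff] at hm
        subst hm
        rw [h0, Nat.cast_zero, mul_zero, zero_smul, formsAug_tmul,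
          ExteriorAlgebra.algebraMap_leftInverse, eq_comm, sub_eq_zero]
        rw [show MvPolynomial.monomial 0 r = MvPolynomial.C r from rfl, MvPolynomial.aeval_C,
          Algebra.algebraMap_self_apply, Algebra.algebraMap_eq_smul_one s,
          Algebra.algebraMap_eq_smul_one (r * s), MvPolynomial.C_eq_smul_one,
          TensorProduct.smul_tmul_smul, Algebra.TensorProduct.one_def]
      · rw [inv_mul_cancel₀ (by exact_mod_cast h0.ne'), one_smul, formsAug_tmul]
        have : MvPolynomial.aeval (0 : Fin n → ℚ) (MvPolynomial.monomial m r) *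
            ExteriorAlgebra.algebraMapInv α = 0 := by
          cases p with
          | succ p => rw [algebraMapInv_of_mem hα, mul_zero]
          | zero =>
            have hm : m ≠ 0 := by rintro rfl; simp at h0
            rw [MvPolynomial.aeval_zero, MvPolynomial.constantCoeff_monomial, if_neg hm, map_zero,
              zero_mul]
        rw [this, map_zero, sub_zero]

end Poincare

end Deligne
end

theorem mainTheorem5 {H : Type*} [AddCommGroup H] [Module ℚ H] (h : Deligne.DGLA H)
    [h.IsNilpotent] [h.IsGENegOne] (n : ℕ) :
    Deligne.IsBiequivalence ((Deligne.Omega n).const h).mc.toPseudofunctor ∧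
      ∀ μ : h.MC, (((Deligne.Omega n).const h).mc.mapFunctor μ μ).IsEquivalence :=
  ⟨((Deligne.omegaContraction n).tensor h).isBiequivalence,
    fun μ => ((Deligne.omegaContraction n).tensor h).isEquivalence_mapFunctor μ μ⟩
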